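/- **Theorem (SLT existence in frozen networks).** For every depth $L\ge 1$ there are constants $C_0,C_0',C'>0$ and a positive function $C$ on $(0,1)^2$, depending only on $L$, such that the following holds. *Target.* Let $f_T$ be a fully connected network of depth $L$ with widths $n_{T,0}=d,n_{T,1},\dots,n_{T,L}\ge 1$, given by $x^{(0)}=x$, $x^{(l)}=\max(0,W^{(l)}x^{(l-1)}+b^{(l)})$ for $1\le l<L$, and $f_T(x)=W^{(L)}x^{(L-1)}+b^{(L)}$, all of whose weights and biases lie in $[-1,1]$. Let $N_T$ be its number of weights and biases, and let $\mathcal D\subset\mathbb R^d$ be a compact set of inputs. *Source.* Let $f_S$ be a ReLU network of the same kind with input dimension $d$ and $L+1$ layers, numbered $0,1,\dots,L$, of widths $n_{S,0},\dots,n_{S,L}$, where $n_{S,L}\ge n_{T,L}$. Its weights and biases $\theta_S$ are independent and uniform on $[-1,1]$. Independently, in each layer $2\le l\le L$, every weight and bias is pruned with probability $p_l\in(0,1)$, and selected for locking with probability $q_l\in(0,1)$, all these events being independent; in layers $0$ and $1$ nothing is pruned or locked. A binary mask $m_S$ is admissible if it is $0$ on every pruned parameter and $1$ on every non-pruned parameter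 selected for locking; elsewhere it is arbitrary. *Tolerances.* Let $\varepsilon,\delta\in(0,1)$, $\gamma\ge 0$, $B_l=\sup_{x\in\mathcal D}\|x^{(l)}\|_1$, let $\|\cdot\|_\infty$ be the maximal absolute row sum, and for $1\le l\le L$ put $$\varepsilon_l=\frac{\varepsilon}{n_{T,L}\,L}\Big[(1+B_{l-1})\Big(1+\frac{\varepsilon}{L}\Big)\prod_{k=l+1}^{L-1}\Big(\max\{1,\|W^{(k)}\|_\infty\}+\frac{\varepsilon}{L}\Big)\Big]^{-1}.$$ Put $$\rho=\Big(\frac{N_T}{\kappa}\Big)^{1+\gamma}\log\frac{1}{\min\{\min_{1\le l\le L}\varepsilon_l,\ \delta\}},\qquad \kappa=\min_{2\le l\le L}(1-p_l)(1-q_l)\quad(\kappa=1\text{ if }L=1).$$ *Widths.* Write $C_l=C(p_{l+1},q_{l+1})$ for $1\le l<L$, and assume $$n_{S,0}\ \ge\ C_0\log\Big(\frac{C_0'}{\min\{\varepsilon_1,\delta/\rho\}}\Big)\,d,\qquad n_{S,l}\ \ge\ C_l\log\Big(\frac{C'}{\min\{\varepsilon_l,\delta/\rho\}}\Big)\,n_{T,l}\quad(1\le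 l<L).$$ Assume also that no frozen hidden layer is exponentially wider than an earlier layer, in the sense that $n_{S,l}\ge C_l\,\log(n_{S,k})\,n_{T,l}$ whenever $0\le l<k$ and $2\le k<L$. *Conclusion.* With probability at least $1-\delta$ there is an admissible mask $m_S$ such that, for every output component $1\le i\le n_{T,L}$, $$\max_{x\in\mathcal D}\big|f_{T,i}(x)-f_{S,i}(x;\theta_S\odot m_S)\big|<\varepsilon .$$ -/

import Mathlib

open scoped ENNReal

namespace FrozenNet

/-- Index of a parameter of a fully connected network with `k` affine layers, where `w 0` is the
input dimension and affine layer `l` (`0 ≤ l < k`) maps `w l` neurons to `w (l + 1)` neurons.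
`⟨l, i, some j⟩` is the weight from neuron `j` to neuron `i`, and `⟨l, i, none⟩` is the bias of
neuron `i`. -/
abbrev Param (w : ℕ → ℕ) (k : ℕ) : Type :=
  (l : Fin k) × (Fin (w (l + 1)) × Option (Fin (w l)))

/-- The affine map `y ↦ W y + b` of layer `l`. -/
def affine {w : ℕ → ℕ} {k : ℕ} (θ : Param w k → ℝ) (l : Fin k) (y : Fin (w l) → ℝ) :
    Fin (w (l + 1)) → ℝ :=
  fun i => (∑ j, θ ⟨l, i, some j⟩ * y j) + θ ⟨l, i, none⟩

/-- The neurons after `l` layers with ReLU activation; `neurons θ x 0 = x`. -/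
def neurons {w : ℕ → ℕ} {k : ℕ} (θ : Param w k → ℝ) (x : Fin (w 0) → ℝ) :
    (l : ℕ) → Fin (w l) → ℝ
  | 0 => x
  | l + 1 => if h : l < k then fun i => max 0 (affine θ ⟨l, h⟩ (neurons θ x l) i) else 0

/-- The function computed by a ReLU network of depth `k`: ReLU after every layer except the last
one, whose affine output is returned. -/
def netFun {w : ℕ → ℕ} : {k : ℕ} → (Param w k → ℝ) → (Fin (w 0) → ℝ) → Fin (w k) → ℝ
  | 0, _, x => x
  | m + 1, θ, x => affine θ (Fin.last m) (neurons θ x m)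

/-- The operator norm `‖W‖_∞` (maximal absolute row sum) of the weight matrix of layer `l`,
the layers being counted from `0`. -/
noncomputable def weightNorm {w : ℕ → ℕ} {k : ℕ} (θ : Param w k → ℝ) (l : ℕ) : ℝ :=
  if h : l < k then ⨆ i : Fin (w (l + 1)), ∑ j : Fin (w l), |θ ⟨⟨l, h⟩, i, some j⟩| else 0

/-- `B_l = sup_{x ∈ D} ‖x^{(l)}‖₁`. -/
noncomputable def actBound {w : ℕ → ℕ} {k : ℕ} (θ : Param w k → ℝ) (D : Set (Fin (w 0) → ℝ))
    (l : ℕ) : ℝ :=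
  sSup ((fun x => ∑ i, |neurons θ x l i|) '' D)

/-- The parameter tolerance `ε_l` of layer `l ∈ {1, …, L}` of a target network of depth `L`:
`ε_l = ε / (n_L L) · [(1 + B_{l-1}) (1 + ε/L) ∏_{k=l+1}^{L-1} (max{1, ‖W^{(k)}‖_∞} + ε/L)]⁻¹`.
(The matrix `W^{(k+1)}` belongs to the parameters with layer index `k`.) -/
noncomputable def tol {n : ℕ → ℕ} {L : ℕ} (θ : Param n L → ℝ) (D : Set (Fin (n 0) → ℝ))
    (ε : ℝ) (l : ℕ) : ℝ :=
  ε / (n L * L) *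
    ((1 + actBound θ D (l - 1)) * (1 + ε / L) *
      ∏ k ∈ Finset.Ico l (L - 1), (max 1 (weightNorm θ k) + ε / L))⁻¹

/-- The smallest probability, over the frozen layers `2, …, L`, that a parameter is free, i.e.
neither pruned nor locked (and `1` if no layer is frozen). -/
noncomputable def freeRatio (L : ℕ) (p q : ℕ → ℝ) : ℝ :=
  (Finset.Icc 2 L).fold min 1 fun l => (1 - p l) * (1 - q l)

/-- `ρ = (N_T / κ)^{1+γ} log (1 / min {min_l ε_l, δ})`, where `N_T` is the number of parameters of
the target network and `κ` is the smallest probability that a parameter is free. -/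
noncomputable def rho {n : ℕ → ℕ} {L : ℕ} (θ : Param n L → ℝ) (D : Set (Fin (n 0) → ℝ))
    (p q : ℕ → ℝ) (γ ε δ : ℝ) : ℝ :=
  ((Fintype.card (Param n L) : ℝ) / freeRatio L p q) ^ (1 + γ) *
    Real.log (1 / (Finset.Icc 1 L).fold min δ (tol θ D ε))

/-- Widths of the source network: input dimension `d`, then the layers `0, 1, 2, …` of widths
`nS 0, nS 1, nS 2, …`. -/
def srcWidth (d : ℕ) (nS : ℕ → ℕ) : ℕ → ℕ
  | 0 => d
  | l + 1 => nS l

/-- The uniform distribution `U[-1, 1]`. -/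
noncomputable def unif : MeasureTheory.Measure ℝ :=
  ProbabilityTheory.cond MeasureTheory.volume (Set.Icc (-1) 1)

/-- The Bernoulli distribution with success probability `a ∈ [0, 1]`. -/
noncomputable def bern (a : ℝ) : MeasureTheory.Measure Bool :=
  ENNReal.ofReal a • MeasureTheory.Measure.dirac true +
    ENNReal.ofReal (1 - a) • MeasureTheory.Measure.dirac false

/-- Joint law of a source parameter: its value is `U[-1, 1]`, its pruning indicator is `Ber(p)` and
its locking indicator is `Ber(q)`, all independent. -/
noncomputable def paramLaw (p q : ℝ) : MeasureTheory.Measure (ℝ × Bool × Bool) :=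
  unif.prod ((bern p).prod (bern q))

/-- The ratio in force in layer `l`: nothing is pruned or locked in layers `0` and `1`. -/
def layerRatio (p : ℕ → ℝ) (l : ℕ) : ℝ :=
  if l < 2 then 0 else p l

/-- Law of the randomly frozen source network: the parameters (value, pruning indicator, locking
indicator) are independent, with the pruning and locking ratio of their layer. -/
noncomputable def sourceLaw (w : ℕ → ℕ) (k : ℕ) (p q : ℕ → ℝ) :
    MeasureTheory.Measure (Param w k → ℝ × Bool × Bool) :=
  MeasureTheory.Measure.pi fun e => paramLaw (layerRatio p e.1) (layerRatio q e.1)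

/-- A binary mask respects the freezing pattern of `ω` if it removes every pruned parameter and
keeps every locked parameter that has not been pruned. It is arbitrary elsewhere. -/
def Respects {w : ℕ → ℕ} {k : ℕ} (ω : Param w k → ℝ × Bool × Bool) (m : Param w k → Bool) : Prop :=
  ∀ e, ((ω e).2.1 = true → m e = false) ∧
    ((ω e).2.1 = false → (ω e).2.2 = true → m e = true)

/-- The masked parameters `θ_S ⊙ m`. -/
def masked {w : ℕ → ℕ} {k : ℕ} (ω : Param w k → ℝ × Bool × Bool) (m : Param w k → Bool) :
    Param w k → ℝ :=
  fun e => if m e then (ω e).1 else 0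

end FrozenNet

/-! Every target weight is realized by a random subset sum. For `1 ≤ r < L`, the neurons used in
layer `r` of the source are divided into groups of copies of the neurons of target layer `r`, plus
one group of copies of a constant neuron of value `1`. The weights leaving the constant group play
the role of biases, because a single frozen bias cannot be tuned. A copy of neuron `i` sees the
group of neuron `o` through many independent weights, and the mask keeps free ones among them whose
sum is close to the target weight.

The probabilistic engine is random subset sum in Lueker's style. Let `A` be the set of points of a
window that are already reached up to `ε`. Adding one more random element multiplies the expected
odds `1 / (2|A|) - 1` by at most `1 - κ / 4` (`integral_odds_extend_le`), so Markov's inequality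
gives an exponentially fine net. Locked weights cannot be removed, so their sum shifts the target.
They are centred and bounded, whereas the free weights of either sign have a sum of linear order. By
a Chernoff bound, half of the free weights can therefore compensate the shift up to the size of the
window, and the other half finishes (`exists_robust_subset_sum`).

The first target layer uses the unfrozen source layers `0` and `1`. A neuron of layer `0` keeps a
single weight `v` and, by positive homogeneity of ReLU, outputs `|v|` times the positive or negative
part of one input. Products of two weights along a path then serve as summands
(`dominatesUniform_mul_gate`).

`Good.exists_mask` propagates errors deterministically. All weights are at most `1` in absolute
value, so a layer amplifies the incoming error by at most its number of used neurons. The product of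
the later widths must be beaten by the accuracy of the subset sums, which is exponentially small in
the group size; this is where the comparison of `log (nS k)` with earlier widths enters. Layer `1`
needs no such comparison: it is unfrozen and can be thinned to `(n 1 + 1) * m` neurons, with `m` of
logarithmic order.

For the final accounting, put `y = exp (-Λ)` with `y * ∏ nS k = μ / C'`. The widths yield accuracy
`y ^ 8`, and all losses (cardinalities, `1 / κ`, the thinned width) are at most polynomial in `1 /
y`, since `μ ≤ δ / ρ` and `ρ ≥ N / (2κ)`. -/

namespace FrozenNet

/-! ### Random subset sum: exponentially fine nets of a window -/

section SubsetSum

open MeasureTheory Set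

/-- The window of targets of the random subset sum process. -/
abbrev window : Set ℝ := Icc (-(1 / 4)) (1 / 4)

/-- The points of the window that are reached from `A` by adding `y` or nothing. -/
def extend (y : ℝ) (A : Set ℝ) : Set ℝ := {z | z ∈ window ∧ (z ∈ A ∨ z - y ∈ A)}

/-- `ν` dominates `κ` times the Lebesgue measure on `[-1/2, 1/2]`. -/
def DominatesUniform (κ : ℝ) (ν : Measure ℝ) : Prop :=
  ∀ B, MeasurableSet B → B ⊆ Icc (-(1 / 2)) (1 / 2) → ENNReal.ofReal κ * volume B ≤ ν B

theorem DominatesUniform.le_one {κ : ℝ} {ν : Measure ℝ} [IsProbabilityMeasure ν]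
    (h : DominatesUniform κ ν) : κ ≤ 1 := by
  have h1 := (h (Icc (-(1 / 2)) (1 / 2)) measurableSet_Icc subset_rfl).trans prob_le_one
  rw [Real.volume_Icc] at h1
  norm_num at h1
  exact h1

/-- The odds against a uniformly chosen point of the window lying in `A ⊆ window`. -/
noncomputable def odds (A : Set ℝ) : ℝ := 1 / (2 * volume.real A) - 1

theorem extend_subset (y : ℝ) (A : Set ℝ) : extend y A ⊆ window := fun _ hz => hz.1

theorem subset_extend {A : Set ℝ} (hA : A ⊆ window) (y : ℝ) : A ⊆ extend y A :=
  fun _ hz => ⟨hA hz, Or.inl hz⟩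

theorem volume_ne_top_of_subset_window {A : Set ℝ} (hA : A ⊆ window) : volume A ≠ ∞ :=
  ne_top_of_le_ne_top (by rw [Real.volume_Icc]; exact ENNReal.ofReal_ne_top) (measure_mono hA)

theorem measureReal_window : volume.real window = 1 / 2 := by
  rw [Measure.real, Real.volume_Icc, ENNReal.toReal_ofReal] <;> norm_num

theorem measureReal_le_of_subset_window {A : Set ℝ} (hA : A ⊆ window) :
    volume.real A ≤ 1 / 2 := by
  rw [← measureReal_window]
  exact measureReal_mono hA (volume_ne_top_of_subset_window subset_rfl)

theorem measureReal_extend_le {A : Set ℝ} (hA : A ⊆ window) (y : ℝ) :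
    volume.real (extend y A) ≤ 2 * volume.real A := by
  have hsub : extend y A ⊆ A ∪ (fun z => z - y) ⁻¹' A := fun z hz => hz.2
  have hpre : volume ((fun z => z - y) ⁻¹' A) = volume A := by
    simp [sub_eq_add_neg]
  have hfin := volume_ne_top_of_subset_window hA
  calc volume.real (extend y A) ≤ volume.real (A ∪ (fun z => z - y) ⁻¹' A) :=
        measureReal_mono hsub (measure_union_ne_top hfin (by rwa [hpre]))
    _ ≤ volume.real A + volume.real ((fun z => z - y) ⁻¹' A) := measureReal_union_le _ _
    _ = 2 * volume.real A := by rw [Measure.real, Measure.real, hpre]; ring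

theorem measurableSet_extend_prod {α : Type*} [MeasurableSpace α] {f : α → ℝ} (hf : Measurable f)
    {S : Set (α × ℝ)} (hS : MeasurableSet S) :
    MeasurableSet {p : α × ℝ | p.2 ∈ extend (f p.1) {z | (p.1, z) ∈ S}} := by
  have h1 : MeasurableSet {p : α × ℝ | p.2 ∈ window} := measurable_snd measurableSet_Icc
  have h2 : MeasurableSet {p : α × ℝ | (p.1, p.2 - f p.1) ∈ S} :=
    (measurable_fst.prodMk (measurable_snd.sub (hf.comp measurable_fst))) hS
  exact h1.inter (hS.union h2)

theorem measurable_measureReal_extend {A : Set ℝ} (hA : MeasurableSet A) :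
    Measurable fun y => volume.real (extend y A) := by
  have h : MeasurableSet {p : ℝ × ℝ | p.2 ∈ extend p.1 A} :=
    measurableSet_extend_prod (S := {p | p.2 ∈ A}) measurable_id (measurable_snd hA)
  exact (measurable_measure_prodMk_left h).ennreal_toReal

theorem integrable_measureReal_extend {A : Set ℝ} (hA : MeasurableSet A) (ν : Measure ℝ)
    [IsProbabilityMeasure ν] : Integrable (fun y => volume.real (extend y A)) ν := by
  refine Integrable.of_bound (measurable_measureReal_extend hA).aestronglyMeasurable (1 / 2)
    (ae_of_all _ fun y => ?_)
  rw [Real.norm_of_nonneg measureReal_nonneg]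
  exact measureReal_le_of_subset_window (extend_subset y A)

/-- For `z` in the window but not in `A`, the set `z - A` lies in `[-1/2, 1/2]`, so the random
element falls into it with probability at least `κ |A|`. Tonelli over `z` gives the expected gain.
-/
theorem le_integral_measureReal_extend {A : Set ℝ} (hAm : MeasurableSet A) (hA : A ⊆ window)
    {ν : Measure ℝ} [IsProbabilityMeasure ν] {κ : ℝ} (hκ : 0 ≤ κ) (hν : DominatesUniform κ ν) :
    volume.real A + κ * (1 / 2 - volume.real A) * volume.real A
      ≤ ∫ y, volume.real (extend y A) ∂ν := by
  have hfin := volume_ne_top_of_subset_window hA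
  set S : Set (ℝ × ℝ) := {p | p.2 ∈ window \ A ∧ p.2 - p.1 ∈ A} with hS
  have hSm : MeasurableSet S := by
    have h1 : MeasurableSet {p : ℝ × ℝ | p.2 ∈ window \ A} :=
      measurable_snd (measurableSet_Icc.diff hAm)
    have h2 : MeasurableSet {p : ℝ × ℝ | p.2 - p.1 ∈ A} :=
      (measurable_snd.sub measurable_fst) hAm
    exact h1.inter h2
  have hsub : ∀ y, Prod.mk y ⁻¹' S ⊆ window := fun y z hz => hz.1.1
  have hext : ∀ y, volume.real (extend y A) = volume.real A + volume.real (Prod.mk y ⁻¹' S) := by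
    intro y
    rw [← measureReal_union _ (measurable_prodMk_left hSm) hfin
      (volume_ne_top_of_subset_window (hsub y))]
    · congr 1
      ext z
      simp only [extend, hS, mem_ofPred_eq, mem_union, mem_preimage, mem_sdiff]
      constructor
      · rintro ⟨h1, h2⟩
        by_cases hz : z ∈ A
        · exact Or.inl hz
        · exact Or.inr ⟨⟨h1, hz⟩, h2.resolve_left hz⟩
      · rintro (h | h)
        · exact ⟨hA h, Or.inl h⟩
        · exact ⟨h.1.1, Or.inr h.2⟩
    · exact disjoint_left.2 fun z hz h => h.1.2 hz
  have hmeas : Measurable fun y => volume.real (Prod.mk y ⁻¹' S) :=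
    (measurable_measure_prodMk_left hSm).ennreal_toReal
  have hint : Integrable (fun y => volume.real (Prod.mk y ⁻¹' S)) ν := by
    refine Integrable.of_bound hmeas.aestronglyMeasurable (1 / 2) (ae_of_all _ fun y => ?_)
    rw [Real.norm_of_nonneg measureReal_nonneg]
    exact measureReal_le_of_subset_window (hsub y)
  have hI : ∫ y, volume.real (extend y A) ∂ν
      = volume.real A + ∫ y, volume.real (Prod.mk y ⁻¹' S) ∂ν := by
    simp_rw [hext]
    rw [integral_add (integrable_const _) hint]
    simp
  rw [hI]
  gcongr
  have h1 : ∫ y, volume.real (Prod.mk y ⁻¹' S) ∂ν = ((ν.prod volume) S).toReal := by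
    rw [Measure.prod_apply hSm]
    exact integral_toReal (measurable_measure_prodMk_left hSm).aemeasurable
      (ae_of_all _ fun y => (volume_ne_top_of_subset_window (hsub y)).lt_top)
  have h2 : ENNReal.ofReal κ * volume A * volume (window \ A) ≤ (ν.prod volume) S := by
    rw [Measure.prod_apply_symm hSm, ← setLIntegral_const]
    rw [← lintegral_indicator (measurableSet_Icc.diff hAm)]
    refine lintegral_mono fun z => ?_
    by_cases hz : z ∈ window \ A
    · rw [indicator_of_mem hz]
      have hpre : volume ((fun y => z - y) ⁻¹' A) = volume A := by
        simpa using (Measure.measurePreserving_sub_left volume z).measure_preimage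
          hAm.nullMeasurableSet
      rw [← hpre]
      refine (hν _ ((measurable_const.sub measurable_id) hAm) ?_).trans (measure_mono ?_)
      · intro y hy
        have h3 : z - y ∈ window := hA hy
        have h4 := hz.1
        simp only [window, mem_Icc] at h3 h4 ⊢
        constructor <;> linarith [h3.1, h3.2, h4.1, h4.2]
      · intro y hy
        exact ⟨hz, hy⟩
    · rw [indicator_of_notMem hz]
      exact zero_le
  have hprodfin : (ν.prod volume) S ≠ ∞ := by
    refine ne_top_of_le_ne_top ?_ (measure_mono (show S ⊆ univ ×ˢ window from
      fun p hp => ⟨mem_univ _, hp.1.1⟩))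
    rw [Measure.prod_prod]
    simp [window]
  have hdiff : volume.real (window \ A) = 1 / 2 - volume.real A := by
    rw [measureReal_sdiff hA hAm (volume_ne_top_of_subset_window subset_rfl), measureReal_window]
  have h3 := ENNReal.toReal_mono hprodfin h2
  rw [ENNReal.toReal_mul, ENNReal.toReal_mul, ENNReal.toReal_ofReal hκ] at h3
  rw [h1, ← hdiff]
  calc κ * volume.real (window \ A) * volume.real A
      = κ * volume.real A * volume.real (window \ A) := by ring
    _ ≤ _ := h3

theorem odds_nonneg {A : Set ℝ} (hA : A ⊆ window) (h0 : 0 < volume.real A) : 0 ≤ odds A := by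
  have := measureReal_le_of_subset_window hA
  rw [odds, sub_nonneg, le_div_iff₀ (by positivity)]
  linarith

/-- The new volume `v` lies in `[a, 2 * a]`, and on this interval the convex function `1 / (2 * v)`
is below its chord. The chord is affine, so only the expectation of `v` matters, and inserting its
lower bound gives exactly the factor `1 - κ / 4`. -/
theorem integral_odds_extend_le {A : Set ℝ} (hAm : MeasurableSet A) (hA : A ⊆ window)
    (h0 : 0 < volume.real A) {ν : Measure ℝ} [IsProbabilityMeasure ν] {κ : ℝ} (hκ : 0 ≤ κ)
    (hν : DominatesUniform κ ν) :
    ∫⁻ y, ENNReal.ofReal (odds (extend y A)) ∂ν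
      ≤ ENNReal.ofReal (1 - κ / 4) * ENNReal.ofReal (odds A) := by
  set a := volume.real A with ha
  have hV := le_integral_measureReal_extend hAm hA hκ hν
  have hint := integrable_measureReal_extend hAm ν
  have hκ1 := hν.le_one
  have hpt : ∀ y, odds (extend y A) ≤
      (3 / (4 * a) - 1) - (1 / (4 * a ^ 2)) * volume.real (extend y A) := by
    intro y
    have h1 : a ≤ volume.real (extend y A) :=
      measureReal_mono (subset_extend hA y) (volume_ne_top_of_subset_window (extend_subset y A))
    have h2 := measureReal_extend_le hA y
    rw [← ha] at h2
    set v := volume.real (extend y A)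
    have hv : 0 < v := h0.trans_le h1
    have h3 : 3 / (4 * a) - 1 - 1 / (4 * a ^ 2) * v - (1 / (2 * v) - 1)
        = (v - a) * (2 * a - v) / (4 * a ^ 2 * v) := by field_simp; ring
    have h4 : 0 ≤ (v - a) * (2 * a - v) / (4 * a ^ 2 * v) :=
      div_nonneg (mul_nonneg (by linarith) (by linarith)) (by positivity)
    rw [odds]
    linarith
  have hub : Integrable (fun y => (3 / (4 * a) - 1) -
      (1 / (4 * a ^ 2)) * volume.real (extend y A)) ν :=
    (integrable_const _).sub (hint.const_mul _)
  calc ∫⁻ y, ENNReal.ofReal (odds (extend y A)) ∂ν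
      ≤ ∫⁻ y, ENNReal.ofReal ((3 / (4 * a) - 1) -
          (1 / (4 * a ^ 2)) * volume.real (extend y A)) ∂ν :=
        lintegral_mono fun y => ENNReal.ofReal_le_ofReal (hpt y)
    _ = ENNReal.ofReal (∫ y, ((3 / (4 * a) - 1) -
          (1 / (4 * a ^ 2)) * volume.real (extend y A)) ∂ν) := by
        rw [ofReal_integral_eq_lintegral_ofReal hub (ae_of_all _ fun y => ?_)]
        refine (odds_nonneg (extend_subset y A) ?_).trans (hpt y)
        exact h0.trans_le (measureReal_mono (subset_extend hA y)
          (volume_ne_top_of_subset_window (extend_subset y A)))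
    _ ≤ ENNReal.ofReal ((1 - κ / 4) * odds A) := by
        refine ENNReal.ofReal_le_ofReal ?_
        rw [integral_sub (integrable_const _) (hint.const_mul _), integral_const_mul]
        simp only [integral_const, probReal_univ, one_smul]
        have h5 : 1 / (4 * a ^ 2) * (a + κ * (1 / 2 - a) * a)
            ≤ 1 / (4 * a ^ 2) * ∫ y, volume.real (extend y A) ∂ν := by gcongr
        have h6 : (1 - κ / 4) * odds A
            = 3 / (4 * a) - 1 - 1 / (4 * a ^ 2) * (a + κ * (1 / 2 - a) * a) := by
          rw [odds, ← ha]; field_simp; ring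
        linarith
    _ = _ := ENNReal.ofReal_mul (by linarith)

/-- The points of the window that are reached, up to `ε`, by partial sums of `y` whose path stays
in the window. -/
def reached (ε : ℝ) : (n : ℕ) → (Fin n → ℝ) → Set ℝ
  | 0, _ => Icc (-ε) ε
  | n + 1, y => extend (y 0) (reached ε n fun i => y i.succ)

theorem exists_sum_of_mem_reached {ε : ℝ} : ∀ {n : ℕ} {y : Fin n → ℝ} {z : ℝ},
    z ∈ reached ε n y → ∃ U : Finset (Fin n), |∑ i ∈ U, y i - z| ≤ ε
  | 0, y, z, hz => ⟨∅, by
      have h : z ∈ Icc (-ε) ε := hz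
      simpa [abs_le] using h⟩
  | n + 1, y, z, hz => by
      rcases hz.2 with h | h
      · obtain ⟨U, hU⟩ := exists_sum_of_mem_reached h
        exact ⟨U.map (Fin.succEmb n), by simpa using hU⟩
      · obtain ⟨U, hU⟩ := exists_sum_of_mem_reached h
        refine ⟨insert 0 (U.map (Fin.succEmb n)), ?_⟩
        rw [Finset.sum_insert (by simp)]
        simp only [Finset.sum_map, Fin.coe_succEmb]
        convert hU using 2
        ring

theorem measurableSet_reached (ε : ℝ) : ∀ n : ℕ,
    MeasurableSet {p : (Fin n → ℝ) × ℝ | p.2 ∈ reached ε n p.1}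
  | 0 => measurable_snd measurableSet_Icc
  | n + 1 => by
      have h1 : Measurable fun p : (Fin (n + 1) → ℝ) × ℝ => ((fun i : Fin n => p.1 i.succ), p.2) := by
        fun_prop
      exact measurableSet_extend_prod (f := fun y : Fin (n + 1) → ℝ => y 0) (by fun_prop)
        (h1 (measurableSet_reached ε n))

theorem measurableSet_reached_apply (ε : ℝ) (n : ℕ) (y : Fin n → ℝ) :
    MeasurableSet (reached ε n y) :=
  measurable_prodMk_left (x := y) (measurableSet_reached ε n)

theorem measurable_odds_reached (ε : ℝ) (n : ℕ) :
    Measurable fun y : Fin n → ℝ => odds (reached ε n y) := by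
  have h : Measurable fun y : Fin n → ℝ => volume.real (reached ε n y) :=
    (measurable_measure_prodMk_left (measurableSet_reached ε n)).ennreal_toReal
  unfold odds
  fun_prop

theorem reached_subset {ε : ℝ} (hε : ε ≤ 1 / 4) : ∀ (n : ℕ) (y : Fin n → ℝ),
    reached ε n y ⊆ window
  | 0, _ => Icc_subset_Icc (by linarith) hε
  | _ + 1, _ => extend_subset _ _

theorem Icc_subset_reached {ε : ℝ} (hε : ε ≤ 1 / 4) : ∀ (n : ℕ) (y : Fin n → ℝ),
    Icc (-ε) ε ⊆ reached ε n y
  | 0, _ => subset_rfl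
  | n + 1, _ => (Icc_subset_reached hε n _).trans (subset_extend (reached_subset hε n _) _)

theorem le_measureReal_reached {ε : ℝ} (hε0 : 0 < ε) (hε : ε ≤ 1 / 4) (n : ℕ) (y : Fin n → ℝ) :
    2 * ε ≤ volume.real (reached ε n y) := by
  have h := measureReal_mono (Icc_subset_reached hε n y)
    (volume_ne_top_of_subset_window (reached_subset hε n y))
  rw [Measure.real, Real.volume_Icc, ENNReal.toReal_ofReal (by linarith)] at h
  linarith

/-- Coordinate `0` is the element added last. With the other coordinates fixed, integrating over it
contracts the odds once; the initial interval `[-ε, ε]` has odds below `1 / (4 * ε)`. -/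
theorem lintegral_odds_reached_le {ε κ : ℝ} (hε0 : 0 < ε) (hε : ε ≤ 1 / 4) (hκ : 0 ≤ κ) :
    ∀ (n : ℕ) (ν : Fin n → Measure ℝ) [∀ i, IsProbabilityMeasure (ν i)],
      (∀ i, DominatesUniform κ (ν i)) →
      ∫⁻ y, ENNReal.ofReal (odds (reached ε n y)) ∂Measure.pi ν
        ≤ ENNReal.ofReal (1 - κ / 4) ^ n * ENNReal.ofReal (1 / (4 * ε))
  | 0, ν, _, _ => by
      have h : ∀ y : Fin 0 → ℝ, ENNReal.ofReal (odds (reached ε 0 y)) ≤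
          ENNReal.ofReal (1 / (4 * ε)) := by
        intro y
        refine ENNReal.ofReal_le_ofReal ?_
        rw [odds, reached, Measure.real, Real.volume_Icc, ENNReal.toReal_ofReal (by linarith)]
        have : 2 * (ε - -ε) = 4 * ε := by ring
        rw [this]
        linarith
      refine (lintegral_mono h).trans ?_
      simp
  | n + 1, ν, _, hν => by
      have hmp := measurePreserving_piFinSuccAbove ν 0
      have hmeas : Measurable fun p : ℝ × (Fin n → ℝ) =>
          ENNReal.ofReal (odds (extend p.1 (reached ε n p.2))) := by
        have h1 := (measurable_odds_reached ε (n + 1)).ennreal_ofReal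
        have h2 : Measurable fun p : ℝ × (Fin n → ℝ) => (Fin.cons p.1 p.2 : Fin (n + 1) → ℝ) := by
          refine measurable_pi_iff.2 fun i => ?_
          refine Fin.cases ?_ (fun j => ?_) i
          · simpa using measurable_fst
          · simpa [Function.comp_def] using (measurable_pi_apply j).comp measurable_snd
        have h3 := h1.comp h2
        simpa [Function.comp_def, reached] using h3
      have hcomp : ∫⁻ y, ENNReal.ofReal (odds (reached ε (n + 1) y)) ∂Measure.pi ν
          = ∫⁻ p, ENNReal.ofReal (odds (extend p.1 (reached ε n p.2)))
              ∂((ν 0).prod (Measure.pi fun j => ν ((0 : Fin (n + 1)).succAbove j))) := by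
        rw [← hmp.lintegral_comp hmeas]
        rfl
      rw [hcomp, lintegral_prod_symm _ hmeas.aemeasurable]
      calc _ ≤ ∫⁻ ys, ENNReal.ofReal (1 - κ / 4) * ENNReal.ofReal (odds (reached ε n ys))
              ∂(Measure.pi fun j => ν ((0 : Fin (n + 1)).succAbove j)) := by
            refine lintegral_mono fun ys => ?_
            refine integral_odds_extend_le (measurableSet_reached_apply ε n ys)
              (reached_subset hε n ys) ?_ hκ (hν 0)
            linarith [le_measureReal_reached hε0 hε n ys]
        _ ≤ _ := by
            rw [lintegral_const_mul _ (measurable_odds_reached ε n).ennreal_ofReal, pow_succ',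
              mul_assoc]
            gcongr
            exact lintegral_odds_reached_le hε0 hε hκ n _ fun i => hν _

/-- A subset of the window whose complement in the window has small volume is a net. -/
theorem exists_mem_of_odds_lt {A : Set ℝ} (hAm : MeasurableSet A) (hA : A ⊆ window)
    (h0 : 0 < volume.real A) {ε : ℝ} (hε0 : 0 < ε) (hε : ε ≤ 1 / 4) (h : odds A < 2 * ε)
    {z : ℝ} (hz : z ∈ window) : ∃ z' ∈ A, |z' - z| ≤ ε := by
  by_contra! hcon
  -- An interval of length `ε` with endpoint `z`, extended towards `0` so that it stays in the
  -- window.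
  obtain ⟨u, hu1, hu2, hu3⟩ : ∃ u, u ≤ z ∧ z ≤ u + ε ∧ Icc u (u + ε) ⊆ window := by
    obtain ⟨h1, h2⟩ := hz
    rcases le_total z 0 with h3 | h3
    · exact ⟨z, le_rfl, by linarith, Icc_subset_Icc h1 (by linarith)⟩
    · exact ⟨z - ε, by linarith, by linarith, Icc_subset_Icc (by linarith) (by linarith)⟩
  have hdisj : Icc u (u + ε) ⊆ window \ A := fun x hx => ⟨hu3 hx, fun hxA => by
    have := hcon x hxA
    have h2 : |x - z| ≤ ε := by
      rw [abs_le]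
      constructor <;> linarith [hx.1, hx.2]
    linarith⟩
  -- The complement of `A` has volume `odds A * |A| ≤ odds A / 2 < ε`, too little to contain this
  -- interval.
  have h1 := measureReal_mono hdisj (volume_ne_top_of_subset_window sdiff_subset)
  rw [measureReal_sdiff hA hAm (volume_ne_top_of_subset_window subset_rfl), measureReal_window, Measure.real, Real.volume_Icc,
    ENNReal.toReal_ofReal (by linarith)] at h1
  have h2 := measureReal_le_of_subset_window hA
  rw [odds, sub_lt_iff_lt_add, div_lt_iff₀ (by positivity)] at h
  nlinarith

/-- Random subset sum: with high probability the subset sums of independent real variables form an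
exponentially fine net of the window. -/
theorem pi_exists_not_reached_le {ε κ : ℝ} (hε0 : 0 < ε) (hε : ε ≤ 1 / 4) (hκ : 0 ≤ κ) {n : ℕ}
    (ν : Fin n → Measure ℝ) [∀ i, IsProbabilityMeasure (ν i)]
    (hν : ∀ i, DominatesUniform κ (ν i)) (hκ1 : κ ≤ 1) :
    ∃ S : Set (Fin n → ℝ), MeasurableSet S ∧
      Measure.pi ν S ≤ ENNReal.ofReal (Real.exp (-(κ * n / 4)) / (8 * ε ^ 2)) ∧
      ∀ y ∉ S, ∀ z ∈ window, ∃ U : Finset (Fin n), |∑ i ∈ U, y i - z| ≤ 2 * ε := by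
  refine ⟨{y | ENNReal.ofReal (2 * ε) ≤ ENNReal.ofReal (odds (reached ε n y))},
    measurableSet_le measurable_const (measurable_odds_reached ε n).ennreal_ofReal, ?_, ?_⟩
  -- Markov's inequality, at the threshold below which `exists_mem_of_odds_lt` applies.
  · have h1 := meas_ge_le_lintegral_div (μ := Measure.pi ν)
      (measurable_odds_reached ε n).ennreal_ofReal.aemeasurable
      (ε := ENNReal.ofReal (2 * ε)) (by simpa using hε0) ENNReal.ofReal_ne_top
    refine h1.trans ?_
    calc _ ≤ ENNReal.ofReal (1 - κ / 4) ^ n * ENNReal.ofReal (1 / (4 * ε)) /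
          ENNReal.ofReal (2 * ε) := by
            gcongr
            exact lintegral_odds_reached_le hε0 hε hκ n ν hν
      _ = ENNReal.ofReal ((1 - κ / 4) ^ n * (1 / (4 * ε)) / (2 * ε)) := by
            rw [← ENNReal.ofReal_pow (by linarith), ← ENNReal.ofReal_mul (by
              apply pow_nonneg; linarith), ENNReal.ofReal_div_of_pos (by linarith)]
      _ ≤ _ := by
            refine ENNReal.ofReal_le_ofReal ?_
            have h2 : (1 - κ / 4) ^ n ≤ Real.exp (-(κ * n / 4)) := by
              calc (1 - κ / 4) ^ n ≤ (Real.exp (-(κ / 4))) ^ n := by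
                    refine pow_le_pow_left₀ (by linarith) ?_ n
                    linarith [Real.add_one_le_exp (-(κ / 4))]
                _ = _ := by rw [← Real.exp_nat_mul]; congr 1; ring
            rw [mul_one_div, div_div, show 4 * ε * (2 * ε) = 8 * ε ^ 2 by ring]
            gcongr
  · intro y hy z hz
    have hlt : odds (reached ε n y) < 2 * ε := by
      by_contra! hcon
      exact hy (ENNReal.ofReal_le_ofReal hcon)
    obtain ⟨z', hz', hd⟩ := exists_mem_of_odds_lt (measurableSet_reached_apply ε n y)
      (reached_subset hε n y) (by linarith [le_measureReal_reached hε0 hε n y]) hε0 hε hlt hz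
    obtain ⟨U, hU⟩ := exists_sum_of_mem_reached hz'
    refine ⟨U, ?_⟩
    -- One `ε` comes from the radius of the initial interval, the other from the net property.
    calc |∑ i ∈ U, y i - z| = |(∑ i ∈ U, y i - z') + (z' - z)| := by ring_nf
      _ ≤ _ := (abs_add_le _ _).trans (by linarith)

end SubsetSum

/-! ### Subset sums in the presence of fixed summands -/

section RobustSubsetSum

open MeasureTheory ProbabilityTheory Set

/-- Greedy selection: nonnegative numbers that are at most `1/2` and whose sum is large enough have
a subset sum within `1/4` of a given target. -/
theorem exists_subset_sum_near {ι : Type*} [DecidableEq ι] (a : ι → ℝ) {r : ℝ} (hr : 0 ≤ r)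
    (s : Finset ι) (ha : ∀ i ∈ s, 0 ≤ a i ∧ a i ≤ 1 / 2) (hs : r - 1 / 4 ≤ ∑ i ∈ s, a i) :
    ∃ U ⊆ s, |∑ i ∈ U, a i - r| ≤ 1 / 4 := by
  induction s using Finset.induction_on with
  | empty =>
    refine ⟨∅, le_rfl, ?_⟩
    simp only [Finset.sum_empty] at hs ⊢
    rw [abs_le]
    constructor <;> linarith
  | insert i s hi ih =>
    have ha' : ∀ j ∈ s, 0 ≤ a j ∧ a j ≤ 1 / 2 := fun j hj => ha j (Finset.mem_insert_of_mem hj)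
    by_cases h : r - 1 / 4 ≤ ∑ j ∈ s, a j
    · obtain ⟨U, hU, h'⟩ := ih ha' h
      exact ⟨U, hU.trans (Finset.subset_insert _ _), h'⟩
    · refine ⟨insert i s, le_rfl, ?_⟩
      have h1 := ha i (Finset.mem_insert_self _ _)
      rw [Finset.sum_insert hi] at hs ⊢
      rw [abs_le]
      constructor <;> linarith [h1.1, h1.2]

/-- The value `y` if it lies in `[0, 1/2]`, and `0` otherwise. -/
noncomputable def smallPart (y : ℝ) : ℝ := (Icc (0 : ℝ) (1 / 2)).indicator id y

theorem smallPart_mem (y : ℝ) : 0 ≤ smallPart y ∧ smallPart y ≤ 1 / 2 := by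
  unfold smallPart
  by_cases h : y ∈ Icc (0 : ℝ) (1 / 2)
  · rw [indicator_of_mem h]; exact h
  · rw [indicator_of_notMem h]; norm_num

theorem measurable_smallPart : Measurable smallPart :=
  measurable_id.indicator measurableSet_Icc

/-- The bound is `κ` times the integral of `y` over `[0, 1/2]`. It is the drift that the free
elements supply against the fixed ones. -/
theorem le_integral_smallPart {κ : ℝ} {ν : Measure ℝ} [IsProbabilityMeasure ν] (hκ : 0 ≤ κ)
    (h : DominatesUniform κ ν) : κ / 8 ≤ ∫ y, smallPart y ∂ν := by
  have hle : ENNReal.ofReal κ • volume.restrict (Icc (0 : ℝ) (1 / 2)) ≤ ν := by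
    refine Measure.le_iff.2 fun B hB => ?_
    rw [Measure.smul_apply, Measure.restrict_apply hB, smul_eq_mul]
    refine (h _ (hB.inter measurableSet_Icc) ?_).trans (measure_mono inter_subset_left)
    exact inter_subset_right.trans (Icc_subset_Icc (by norm_num) le_rfl)
  have hint : Integrable smallPart ν := by
    refine Integrable.of_bound measurable_smallPart.aestronglyMeasurable (1 / 2)
      (ae_of_all _ fun y => ?_)
    rw [Real.norm_of_nonneg (smallPart_mem y).1]
    exact (smallPart_mem y).2
  have h1 := integral_mono_measure hle (ae_of_all _ fun y => (smallPart_mem y).1) hint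
  refine le_trans (le_of_eq ?_) h1
  rw [integral_smul_measure, ENNReal.toReal_ofReal hκ]
  have h2 : ∫ y in Icc (0 : ℝ) (1 / 2), smallPart y = ∫ y in Icc (0 : ℝ) (1 / 2), y :=
    setIntegral_congr_fun measurableSet_Icc fun y hy => by
      rw [smallPart, indicator_of_mem hy, id]
  rw [h2, integral_Icc_eq_integral_Ioc, ← intervalIntegral.integral_of_le (by norm_num),
    integral_id]
  norm_num
  ring

theorem DominatesUniform.map_neg {κ : ℝ} {ν : Measure ℝ} (h : DominatesUniform κ ν) :
    DominatesUniform κ (ν.map Neg.neg) := by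
  intro B hB hsub
  rw [Measure.map_apply measurable_neg hB]
  have h1 : volume (Neg.neg ⁻¹' B) = volume B :=
    (Measure.measurePreserving_neg (volume : Measure ℝ)).measure_preimage hB.nullMeasurableSet
  rw [← h1]
  refine h _ (measurable_neg hB) fun y hy => ?_
  have := hsub hy
  simp only [mem_Icc] at this ⊢
  constructor <;> linarith [this.1, this.2]

/-- Integrate `exp x ≤ 1 + x + x ^ 2`, valid for `|x| ≤ 1`. The constant `3 / 2` is a fixed element
(at most `1`) plus a small free part (at most `1 / 2`), and `lam ≤ 2 / 3` makes the exponent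
admissible. -/
theorem mgf_neg_le {Ω : Type*} [MeasurableSpace Ω] {P : Measure Ω} [IsProbabilityMeasure P]
    {Z : Ω → ℝ} (hZ : Measurable Z) (hb : ∀ᵐ ω ∂P, |Z ω| ≤ 3 / 2) {m lam : ℝ}
    (hm : m ≤ ∫ ω, Z ω ∂P) (h0 : 0 ≤ lam) (h1 : lam ≤ 2 / 3) :
    mgf Z P (-lam) ≤ Real.exp (-(lam * m) + 9 / 4 * lam ^ 2) := by
  have hint : Integrable Z P := Integrable.of_bound hZ.aestronglyMeasurable (3 / 2) hb
  have hpt : ∀ᵐ ω ∂P, Real.exp (-lam * Z ω) ≤ 1 - lam * Z ω + 9 / 4 * lam ^ 2 := by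
    filter_upwards [hb] with ω hω
    have hx : |-lam * Z ω| ≤ 1 := by
      rw [abs_mul, abs_neg, abs_of_nonneg h0]
      nlinarith [abs_nonneg (Z ω)]
    have h2 := (abs_le.1 (Real.abs_exp_sub_one_sub_id_le hx)).2
    have h3 : (Z ω) ^ 2 ≤ 9 / 4 := by
      rw [← sq_abs]; nlinarith [abs_nonneg (Z ω)]
    nlinarith [mul_le_mul_of_nonneg_left h3 (sq_nonneg lam)]
  have hint2 : Integrable (fun ω => 1 - lam * Z ω + 9 / 4 * lam ^ 2) P :=
    ((integrable_const _).sub (hint.const_mul _)).add (integrable_const _)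
  calc mgf Z P (-lam) = ∫ ω, Real.exp (-lam * Z ω) ∂P := rfl
    _ ≤ ∫ ω, (1 - lam * Z ω + 9 / 4 * lam ^ 2) ∂P :=
        integral_mono_of_nonneg (ae_of_all _ fun ω => (Real.exp_pos _).le) hint2 hpt
    _ = 1 - lam * ∫ ω, Z ω ∂P + 9 / 4 * lam ^ 2 := by
        rw [integral_add (by fun_prop) (integrable_const _),
          integral_sub (integrable_const _) (by fun_prop), integral_const_mul]
        simp
    _ ≤ 1 - lam * m + 9 / 4 * lam ^ 2 := by gcongr
    _ ≤ _ := by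
        have := Real.add_one_le_exp (-(lam * m) + 9 / 4 * lam ^ 2)
        linarith

/-- Chernoff bound for the lower tail of a sum of bounded independent variables. -/
theorem measure_sum_lt_two_le {Ω ι : Type*} [MeasurableSpace Ω] [Fintype ι] {P : Measure Ω}
    [IsProbabilityMeasure P] {Z : ι → Ω → ℝ} (hind : iIndepFun Z P) (hZ : ∀ i, Measurable (Z i))
    (hb : ∀ i, ∀ᵐ ω ∂P, |Z i ω| ≤ 3 / 2) {m : ι → ℝ} (hm : ∀ i, m i ≤ ∫ ω, Z i ω ∂P) {lam : ℝ}
    (h0 : 0 ≤ lam) (h1 : lam ≤ 2 / 3) :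
    P {ω | ∑ i, Z i ω < 2} ≤ ENNReal.ofReal
      (Real.exp (2 * lam - lam * ∑ i, m i + Fintype.card ι * (9 / 4 * lam ^ 2))) := by
  have hsum : ∀ᵐ ω ∂P, |(∑ i, Z i) ω| ≤ ∑ _i : ι, (3 / 2 : ℝ) := by
    filter_upwards [ae_all_iff.2 hb] with ω hω
    rw [Finset.sum_apply]
    exact (Finset.abs_sum_le_sum_abs _ _).trans (Finset.sum_le_sum fun i _ => hω i)
  have hmeas : Measurable (∑ i, Z i) := by fun_prop
  have hint : Integrable (fun ω => Real.exp (-lam * (∑ i, Z i) ω)) P := by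
    refine Integrable.of_bound (by fun_prop) (Real.exp (lam * ∑ _i : ι, (3 / 2 : ℝ))) ?_
    filter_upwards [hsum] with ω hω
    rw [Real.norm_of_nonneg (Real.exp_pos _).le]
    refine Real.exp_le_exp.2 ?_
    nlinarith [(abs_le.1 hω).1]
  have h2 := measure_le_le_exp_mul_mgf (μ := P) (X := ∑ i, Z i) (t := -lam) 2 (by linarith) hint
  rw [hind.mgf_sum hZ] at h2
  have h3 : P.real {ω | (∑ i, Z i) ω ≤ 2} ≤
      Real.exp (2 * lam - lam * ∑ i, m i + Fintype.card ι * (9 / 4 * lam ^ 2)) := by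
    refine h2.trans ?_
    calc _ ≤ Real.exp (- -lam * 2) * ∏ i, Real.exp (-(lam * m i) + 9 / 4 * lam ^ 2) := by
          gcongr with i
          · exact fun i _ => mgf_nonneg
          · exact mgf_neg_le (hZ i) (hb i) (hm i) h0 h1
      _ = _ := by
          rw [← Real.exp_sum, ← Real.exp_add, Finset.sum_add_distrib, Finset.sum_neg_distrib,
            ← Finset.mul_sum]
          simp only [Finset.sum_const, Finset.card_univ, nsmul_eq_mul]
          congr 1; ring
  calc P {ω | ∑ i, Z i ω < 2} ≤ P {ω | (∑ i, Z i) ω ≤ 2} :=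
        measure_mono fun ω hω => by
          simp only [mem_ofPred_eq, Finset.sum_apply] at hω ⊢
          exact hω.le
    _ ≤ _ := by
        rw [← ofReal_measureReal]
        exact ENNReal.ofReal_le_ofReal h3

/-- The free elements outside `T` outweigh the fixed elements. -/
theorem measure_sum_smallPart_lt_two_le {Ω ι : Type*} [MeasurableSpace Ω] [Fintype ι]
    [DecidableEq ι] {P : Measure Ω}
    [IsProbabilityMeasure P] {Y K : ι → Ω → ℝ} (hY : ∀ i, Measurable (Y i))
    (hK : ∀ i, Measurable (K i)) (hind : iIndepFun (fun i ω => (Y i ω, K i ω)) P) {κ : ℝ}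
    (hκ : 0 ≤ κ) (hκ1 : κ ≤ 1) (hdom : ∀ i, DominatesUniform κ (P.map (Y i)))
    (hKb : ∀ i, ∀ᵐ ω ∂P, |K i ω| ≤ 1) (hK0 : ∀ i, ∫ ω, K i ω ∂P = 0)
    (T : Finset ι) (hT : 2 * T.card ≤ Fintype.card ι) :
    P {ω | ∑ i ∈ Tᶜ, smallPart (Y i ω) + ∑ i, K i ω < 2} ≤
      ENNReal.ofReal (2 * Real.exp (-(κ ^ 2 * Fintype.card ι / 2304))) := by
  set Z : ι → Ω → ℝ := fun i ω => (if i ∈ T then 0 else smallPart (Y i ω)) + K i ω with hZ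
  have hZm : ∀ i, Measurable (Z i) := fun i => by
    by_cases h : i ∈ T
    · simpa [hZ, h] using hK i
    · simp only [hZ, h, if_false]
      exact (measurable_smallPart.comp (hY i)).add (hK i)
  have hZind : iIndepFun Z P := by
    have := hind.comp (fun i p => (if i ∈ T then 0 else smallPart p.1) + p.2) (fun i => by
      by_cases h : i ∈ T
      · simpa [h] using measurable_snd
      · simp only [h, if_false]
        exact (measurable_smallPart.comp measurable_fst).add measurable_snd)
    exact this
  have hZb : ∀ i, ∀ᵐ ω ∂P, |Z i ω| ≤ 3 / 2 := fun i => by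
    filter_upwards [hKb i] with ω hω
    have h1 := smallPart_mem (Y i ω)
    have h2 := abs_le.1 hω
    rw [abs_le]
    by_cases h : i ∈ T
    · simp only [hZ, h, if_true]; constructor <;> linarith [h2.1, h2.2]
    · simp only [hZ, h, if_false]; constructor <;> linarith [h2.1, h2.2, h1.1, h1.2]
  have hKint : ∀ i, Integrable (K i) P := fun i =>
    Integrable.of_bound (hK i).aestronglyMeasurable 1 (hKb i)
  have hmean : ∀ i, (if i ∈ T then 0 else κ / 8) ≤ ∫ ω, Z i ω ∂P := fun i => by
    by_cases h : i ∈ T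
    · simp [hZ, h, hK0]
    · have hp : IsProbabilityMeasure (P.map (Y i)) :=
        Measure.isProbabilityMeasure_map (hY i).aemeasurable
      have h1 := le_integral_smallPart hκ (hdom i)
      rw [integral_map (hY i).aemeasurable measurable_smallPart.aestronglyMeasurable] at h1
      have h2 : Integrable (fun ω => smallPart (Y i ω)) P := by
        refine Integrable.of_bound (measurable_smallPart.comp (hY i)).aestronglyMeasurable (1 / 2)
          (ae_of_all _ fun ω => ?_)
        rw [Real.norm_of_nonneg (smallPart_mem _).1]
        exact (smallPart_mem _).2
      simp only [hZ, h, if_false]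
      rw [integral_add h2 (hKint i), hK0, add_zero]
      exact h1
  -- The mean is at least `κ / 16` per element, as at least half of the elements are outside `T`;
  -- `lam = κ / 72` minimizes `-lam * κ / 16 + 9 / 4 * lam ^ 2`, with value `-κ ^ 2 / 2304`.
  have h := measure_sum_lt_two_le hZind hZm hZb hmean (lam := κ / 72) (by positivity) (by linarith)
  have hset : {ω | ∑ i ∈ Tᶜ, smallPart (Y i ω) + ∑ i, K i ω < 2} = {ω | ∑ i, Z i ω < 2} := by
    ext ω
    simp only [mem_ofPred_eq, hZ, Finset.sum_add_distrib]
    rw [Finset.sum_ite, Finset.sum_const_zero, zero_add, Finset.filter_notMem_eq_sdiff,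
      ← Finset.compl_eq_univ_sdiff]
  rw [hset]
  refine h.trans (ENNReal.ofReal_le_ofReal ?_)
  have hsum : ∑ i, (if i ∈ T then 0 else κ / 8) = (Fintype.card ι - T.card) * (κ / 8) := by
    rw [Finset.sum_ite, Finset.sum_const_zero, zero_add, Finset.sum_const, nsmul_eq_mul]
    have : (Finset.univ.filter fun i => i ∉ T) = Tᶜ := by ext i; simp
    rw [this, Finset.card_compl, Nat.cast_sub (Finset.card_le_univ T)]
  have hT' : (2 : ℝ) * T.card ≤ Fintype.card ι := by exact_mod_cast hT
  -- The term `2 * lam` from the threshold `2` is at most `1 / 36`; it costs the factor `2` in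
  -- front.
  have hexp : 2 * (κ / 72) - κ / 72 * ∑ i, (if i ∈ T then 0 else κ / 8) +
      Fintype.card ι * (9 / 4 * (κ / 72) ^ 2) ≤ 1 / 36 + -(κ ^ 2 * Fintype.card ι / 2304) := by
    rw [hsum]
    have : (Fintype.card ι : ℝ) / 2 * (κ ^ 2 / 576) ≤ (Fintype.card ι - T.card) * (κ ^ 2 / 576) := by
      gcongr
      linarith
    nlinarith [sq_nonneg κ]
  refine (Real.exp_le_exp.2 hexp).trans ?_
  rw [Real.exp_add]
  gcongr
  have h1 := Real.exp_bound_div_one_sub_of_interval (x := 1 / 36) (by norm_num) (by norm_num)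
  refine h1.trans (by norm_num)

/-- Deterministic core: a net of the window together with enough small elements of either sign
gives a net of `[-2, 2]`. -/
theorem exists_subset_sum_of_net {ι κ : Type*} [Fintype ι] [DecidableEq ι] [Fintype κ] (g : κ ↪ ι)
    {y k : ι → ℝ} {η : ℝ}
    (hnet : ∀ z ∈ window, ∃ U : Finset κ, |∑ i ∈ U, y (g i) - z| ≤ η)
    (hpos : 2 ≤ ∑ i ∈ (Finset.univ.map g)ᶜ, smallPart (y i) + ∑ i, k i)
    (hneg : 2 ≤ ∑ i ∈ (Finset.univ.map g)ᶜ, smallPart (-y i) + ∑ i, -k i)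
    {t : ℝ} (ht : |t| ≤ 2) : ∃ U : Finset ι, |∑ i ∈ U, y i + ∑ i, k i - t| ≤ η := by
  have ht' := abs_le.1 ht
  set R : Finset ι := (Finset.univ.map g)ᶜ with hR
  have hgreedy : ∀ (y : ι → ℝ) (r : ℝ), 0 ≤ r → r - 1 / 4 ≤ ∑ i ∈ R, smallPart (y i) →
      ∃ U ⊆ R, |∑ i ∈ U, y i - r| ≤ 1 / 4 := by
    intro y r hr h
    have h1 : ∑ i ∈ R, smallPart (y i) = ∑ i ∈ R.filter (fun i => y i ∈ Icc (0 : ℝ) (1 / 2)), y i := by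
      rw [Finset.sum_filter]
      refine Finset.sum_congr rfl fun i _ => ?_
      simp [smallPart, indicator_apply]
    rw [h1] at h
    obtain ⟨U, hU, h2⟩ := exists_subset_sum_near y hr _ (fun i hi => (Finset.mem_filter.1 hi).2) h
    exact ⟨U, hU.trans (Finset.filter_subset _ _), h2⟩
  -- Small elements of the sign of the shifted target bring it within `1 / 4` of zero, that is, into
  -- the window where the net takes over.
  obtain ⟨V, hV, hVr⟩ : ∃ V ⊆ R, |∑ i ∈ V, y i - (t - ∑ i, k i)| ≤ 1 / 4 := by
    rcases le_total 0 (t - ∑ i, k i) with h | h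
    · exact hgreedy y _ h (by linarith)
    · rw [Finset.sum_neg_distrib] at hneg
      obtain ⟨V, hV, h2⟩ := hgreedy (fun i => -y i) (-(t - ∑ i, k i)) (by linarith) (by linarith)
      refine ⟨V, hV, ?_⟩
      rw [Finset.sum_neg_distrib] at h2
      rw [← abs_neg]
      convert h2 using 2
      ring
  obtain ⟨U, hU⟩ := hnet ((t - ∑ i, k i) - ∑ i ∈ V, y i) (by
    have := abs_le.1 hVr
    simp only [window, mem_Icc]
    constructor <;> linarith [this.1, this.2])
  refine ⟨U.map g ∪ V, ?_⟩
  have hdisj : Disjoint (U.map g) V := by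
    refine Finset.disjoint_left.2 fun i hi hiV => ?_
    have h1 := hV hiV
    rw [hR, Finset.mem_compl] at h1
    exact h1 (Finset.map_subset_map.2 (Finset.subset_univ U) hi)
  rw [Finset.sum_union hdisj, Finset.sum_map]
  convert hU using 2
  ring

/-- Random subset sum with fixed elements: with high probability every target in `[-2, 2]` is the
sum of all fixed elements `K i` and some of the free elements `Y i`, up to an exponentially small
error. -/
theorem exists_robust_subset_sum {Ω ι : Type*} [MeasurableSpace Ω] [Fintype ι]
    {P : Measure Ω} [IsProbabilityMeasure P] {Y K : ι → Ω → ℝ} (hY : ∀ i, Measurable (Y i))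
    (hK : ∀ i, Measurable (K i)) (hind : iIndepFun (fun i ω => (Y i ω, K i ω)) P) {κ : ℝ}
    (hκ : 0 ≤ κ) (hκ1 : κ ≤ 1) (hdom : ∀ i, DominatesUniform κ (P.map (Y i)))
    (hKb : ∀ i, ∀ᵐ ω ∂P, |K i ω| ≤ 1) (hK0 : ∀ i, ∫ ω, K i ω ∂P = 0) :
    P {ω | ¬ ∀ t : ℝ, |t| ≤ 2 → ∃ U : Finset ι, |∑ i ∈ U, Y i ω + ∑ i, K i ω - t| ≤
        Real.exp (-(κ ^ 2 * Fintype.card ι / 2304))} ≤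
      ENNReal.ofReal (10 * Real.exp (-(κ ^ 2 * Fintype.card ι / 2304))) := by
  classical
  set n := Fintype.card ι with hn
  -- One half of the elements forms the net; the rest compensates the fixed sum. The halves are
  -- disjoint, so their selections can be united.
  set m := n / 2 with hm
  have hmn : m ≤ n := Nat.div_le_self _ _
  set g : Fin m ↪ ι :=
    (Fin.castLEEmb hmn).trans (Fintype.equivFin ι).symm.toEmbedding with hg
  -- With this exponent, `1 / (8 * ε ^ 2)` grows like `exp (κ * n / 16)` and uses up only half of
  -- the decay `exp (-(κ * m / 4))`, which is about `exp (-(κ * n / 8))`.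
  set ε : ℝ := Real.exp (-(κ * n / 32)) / 4 with hε
  have hexp1 : Real.exp (-(κ * n / 32)) ≤ 1 := Real.exp_le_one_iff.2 (by
    rw [neg_nonpos]; positivity)
  have hprob : ∀ i, IsProbabilityMeasure (P.map (Y i)) := fun i =>
    Measure.isProbabilityMeasure_map (hY i).aemeasurable
  obtain ⟨S, hSm, hS, hnet⟩ := pi_exists_not_reached_le (ε := ε) (by positivity)
    (by rw [hε]; linarith) hκ (fun j : Fin m => P.map (Y (g j))) (fun j => hdom _) hκ1
  have hindY : iIndepFun (fun (j : Fin m) => Y (g j)) P :=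
    (hind.comp (fun _ p => p.1) fun _ => measurable_fst).precomp g.injective
  have hmap := (iIndepFun_iff_map_fun_eq_pi_map fun j => (hY (g j)).aemeasurable).1 hindY
  set E1 : Set Ω := {ω | (fun j => Y (g j) ω) ∈ S} with hE1
  set E2 : Set Ω := {ω | ∑ i ∈ (Finset.univ.map g)ᶜ, smallPart (Y i ω) + ∑ i, K i ω < 2} with hE2
  set E3 : Set Ω := {ω | ∑ i ∈ (Finset.univ.map g)ᶜ, smallPart (-Y i ω) + ∑ i, -K i ω < 2}
    with hE3
  have hP1 : P E1 ≤ ENNReal.ofReal (Real.exp (-(κ * m / 4)) / (8 * ε ^ 2)) := by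
    refine le_trans (le_of_eq ?_) hS
    rw [← hmap, Measure.map_apply (measurable_pi_iff.2 fun j => hY (g j)) hSm]
    rfl
  have hT : 2 * (Finset.univ.map g).card ≤ Fintype.card ι := by
    rw [Finset.card_map, Finset.card_univ, Fintype.card_fin, hm, ← hn]
    exact Nat.mul_div_le n 2
  have hP2 := measure_sum_smallPart_lt_two_le hY hK hind hκ hκ1 hdom hKb hK0 _ hT
  have hP3 := measure_sum_smallPart_lt_two_le (Y := fun i ω => -Y i ω) (K := fun i ω => -K i ω)
    (fun i => (hY i).neg) (fun i => (hK i).neg)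
    (hind.comp (fun _ p => (-p.1, -p.2)) fun _ => by fun_prop) hκ hκ1
    (fun i => by
      have := (hdom i).map_neg
      rwa [Measure.map_map measurable_neg (hY i)] at this)
    (fun i => by simpa using hKb i) (fun i => by rw [integral_neg, hK0, neg_zero]) _ hT
  have hsub : {ω | ¬ ∀ t : ℝ, |t| ≤ 2 → ∃ U : Finset ι, |∑ i ∈ U, Y i ω + ∑ i, K i ω - t| ≤
        Real.exp (-(κ ^ 2 * n / 2304))} ⊆ E1 ∪ (E2 ∪ E3) := by
    intro ω hω
    by_contra hcon
    simp only [mem_union, not_or] at hcon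
    obtain ⟨h1, h2, h3⟩ := hcon
    refine hω fun t ht => ?_
    obtain ⟨U, hU⟩ := exists_subset_sum_of_net g
      (hnet (fun j => Y (g j) ω) h1) (not_lt.1 h2) (not_lt.1 h3) ht
    refine ⟨U, hU.trans ?_⟩
    have : Real.exp (-(κ * n / 32)) ≤ Real.exp (-(κ ^ 2 * n / 2304)) := by
      refine Real.exp_le_exp.2 (neg_le_neg ?_)
      have : κ ^ 2 ≤ κ := by nlinarith
      have hn0 : (0 : ℝ) ≤ n := Nat.cast_nonneg n
      nlinarith [mul_le_mul_of_nonneg_right this hn0, mul_nonneg hκ hn0]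
    rw [hε]
    linarith [Real.exp_pos (-(κ * n / 32))]
  have hfirst : Real.exp (-(κ * m / 4)) / (8 * ε ^ 2) ≤
      6 * Real.exp (-(κ ^ 2 * n / 2304)) := by
    have h1 : 8 * ε ^ 2 = Real.exp (-(κ * n / 16)) / 2 := by
      rw [hε, div_pow, ← Real.exp_nat_mul]
      rw [show ((2 : ℕ) : ℝ) * -(κ * n / 32) = -(κ * n / 16) by push_cast; ring]
      ring
    have h2 : (n : ℝ) ≤ 2 * m + 1 := by
      have : n ≤ 2 * m + 1 := by omega
      exact_mod_cast this
    rw [h1, div_le_iff₀ (by positivity)]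
    have h3 : -(κ * m / 4) ≤ 1 / 8 + (-(κ ^ 2 * n / 2304) + -(κ * n / 16)) := by
      have : κ ^ 2 ≤ κ := by nlinarith
      have hn0 : (0 : ℝ) ≤ n := Nat.cast_nonneg n
      nlinarith [mul_le_mul_of_nonneg_right this hn0, mul_nonneg hκ hn0,
        mul_le_mul_of_nonneg_left h2 hκ]
    have h4 := Real.exp_le_exp.2 h3
    rw [Real.exp_add, Real.exp_add] at h4
    have h5 : Real.exp (1 / 8) ≤ 3 :=
      (Real.exp_bound_div_one_sub_of_interval (by norm_num) (by norm_num)).trans (by norm_num)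
    calc _ ≤ _ := h4
      _ ≤ 3 * (Real.exp (-(κ ^ 2 * n / 2304)) * Real.exp (-(κ * n / 16))) := by gcongr
      _ = _ := by ring
  calc _ ≤ P E1 + (P E2 + P E3) :=
        (measure_mono hsub).trans ((measure_union_le _ _).trans (by gcongr; exact measure_union_le _ _))
    _ ≤ ENNReal.ofReal (6 * Real.exp (-(κ ^ 2 * n / 2304))) +
        (ENNReal.ofReal (2 * Real.exp (-(κ ^ 2 * n / 2304))) +
          ENNReal.ofReal (2 * Real.exp (-(κ ^ 2 * n / 2304)))) := by
        gcongr
        exact hP1.trans (ENNReal.ofReal_le_ofReal hfirst)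
    _ = _ := by
        rw [← ENNReal.ofReal_add (by positivity) (by positivity),
          ← ENNReal.ofReal_add (by positivity) (by positivity)]
        congr 1; ring

end RobustSubsetSum

/-! ### Laws of the summands: free and locked values, two-layer paths -/

section Laws

open MeasureTheory ProbabilityTheory Set

theorem unif_apply {B : Set ℝ} (hsub : B ⊆ Icc (-1) 1) :
    unif B = ENNReal.ofReal (1 / 2) * volume B := by
  rw [unif, cond_apply measurableSet_Icc, inter_eq_self_of_subset_right hsub, Real.volume_Icc,
    ← ENNReal.ofReal_inv_of_pos (by norm_num)]
  norm_num

instance : IsProbabilityMeasure unif := by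
  refine cond_isProbabilityMeasure_of_finite ?_ ?_ <;> simp [Real.volume_Icc]

theorem ae_abs_le_one_unif : ∀ᵐ x ∂unif, |x| ≤ 1 := by
  have h : unif (Icc (-1) 1) = 1 := by
    rw [unif_apply subset_rfl, Real.volume_Icc,
      ← ENNReal.ofReal_mul (by norm_num)]
    norm_num
  rw [← prob_compl_eq_zero_iff measurableSet_Icc] at h
  refine measure_mono_null ?_ h
  intro x hx hx'
  exact hx (abs_le.2 hx')

theorem integral_unif : ∫ x, x ∂unif = 0 := by
  rw [unif, ProbabilityTheory.cond, integral_smul_measure, integral_Icc_eq_integral_Ioc,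
    ← intervalIntegral.integral_of_le (by norm_num), integral_id]
  norm_num

theorem bern_false (a : ℝ) : bern a {false} = ENNReal.ofReal (1 - a) := by
  simp [bern]

theorem bern_true (a : ℝ) : bern a {true} = ENNReal.ofReal a := by
  simp [bern]

theorem isProbabilityMeasure_bern {a : ℝ} (h0 : 0 ≤ a) (h1 : a ≤ 1) :
    IsProbabilityMeasure (bern a) := ⟨by
  simp only [bern, Measure.add_apply, Measure.smul_apply, measure_univ, smul_eq_mul, mul_one]
  rw [← ENNReal.ofReal_add h0 (by linarith)]
  norm_num⟩

theorem isProbabilityMeasure_paramLaw {p q : ℝ} (hp0 : 0 ≤ p) (hp1 : p ≤ 1) (hq0 : 0 ≤ q)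
    (hq1 : q ≤ 1) : IsProbabilityMeasure (paramLaw p q) := by
  have := isProbabilityMeasure_bern hp0 hp1
  have := isProbabilityMeasure_bern hq0 hq1
  unfold paramLaw
  infer_instance

/-- The value of a parameter if it is free, and `0` otherwise. -/
noncomputable def freeVal (x : ℝ × Bool × Bool) : ℝ :=
  if x.2.1 = false ∧ x.2.2 = false then x.1 else 0

/-- The value of a parameter if it is locked and not pruned, and `0` otherwise. -/
noncomputable def lockVal (x : ℝ × Bool × Bool) : ℝ :=
  if x.2.1 = false ∧ x.2.2 = true then x.1 else 0

theorem measurable_freeVal : Measurable freeVal := by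
  refine Measurable.ite ?_ measurable_fst measurable_const
  exact (measurable_snd.fst (measurableSet_singleton false)).inter
    (measurable_snd.snd (measurableSet_singleton false))

theorem measurable_lockVal : Measurable lockVal := by
  refine Measurable.ite ?_ measurable_fst measurable_const
  exact (measurable_snd.fst (measurableSet_singleton false)).inter
    (measurable_snd.snd (measurableSet_singleton true))

/-- A parameter is free with probability `(1 - p) * (1 - q)`, independently of its value, which has
density `1 / 2`. The atom at `0` coming from frozen parameters does no harm, since only a lower
bound is required. -/
theorem dominatesUniform_freeVal {p q : ℝ} (hp0 : 0 ≤ p) (hp1 : p ≤ 1) (hq0 : 0 ≤ q)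
    (hq1 : q ≤ 1) : DominatesUniform ((1 - p) * (1 - q) / 2) ((paramLaw p q).map freeVal) := by
  have := isProbabilityMeasure_bern hp0 hp1
  have := isProbabilityMeasure_bern hq0 hq1
  intro B hB hsub
  rw [Measure.map_apply measurable_freeVal hB]
  have h1 : B ×ˢ ({false} ×ˢ {false}) ⊆ freeVal ⁻¹' B := by
    rintro ⟨x, a, b⟩ ⟨hx, ha, hb⟩
    simp only [mem_singleton_iff] at ha hb hx
    subst ha hb
    simpa [freeVal] using hx
  refine le_trans (le_of_eq ?_) (measure_mono h1)
  rw [paramLaw, Measure.prod_prod, Measure.prod_prod, bern_false, bern_false,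
    unif_apply (hsub.trans (Icc_subset_Icc (by norm_num) (by norm_num))),
    ← ENNReal.ofReal_mul (by linarith), mul_right_comm,
    ← ENNReal.ofReal_mul (by norm_num)]
  congr 2
  ring

theorem ae_paramLaw_abs_le_one {p q : ℝ} (hp0 : 0 ≤ p) (hp1 : p ≤ 1) (hq0 : 0 ≤ q)
    (hq1 : q ≤ 1) : ∀ᵐ x ∂paramLaw p q, |x.1| ≤ 1 := by
  have := isProbabilityMeasure_bern hp0 hp1
  have := isProbabilityMeasure_bern hq0 hq1
  exact Measure.quasiMeasurePreserving_fst.ae ae_abs_le_one_unif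

theorem ae_paramLaw_zero : ∀ᵐ x ∂paramLaw 0 0, x.2.1 = false ∧ x.2.2 = false := by
  have := isProbabilityMeasure_bern le_rfl zero_le_one
  have h : ∀ᵐ b ∂bern 0, b = false := by
    rw [ae_iff]
    have : {b : Bool | ¬b = false} = {true} := by ext b; simp
    rw [this, bern_true]
    simp
  have h1 : ∀ᵐ x ∂paramLaw 0 0, x.2.1 = false :=
    (Measure.quasiMeasurePreserving_fst.comp Measure.quasiMeasurePreserving_snd).ae h
  have h2 : ∀ᵐ x ∂paramLaw 0 0, x.2.2 = false :=
    (Measure.quasiMeasurePreserving_snd.comp Measure.quasiMeasurePreserving_snd).ae h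
  filter_upwards [h1, h2] with x hx1 hx2 using ⟨hx1, hx2⟩

theorem abs_lockVal_le (x : ℝ × Bool × Bool) : |lockVal x| ≤ |x.1| := by
  unfold lockVal
  split_ifs
  · exact le_rfl
  · simp

/-- The value is centred and independent of the freezing indicators. -/
theorem integral_lockVal {p q : ℝ} (hp0 : 0 ≤ p) (hp1 : p ≤ 1) (hq0 : 0 ≤ q)
    (hq1 : q ≤ 1) : ∫ x, lockVal x ∂paramLaw p q = 0 := by
  have := isProbabilityMeasure_bern hp0 hp1
  have := isProbabilityMeasure_bern hq0 hq1
  have h : ∀ x : ℝ × Bool × Bool, lockVal x =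
      x.1 * (if x.2.1 = false ∧ x.2.2 = true then 1 else 0) := by
    intro x
    unfold lockVal
    split_ifs <;> simp
  simp_rw [h]
  rw [paramLaw, integral_prod_mul (fun x : ℝ => x)
    (fun b : Bool × Bool => if b.1 = false ∧ b.2 = true then (1 : ℝ) else 0), integral_unif,
    zero_mul]

/-- The output, at input `1`, of a ReLU neuron with weight `v` and of the sign `σ`, if `v` has the
sign `σ` and is not small. -/
noncomputable def gate (σ : Bool) (v : ℝ) : ℝ :=
  if σ then (if 1 / 2 ≤ v then v else 0) else (if v ≤ -(1 / 2) then -v else 0)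

theorem measurable_gate (σ : Bool) : Measurable (gate σ) := by
  cases σ
  · have h : gate false = fun v => if v ≤ -(1 / 2) then -v else 0 := by ext v; simp [gate]
    rw [h]
    exact Measurable.ite measurableSet_Iic measurable_neg measurable_const
  · have h : gate true = fun v => if 1 / 2 ≤ v then v else 0 := by ext v; simp [gate]
    rw [h]
    exact Measurable.ite measurableSet_Ici measurable_id measurable_const

/-- The second weight has the right sign and modulus at least `1 / 2` with probability `1 / 4`.
Given such a modulus `g ≤ 1`, the product is uniform on `[-g, g]`, which contains `[-1/2, 1/2]`,
with density `1 / (2 * g) ≥ 1 / 2`. Excluding small `g` keeps the range from shrinking. -/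
theorem dominatesUniform_mul_gate (σ : Bool) {p q : ℝ} (hp0 : 0 ≤ p) (hp1 : p ≤ 1) (hq0 : 0 ≤ q)
    (hq1 : q ≤ 1) :
    DominatesUniform (1 / 8) (((paramLaw p q).prod (paramLaw p q)).map
      fun x => x.1.1 * gate σ x.2.1) := by
  have := isProbabilityMeasure_bern hp0 hp1
  have := isProbabilityMeasure_bern hq0 hq1
  have := isProbabilityMeasure_paramLaw hp0 hp1 hq0 hq1
  have hmul : Measurable fun y : ℝ × ℝ => y.1 * gate σ y.2 :=
    measurable_fst.mul ((measurable_gate σ).comp measurable_snd)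
  have hfst : (paramLaw p q).map Prod.fst = unif := by
    unfold paramLaw
    simp
  have hmap : ((paramLaw p q).prod (paramLaw p q)).map (fun x => x.1.1 * gate σ x.2.1)
      = (unif.prod unif).map fun y => y.1 * gate σ y.2 := by
    conv_rhs => rw [← hfst]
    rw [Measure.map_prod_map _ _ measurable_fst measurable_fst,
      Measure.map_map hmul (measurable_fst.prodMap measurable_fst)]
    rfl
  intro B hB hsub
  rw [hmap, Measure.map_apply hmul hB, Measure.prod_apply_symm (hmul hB)]
  obtain ⟨V, hVm, hVsub, hVvol, hV⟩ : ∃ V : Set ℝ, MeasurableSet V ∧ V ⊆ Icc (-1) 1 ∧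
      volume V = ENNReal.ofReal (1 / 2) ∧ ∀ v ∈ V, 1 / 2 ≤ gate σ v ∧ gate σ v ≤ 1 := by
    cases σ
    · refine ⟨Icc (-1) (-(1 / 2)), measurableSet_Icc, Icc_subset_Icc le_rfl (by norm_num), ?_, ?_⟩
      · rw [Real.volume_Icc]; norm_num
      · intro v hv
        have : gate false v = -v := by simp only [gate]; simpa using fun h => absurd hv.2 (by linarith)
        rw [this]
        constructor <;> linarith [hv.1, hv.2]
    · refine ⟨Icc (1 / 2) 1, measurableSet_Icc, Icc_subset_Icc (by norm_num) le_rfl, ?_, ?_⟩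
      · rw [Real.volume_Icc]; norm_num
      · intro v hv
        have : gate true v = v := by simp only [gate]; simpa using fun h => absurd hv.1 (by linarith)
        rw [this]
        exact hv
  have hle : ∀ v ∈ V, ENNReal.ofReal (1 / 2) * volume B ≤
      unif ((fun u => (u, v)) ⁻¹' ((fun y : ℝ × ℝ => y.1 * gate σ y.2) ⁻¹' B)) := by
    intro v hv
    obtain ⟨h1, h2⟩ := hV v hv
    have hpre : (fun u => (u, v)) ⁻¹' ((fun y : ℝ × ℝ => y.1 * gate σ y.2) ⁻¹' B)
        = (fun u => u * gate σ v) ⁻¹' B := rfl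
    rw [hpre, unif_apply, Real.volume_preimage_mul_right (by linarith)]
    · refine mul_le_mul' le_rfl ?_
      have : (1 : ℝ≥0∞) ≤ ENNReal.ofReal |(gate σ v)⁻¹| := by
        rw [ENNReal.one_le_ofReal, abs_inv, abs_of_pos (by linarith)]
        exact (one_le_inv₀ (by linarith)).2 h2
      calc volume B = 1 * volume B := (one_mul _).symm
        _ ≤ _ := mul_le_mul' this le_rfl
    · intro u hu
      have h3 := hsub hu
      have h4 : |u * gate σ v| ≤ 1 / 2 := abs_le.2 h3
      rw [abs_mul, abs_of_pos (show 0 < gate σ v by linarith)] at h4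
      refine abs_le.1 ?_
      by_contra! hcon
      nlinarith
  calc ENNReal.ofReal (1 / 8) * volume B
      = (ENNReal.ofReal (1 / 2) * volume B) * unif V := by
        rw [unif_apply hVsub, hVvol, ← ENNReal.ofReal_mul (by norm_num), mul_right_comm,
          ← ENNReal.ofReal_mul (by norm_num)]
        norm_num
    _ = ∫⁻ _ in V, ENNReal.ofReal (1 / 2) * volume B ∂unif := (setLIntegral_const _ _).symm
    _ ≤ ∫⁻ v in V, unif ((fun u => (u, v)) ⁻¹' ((fun y : ℝ × ℝ => y.1 * gate σ y.2) ⁻¹' B)) ∂unif :=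
        setLIntegral_mono' hVm hle
    _ ≤ _ := setLIntegral_le_lintegral _ _

/-- Regrouping: if the variables `X i b` are independent, then so are the pairs
`(X i true, X i false)`. -/
theorem iIndepFun_pairs {Ω ι β : Type*} [MeasurableSpace Ω] [MeasurableSpace β] {P : Measure Ω}
    {X : ι → Bool → Ω → β} (hX : ∀ i b, Measurable (X i b))
    (h : iIndepFun (fun (x : (_ : ι) × Bool) ω => X x.1 x.2 ω) P) :
    iIndepFun (fun i ω => (X i true ω, X i false ω)) P := by
  have hP := h.isProbabilityMeasure
  have hprob : ∀ i b, IsProbabilityMeasure (P.map (X i b)) :=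
    fun i b => Measure.isProbabilityMeasure_map (hX i b).aemeasurable
  have hrow : iIndepFun (fun i ω => fun b => X i b ω) P := by
    rw [iIndepFun_iff_map_fun_eq_infinitePi_map (by fun_prop)]
    have hc : (fun ω i b => X i b ω) =
        (MeasurableEquiv.piCurry fun (_ : ι) (_ : Bool) => β) ∘ (fun ω x => X x.1 x.2 ω) := by
      ext; simp [Sigma.curry]
    rw [hc, ← Measure.map_map (by fun_prop) (by fun_prop),
      h.map_fun_eq_infinitePi_map (fun x => hX _ _),
      Measure.infinitePi_map_piCurry (fun i j => P.map (X i j))]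
    congr 1
    ext1 i
    exact ((h.precomp (g := fun b : Bool => (⟨i, b⟩ : (_ : ι) × Bool))
      (fun a b hab => by simpa using hab)).map_fun_eq_infinitePi_map (fun b => hX i b)).symm
  exact hrow.comp (fun _ F => (F true, F false)) fun _ => by fun_prop

end Laws

/-! ### Probability that a single target weight cannot be realized -/

section Events

open MeasureTheory ProbabilityTheory Set

/-- Every target in `[-2, 2]` is, up to `η`, the sum of all fixed elements `k i` and of some free
elements `y i` of the group `G`. -/
def Selectable {ι : Type*} (G : Finset ι) (y k : ι → ℝ) (η : ℝ) : Prop :=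
  ∀ t : ℝ, |t| ≤ 2 → ∃ U ⊆ G, |∑ i ∈ U, y i + ∑ i ∈ G, k i - t| ≤ η

/-- The lower bound `s` replaces the exact group size so that all groups of a layer share one
accuracy and one failure probability. -/
theorem measure_not_selectable_le {Ω ι : Type*} [MeasurableSpace Ω]
    {P : Measure Ω} [IsProbabilityMeasure P] {Y K : ι → Ω → ℝ} (G : Finset ι)
    (hY : ∀ i, Measurable (Y i)) (hK : ∀ i, Measurable (K i))
    (hind : iIndepFun (fun (i : G) ω => (Y i ω, K i ω)) P) {κ : ℝ}
    (hκ : 0 ≤ κ) (hκ1 : κ ≤ 1) (hdom : ∀ i, DominatesUniform κ (P.map (Y i)))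
    (hKb : ∀ i, ∀ᵐ ω ∂P, |K i ω| ≤ 1) (hK0 : ∀ i, ∫ ω, K i ω ∂P = 0) {s : ℕ} (hs : s ≤ G.card) :
    P {ω | ¬ Selectable G (fun i => Y i ω) (fun i => K i ω) (Real.exp (-(κ ^ 2 * s / 2304)))} ≤
      ENNReal.ofReal (10 * Real.exp (-(κ ^ 2 * s / 2304))) := by
  have h := exists_robust_subset_sum (ι := G) (fun i => hY i) (fun i => hK i) hind hκ hκ1
    (fun i => hdom i) (fun i => hKb i) (fun i => hK0 i)
  rw [Fintype.card_coe] at h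
  have hexp : Real.exp (-(κ ^ 2 * G.card / 2304)) ≤ Real.exp (-(κ ^ 2 * s / 2304)) := by
    have : (s : ℝ) ≤ G.card := by exact_mod_cast hs
    gcongr
  refine (measure_mono ?_).trans (h.trans (ENNReal.ofReal_le_ofReal (by gcongr)))
  intro ω hω
  by_contra hcon
  refine hω fun t ht => ?_
  obtain ⟨U, hU⟩ := not_not.1 hcon t ht
  refine ⟨U.map (Function.Embedding.subtype _), ?_, ?_⟩
  · intro i hi
    obtain ⟨j, -, rfl⟩ := Finset.mem_map.1 hi
    exact j.2
  · rw [Finset.sum_map]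
    rw [← Finset.sum_coe_sort G]
    exact hU.trans hexp

variable {w : ℕ → ℕ} {k : ℕ} {μ : Param w k → Measure (ℝ × Bool × Bool)}
  [∀ e, IsProbabilityMeasure (μ e)]

theorem iIndepFun_coord : iIndepFun (fun e (ω : Param w k → ℝ × Bool × Bool) => ω e)
    (Measure.pi μ) :=
  iIndepFun_pi (X := fun _ x => x) fun _ => aemeasurable_id

theorem map_coord (e : Param w k) :
    (Measure.pi μ).map (fun ω => ω e) = μ e := (measurePreserving_eval μ e).map_eq

/-- The weights of a frozen neuron coming from a group of `s` or more neurons. -/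
theorem measure_not_selectable_frozen_le (l : Fin k) (i : Fin (w (l + 1)))
    (G : Finset (Fin (w l))) {p q : ℝ} (hp0 : 0 ≤ p) (hp1 : p ≤ 1) (hq0 : 0 ≤ q) (hq1 : q ≤ 1)
    (hμ : ∀ e : Param w k, e.1 = l → μ e = paramLaw p q) {s : ℕ} (hs : s ≤ G.card) :
    Measure.pi μ {ω | ¬ Selectable G (fun j => freeVal (ω ⟨l, i, some j⟩))
        (fun j => lockVal (ω ⟨l, i, some j⟩))
        (Real.exp (-(((1 - p) * (1 - q) / 2) ^ 2 * s / 2304)))} ≤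
      ENNReal.ofReal (10 * Real.exp (-(((1 - p) * (1 - q) / 2) ^ 2 * s / 2304))) := by
  have hpq : (1 - p) * (1 - q) ≤ 1 := mul_le_one₀ (by linarith) (by linarith) (by linarith)
  have hm : ∀ (f : ℝ × Bool × Bool → ℝ), Measurable f → ∀ j : Fin (w l),
      Measurable fun ω : Param w k → ℝ × Bool × Bool => f (ω ⟨l, i, some j⟩) :=
    fun f hf j => hf.comp (measurable_pi_apply _)
  refine measure_not_selectable_le G (hm _ measurable_freeVal) (hm _ measurable_lockVal) ?_
    (by nlinarith) (by linarith) ?_ ?_ ?_ hs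
  · have h1 : iIndepFun (fun (j : G) (ω : Param w k → ℝ × Bool × Bool) => ω ⟨l, i, some j.1⟩)
        (Measure.pi μ) :=
      iIndepFun_coord.precomp (g := fun j : G => (⟨l, i, some j.1⟩ : Param w k))
        (fun a b hab => Subtype.ext (by simpa using hab))
    exact h1.comp (fun _ x => (freeVal x, lockVal x))
      fun _ => measurable_freeVal.prodMk measurable_lockVal
  · intro j
    have : (Measure.pi μ).map (fun ω => freeVal (ω ⟨l, i, some j⟩)) =
        (paramLaw p q).map freeVal := by
      rw [← hμ ⟨l, i, some j⟩ rfl, ← map_coord (μ := μ) ⟨l, i, some j⟩,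
        Measure.map_map measurable_freeVal (measurable_pi_apply _)]
      rfl
    rw [this]
    exact dominatesUniform_freeVal hp0 hp1 hq0 hq1
  · intro j
    have h1 : ∀ᵐ x ∂(μ ⟨l, i, some j⟩), |x.1| ≤ 1 := by
      rw [hμ _ rfl]
      exact ae_paramLaw_abs_le_one hp0 hp1 hq0 hq1
    filter_upwards [(Measure.quasiMeasurePreserving_eval μ ⟨l, i, some j⟩).ae h1] with ω hω
    exact (abs_lockVal_le _).trans hω
  · intro j
    have h1 := integral_map (μ := Measure.pi μ) (φ := fun ω => ω ⟨l, i, some j⟩)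
      (measurable_pi_apply _).aemeasurable measurable_lockVal.aestronglyMeasurable
    rw [← h1, map_coord, hμ _ rfl]
    exact integral_lockVal hp0 hp1 hq0 hq1

/-- The two-layer paths from input `o` through a group of `s` or more neurons of the sign `σ`. -/
theorem measure_not_selectable_input_le (h0 : 0 < k) (h1 : 1 < k) (i : Fin (w 2))
    (o : Option (Fin (w 0))) (σ : Bool) (G : Finset (Fin (w 1)))
    (hμ : ∀ e : Param w k, (e.1 : ℕ) < 2 → μ e = paramLaw 0 0) {s : ℕ} (hs : s ≤ G.card) :
    Measure.pi μ {ω | ¬ Selectable G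
        (fun a => (ω ⟨⟨1, h1⟩, i, some a⟩).1 * gate σ (ω ⟨⟨0, h0⟩, a, o⟩).1) (fun _ => 0)
        (Real.exp (-((1 / 8) ^ 2 * s / 2304)))} ≤
      ENNReal.ofReal (10 * Real.exp (-((1 / 8) ^ 2 * s / 2304))) := by
  have hF : Measurable fun x : (ℝ × Bool × Bool) × (ℝ × Bool × Bool) => x.1.1 * gate σ x.2.1 :=
    measurable_fst.fst.mul ((measurable_gate σ).comp measurable_snd.fst)
  have hpair : ∀ a : Fin (w 1), Measurable fun ω : Param w k → ℝ × Bool × Bool =>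
      (ω ⟨⟨1, h1⟩, i, some a⟩, ω ⟨⟨0, h0⟩, a, o⟩) :=
    fun a => (measurable_pi_apply _).prodMk (measurable_pi_apply _)
  refine measure_not_selectable_le (κ := 1 / 8) G (fun a => hF.comp (hpair a))
    (fun _ => measurable_const) ?_
    (by norm_num) (by norm_num) ?_ ?_ ?_ hs
  -- The two parameters of each path. Paths through different neurons of layer `0` share no
  -- parameter, so injectivity of `g` yields independence of the products.
  · set g : (_ : G) × Bool → Param w k := fun x =>
      if x.2 then ⟨⟨1, h1⟩, i, some x.1.1⟩ else ⟨⟨0, h0⟩, x.1.1, o⟩ with hg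
    have hginj : Function.Injective g := by
      rintro ⟨a, b⟩ ⟨a', b'⟩ hab
      cases b <;> cases b' <;> simp [hg] at hab ⊢
      · exact hab
      · exact hab
    have h2 := (iIndepFun_coord (μ := μ)).precomp hginj
    have h3 := iIndepFun_pairs (X := fun (a : G) b (ω : Param w k → ℝ × Bool × Bool) => ω (g ⟨a, b⟩))
      (fun a b => measurable_pi_apply _) h2
    exact h3.comp (fun _ x => (x.1.1 * gate σ x.2.1, 0)) fun _ => hF.prodMk measurable_const
  · intro a
    have hne : (⟨⟨1, h1⟩, i, some a⟩ : Param w k) ≠ ⟨⟨0, h0⟩, a, o⟩ := by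
      simp [Sigma.ext_iff]
    have h2 : IndepFun (fun ω : Param w k → ℝ × Bool × Bool => ω ⟨⟨1, h1⟩, i, some a⟩)
        (fun ω => ω ⟨⟨0, h0⟩, a, o⟩) (Measure.pi μ) := iIndepFun_coord.indepFun hne
    have h3 := (indepFun_iff_map_prod_eq_prod_map_map (measurable_pi_apply _).aemeasurable
      (measurable_pi_apply _).aemeasurable).1 h2
    rw [map_coord, map_coord, hμ _ Nat.one_lt_two, hμ _ Nat.zero_lt_two] at h3
    have h4 : (Measure.pi μ).map (fun ω => (ω ⟨⟨1, h1⟩, i, some a⟩).1 *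
        gate σ (ω ⟨⟨0, h0⟩, a, o⟩).1) =
        ((paramLaw 0 0).prod (paramLaw 0 0)).map fun x => x.1.1 * gate σ x.2.1 := by
      rw [← h3, Measure.map_map hF (hpair a)]
      rfl
    have h5 := dominatesUniform_mul_gate σ le_rfl zero_le_one le_rfl zero_le_one
    rw [← h4] at h5
    exact h5
  · intro a
    simp
  · intro a
    simp

end Events

/-! ### Layerwise errors, groups of copies, and selection of parameters -/

section Construction

/-- The neurons of a layer together with a constant neuron `none` of value `1`. -/
def withOne {n : ℕ} (x : Fin n → ℝ) : Option (Fin n) → ℝ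
  | none => 1
  | some i => x i

theorem sum_abs_withOne {n : ℕ} (x : Fin n → ℝ) : ∑ o, |withOne x o| = 1 + ∑ i, |x i| := by
  rw [Fintype.sum_option]
  simp [withOne]

theorem affine_eq_sum_withOne {w : ℕ → ℕ} {k : ℕ} (θ : Param w k → ℝ) (l : Fin k)
    (y : Fin (w l) → ℝ) (i : Fin (w (l + 1))) :
    affine θ l y i = ∑ o, θ ⟨l, i, o⟩ * withOne y o := by
  rw [Fintype.sum_option, affine]
  simp only [withOne]
  ring

theorem neurons_succ {w : ℕ → ℕ} {k : ℕ} (θ : Param w k → ℝ) (x : Fin (w 0) → ℝ) {l : ℕ}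
    (h : l < k) (i : Fin (w (l + 1))) :
    neurons θ x (l + 1) i = max 0 (affine θ ⟨l, h⟩ (neurons θ x l) i) := by
  rw [neurons, dif_pos h]

/-- The weights of a layer that also computes a constant neuron `none` of value `1`. -/
def homWeight {n : ℕ → ℕ} {L : ℕ} (θ : Param n L → ℝ) (r : Fin L) :
    Option (Fin (n (r + 1))) → Option (Fin (n r)) → ℝ
  | some i, o => θ ⟨r, i, o⟩
  | none, none => 1
  | none, some _ => 0

theorem abs_relu_sub_le (a b : ℝ) : |max 0 a - max 0 b| ≤ |a - b| := by
  rw [max_comm 0 a, max_comm 0 b]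
  exact abs_max_sub_max_le_abs a b 0

theorem abs_homWeight_le {n : ℕ → ℕ} {L : ℕ} {θ : Param n L → ℝ} (hθ : ∀ e, |θ e| ≤ 1) (r : Fin L)
    (i : Option (Fin (n (r + 1)))) (o : Option (Fin (n r))) : |homWeight θ r i o| ≤ 1 := by
  cases i <;> cases o <;> simp [homWeight, hθ]

/-- The constant neuron reproduces itself because `max 0 1 = 1`. This makes every target layer
homogeneous, so biases are treated as weights. -/
theorem withOne_neurons_succ {n : ℕ → ℕ} {L : ℕ} (θ : Param n L → ℝ) (x : Fin (n 0) → ℝ) {r : ℕ}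
    (h : r < L) (i : Option (Fin (n (r + 1)))) :
    withOne (neurons θ x (r + 1)) i =
      max 0 (∑ o, homWeight θ ⟨r, h⟩ i o * withOne (neurons θ x r) o) := by
  cases i with
  | none =>
    rw [Fintype.sum_option]
    simp [homWeight, withOne]
  | some i =>
    change neurons θ x (r + 1) i = _
    rw [neurons_succ θ x h, affine_eq_sum_withOne]
    rfl

/-- Error of a layer whose weights are distributed over groups of copies of the neurons. -/
theorem abs_layer_sub_le {J' J : Type*} [Fintype J'] [Fintype J] [DecidableEq J]
    (alive : Finset J') (lab : J' → J) (y : J' → ℝ) (X : J → ℝ) (W : J → ℝ) (θ : J' → ℝ)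
    (β : J → ℝ) {e η : ℝ} (hy0 : ∀ j ∉ alive, y j = 0)
    (hye : ∀ j ∈ alive, |y j - X (lab j)| ≤ e) (hθ : ∀ j, |θ j| ≤ 1)
    (hsel : ∀ o, |∑ j ∈ alive.filter (fun j => lab j = o), θ j + β o - W o| ≤ η) :
    |∑ j, θ j * y j + ∑ o, β o * X o - ∑ o, W o * X o| ≤ η * ∑ o, |X o| + alive.card * e := by
  have h1 : ∑ j, θ j * y j = ∑ j ∈ alive, θ j * y j := by
    refine (Finset.sum_subset (Finset.subset_univ _) fun j _ hj => ?_).symm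
    rw [hy0 j hj, mul_zero]
  have h2 : ∑ j ∈ alive, θ j * X (lab j) =
      ∑ o, (∑ j ∈ alive.filter (fun j => lab j = o), θ j) * X o := by
    rw [← Finset.sum_fiberwise_of_maps_to (g := lab) (t := Finset.univ)
      (fun _ _ => Finset.mem_univ _)]
    refine Finset.sum_congr rfl fun o _ => ?_
    rw [Finset.sum_mul]
    refine Finset.sum_congr rfl fun j hj => ?_
    rw [(Finset.mem_filter.1 hj).2]
  have h3 : ∑ j, θ j * y j + ∑ o, β o * X o - ∑ o, W o * X o =
      ∑ o, (∑ j ∈ alive.filter (fun j => lab j = o), θ j + β o - W o) * X o +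
        ∑ j ∈ alive, θ j * (y j - X (lab j)) := by
    simp only [mul_sub, add_mul, sub_mul, Finset.sum_sub_distrib, Finset.sum_add_distrib]
    rw [h1, ← h2]
    ring
  rw [h3]
  refine (abs_add_le _ _).trans (add_le_add ?_ ?_)
  · rw [Finset.mul_sum]
    refine (Finset.abs_sum_le_sum_abs _ _).trans (Finset.sum_le_sum fun o _ => ?_)
    rw [abs_mul]
    exact mul_le_mul_of_nonneg_right (hsel o) (abs_nonneg _)
  · refine (Finset.abs_sum_le_sum_abs _ _).trans ?_
    rw [← nsmul_eq_mul]
    refine Finset.sum_le_card_nsmul _ _ _ fun j hj => ?_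
    rw [abs_mul]
    calc |θ j| * |y j - X (lab j)| ≤ 1 * e :=
          mul_le_mul (hθ j) (hye j hj) (abs_nonneg _) zero_le_one
      _ = e := one_mul e

/-- The part of `z` of the sign `σ`. -/
def signPart (σ : Bool) (z : ℝ) : ℝ := max 0 (if σ then z else -z)

theorem signPart_nonneg (σ : Bool) (z : ℝ) : 0 ≤ signPart σ z := le_max_left _ _

theorem signPart_add (z : ℝ) : signPart true z + signPart false z = |z| := by
  simp only [signPart, if_true, Bool.false_eq_true, if_false]
  rcases le_total 0 z with h | h
  · rw [max_eq_right h, max_eq_left (by linarith), abs_of_nonneg h, add_zero]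
  · rw [max_eq_left h, max_eq_right (by linarith), abs_of_nonpos h, zero_add]

theorem signPart_sub (z : ℝ) : signPart true z - signPart false z = z := by
  simp only [signPart, if_true, Bool.false_eq_true, if_false]
  rcases le_total 0 z with h | h
  · rw [max_eq_right h, max_eq_left (by linarith), sub_zero]
  · rw [max_eq_left h, max_eq_right (by linarith)]; ring

/-- Positive homogeneity: a neuron with the single weight `v` isolates the part of `z` with the sign
of `v` and scales it by `|v|`. Positive and negative parts have separate groups, whose target
weights are opposite. -/
theorem relu_mul_of_gate_ne_zero {σ : Bool} {v : ℝ} (h : gate σ v ≠ 0) (z : ℝ) :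
    max 0 (v * z) = gate σ v * signPart σ z := by
  cases σ
  · have hv : v ≤ -(1 / 2) := by
      by_contra hv
      exact h (by rw [gate, if_neg (by simp), if_neg hv])
    have hg : gate false v = -v := by rw [gate, if_neg (by simp), if_pos hv]
    rw [hg, signPart, if_neg (by simp), mul_max_of_nonneg _ _ (by linarith)]
    simp
  · have hv : 1 / 2 ≤ v := by
      by_contra hv
      exact h (by rw [gate, if_pos rfl, if_neg hv])
    have hg : gate true v = v := by rw [gate, if_pos rfl, if_pos hv]
    rw [hg, signPart, if_pos rfl, mul_max_of_nonneg _ _ (by linarith)]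
    simp

/-- Error of the first target layer, built from two source layers. -/
theorem abs_input_layer_sub_le {J' J : Type*} [Fintype J'] [DecidableEq J'] [Fintype J]
    [DecidableEq J] (lab : J' → J × Bool) (U : J × Bool → Finset J') (hU : ∀ x, ∀ a ∈ U x, lab a = x)
    (X : J → ℝ) (W : J → ℝ) (θ y : J' → ℝ) (g : J' → ℝ) {η : ℝ}
    (hy : ∀ a, y a = g a * signPart (lab a).2 (X (lab a).1))
    (hsel : ∀ o σ, |∑ a ∈ U (o, σ), θ a * g a - (if σ then W o else -W o)| ≤ η) :
    |∑ a, (if a ∈ U (lab a) then θ a else 0) * y a - ∑ o, W o * X o| ≤ η * ∑ o, |X o| := by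
  have h2 : ∑ a, (if a ∈ U (lab a) then θ a else 0) * y a =
      ∑ x : J × Bool, (∑ a ∈ U x, θ a * g a) * signPart x.2 (X x.1) := by
    rw [← Finset.sum_fiberwise_of_maps_to (s := Finset.univ) (g := lab) (t := Finset.univ)
      (fun _ _ => Finset.mem_univ _)]
    refine Finset.sum_congr rfl fun x _ => ?_
    rw [Finset.sum_mul]
    have h3 : U x = (Finset.univ.filter fun a => lab a = x).filter (fun a => a ∈ U x) := by
      ext a
      simp only [Finset.mem_filter, Finset.mem_univ, true_and]
      exact ⟨fun h => ⟨hU x a h, h⟩, fun h => h.2⟩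
    conv_rhs => rw [h3, Finset.sum_filter]
    refine Finset.sum_congr rfl fun a ha => ?_
    have hla := (Finset.mem_filter.1 ha).2
    rw [hla, hy, hla]
    split_ifs
    · ring
    · ring
  have h4 : ∑ o, W o * X o =
      ∑ x : J × Bool, (if x.2 then W x.1 else -W x.1) * signPart x.2 (X x.1) := by
    rw [Fintype.sum_prod_type]
    refine Finset.sum_congr rfl fun o _ => ?_
    rw [Fintype.sum_bool]
    conv_lhs => rw [← signPart_sub (X o)]
    simp only [if_true, Bool.false_eq_true, if_false]
    ring
  have h5 : ∑ o, |X o| = ∑ x : J × Bool, signPart x.2 (X x.1) := by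
    rw [Fintype.sum_prod_type]
    refine Finset.sum_congr rfl fun o _ => ?_
    rw [Fintype.sum_bool, signPart_add]
  rw [h2, h4, h5, ← Finset.sum_sub_distrib, Finset.mul_sum]
  refine (Finset.abs_sum_le_sum_abs _ _).trans (Finset.sum_le_sum fun x _ => ?_)
  rw [← sub_mul, abs_mul, abs_of_nonneg (signPart_nonneg _ _)]
  exact mul_le_mul_of_nonneg_right (hsel x.1 x.2) (signPart_nonneg _ _)

/-- The mask that follows the freezing pattern and decides the free parameters by `f`. -/
def decideFree {w : ℕ → ℕ} {k : ℕ} (ω : Param w k → ℝ × Bool × Bool) (f : Param w k → Bool) :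
    Param w k → Bool :=
  fun e => if (ω e).2.1 then false else if (ω e).2.2 then true else f e

theorem respects_decideFree {w : ℕ → ℕ} {k : ℕ} (ω : Param w k → ℝ × Bool × Bool)
    (f : Param w k → Bool) : Respects ω (decideFree ω f) := by
  intro e
  constructor
  · intro h; simp [decideFree, h]
  · intro h h'; simp [decideFree, h, h']

theorem masked_decideFree_of_free {w : ℕ → ℕ} {k : ℕ} {ω : Param w k → ℝ × Bool × Bool}
    {e : Param w k} (h : (ω e).2 = (false, false)) (f : Param w k → Bool) :
    masked ω (decideFree ω f) e = if f e then (ω e).1 else 0 := by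
  simp [masked, decideFree, h]

/-- Freezing thus appears in a sum of weights only as the fixed shift by the locked values. -/
theorem masked_decideFree {w : ℕ → ℕ} {k : ℕ} (ω : Param w k → ℝ × Bool × Bool)
    (f : Param w k → Bool) (e : Param w k) :
    masked ω (decideFree ω f) e = (if f e then freeVal (ω e) else 0) + lockVal (ω e) := by
  rcases h1 : (ω e).2.1 <;> rcases h2 : (ω e).2.2 <;> rcases h3 : f e <;>
    simp [masked, decideFree, freeVal, lockVal, h1, h2, h3]

theorem abs_masked_le {w : ℕ → ℕ} {k : ℕ} {ω : Param w k → ℝ × Bool × Bool}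
    (h : ∀ e, |(ω e).1| ≤ 1) (m : Param w k → Bool) (e : Param w k) : |masked ω m e| ≤ 1 := by
  unfold masked
  split_ifs
  · exact h e
  · simp

/-- The groups into which the neurons of a source network are divided. `lab0` assigns to every
neuron of layer `0` an input (or the constant) and a sign, `lab r` assigns to every neuron of layer
`r ≥ 1` the neuron of the target (or the constant) of which it is a copy. Only the neurons in
`alive r` are used. -/
structure Grouping (n nS : ℕ → ℕ) (L : ℕ) where
  lab0 : Fin (nS 0) → Option (Fin (n 0)) × Bool
  lab : (r : ℕ) → Fin (nS r) → Option (Fin (n r))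
  alive : (r : ℕ) → Finset (Fin (nS r))
  alive_eq_univ : ∀ r, 2 ≤ r → r < L → alive r = Finset.univ

/-- Every weight of the target can be realized, up to the tolerances `η`, by selecting free
parameters of the source network. -/
structure Good {n nS : ℕ → ℕ} {L : ℕ} (g : Grouping n nS L) (hL : 1 < L + 1) (η : ℕ → ℝ)
    (ω : Param (srcWidth (n 0) nS) (L + 1) → ℝ × Bool × Bool) : Prop where
  abs_le_one : ∀ e, |(ω e).1| ≤ 1
  unfrozen : ∀ e, (e.1 : ℕ) < 2 → (ω e).2 = (false, false)
  input : ∀ i ∈ g.alive 1, ∀ o σ, Selectable (Finset.univ.filter fun a => g.lab0 a = (o, σ))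
    (fun a => (ω ⟨⟨1, hL⟩, i, some a⟩).1 * gate σ (ω ⟨⟨0, L.succ_pos⟩, a, o⟩).1) (fun _ => 0) (η 1)
  frozen : ∀ r (h : r + 2 < L + 1), ∀ i ∈ g.alive (r + 2), ∀ o,
    Selectable ((g.alive (r + 1)).filter fun j => g.lab (r + 1) j = o)
      (fun j => freeVal (ω ⟨⟨r + 2, h⟩, i, some j⟩)) (fun j => lockVal (ω ⟨⟨r + 2, h⟩, i, some j⟩))
      (η (r + 2))

/-- In layer `0`, only the weight of the assigned input is kept, and only if it is suitable. -/
noncomputable def Grouping.keepInput {n nS : ℕ → ℕ} {L : ℕ} (g : Grouping n nS L) (a : Fin (nS 0))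
    (o : Option (Fin (n 0))) (v : ℝ) : Bool :=
  decide (o = (g.lab0 a).1 ∧ gate (g.lab0 a).2 v ≠ 0)

/-- In layer `1`, the used neurons keep the weights of the selected neurons. -/
def Grouping.keepFirst {n nS : ℕ → ℕ} {L : ℕ} (g : Grouping n nS L)
    (U : Fin (nS 1) → Option (Fin (n 0)) × Bool → Finset (Fin (nS 0))) (i : Fin (nS 1)) :
    Option (Fin (nS 0)) → Bool
  | some a => decide (i ∈ g.alive 1 ∧ a ∈ U i (g.lab0 a))
  | none => false

/-- In the frozen layers, the weights of the selected neurons are kept. -/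
def Grouping.keepFrozen {n nS : ℕ → ℕ} {L : ℕ} (g : Grouping n nS L) (r : ℕ)
    (U : Option (Fin (n (r + 1))) → Finset (Fin (nS (r + 1)))) :
    Option (Fin (nS (r + 1))) → Bool
  | some j => decide (j ∈ U (g.lab (r + 1) j))
  | none => false

/-- The decisions about the free parameters, given the selected neurons. -/
noncomputable def selection {n nS : ℕ → ℕ} {L : ℕ} (g : Grouping n nS L)
    (ω : Param (srcWidth (n 0) nS) (L + 1) → ℝ × Bool × Bool)
    (U1 : Fin (nS 1) → Option (Fin (n 0)) × Bool → Finset (Fin (nS 0)))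
    (U2 : (r : ℕ) → Fin (nS (r + 2)) → Option (Fin (n (r + 1))) → Finset (Fin (nS (r + 1)))) :
    Param (srcWidth (n 0) nS) (L + 1) → Bool
  | ⟨⟨0, h⟩, a, o⟩ => g.keepInput a o (ω ⟨⟨0, h⟩, a, o⟩).1
  | ⟨⟨1, _⟩, i, o⟩ => g.keepFirst U1 i o
  | ⟨⟨r + 2, _⟩, i, o⟩ => g.keepFrozen r (U2 r i) o

end Construction

/-! ### Construction of the mask and propagation of errors -/

section Construction

variable {n nS : ℕ → ℕ} {L : ℕ}

/-- Only the weight of the assigned input survives the mask. It too is dropped if its gate vanishes,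
and then both sides are `0`. The bias serves as the weight of the constant input. -/
theorem Good.neurons_one {g : Grouping n nS L} {hL : 1 < L + 1} {η : ℕ → ℝ}
    {ω : Param (srcWidth (n 0) nS) (L + 1) → ℝ × Bool × Bool} (hω : Good g hL η ω)
    (U1 : Fin (nS 1) → Option (Fin (n 0)) × Bool → Finset (Fin (nS 0)))
    (U2 : (r : ℕ) → Fin (nS (r + 2)) → Option (Fin (n (r + 1))) → Finset (Fin (nS (r + 1))))
    (x : Fin (n 0) → ℝ) (a : Fin (nS 0)) :
    neurons (masked ω (decideFree ω (selection g ω U1 U2))) x 1 a =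
      gate (g.lab0 a).2 (ω ⟨⟨0, L.succ_pos⟩, a, (g.lab0 a).1⟩).1 *
        signPart (g.lab0 a).2 (withOne x (g.lab0 a).1) := by
  set v := (ω ⟨⟨0, L.succ_pos⟩, a, (g.lab0 a).1⟩).1 with hv
  have h1 := neurons_succ (masked ω (decideFree ω (selection g ω U1 U2))) x L.succ_pos a
  refine (h1.trans (congrArg (max 0) (affine_eq_sum_withOne _ _ _ _))).trans ?_
  have hθ : ∀ o : Option (Fin (n 0)),
      masked ω (decideFree ω (selection g ω U1 U2)) ⟨⟨0, L.succ_pos⟩, a, o⟩ =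
      if o = (g.lab0 a).1 then (if gate (g.lab0 a).2 v ≠ 0 then v else 0) else 0 := by
    intro o
    refine (masked_decideFree_of_free (hω.unfrozen _ Nat.zero_lt_two) _).trans ?_
    change (if g.keepInput a o (ω ⟨⟨0, L.succ_pos⟩, a, o⟩).1 = true then
      (ω ⟨⟨0, L.succ_pos⟩, a, o⟩).1 else 0) = _
    by_cases ho : o = (g.lab0 a).1
    · subst ho
      simp [Grouping.keepInput, hv]
    · simp [Grouping.keepInput, ho]
  have hsum : ∑ o : Option (Fin (n 0)),
      masked ω (decideFree ω (selection g ω U1 U2)) ⟨⟨0, L.succ_pos⟩, a, o⟩ * withOne x o =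
      (if gate (g.lab0 a).2 v ≠ 0 then v else 0) * withOne x (g.lab0 a).1 := by
    simp only [hθ, ite_mul, zero_mul, Finset.sum_ite_eq', Finset.mem_univ, if_true]
  refine (congrArg (max 0) hsum).trans ?_
  by_cases hg : gate (g.lab0 a).2 v = 0
  · simp [hg]
  · rw [if_pos hg]
    exact relu_mul_of_gate_ne_zero hg _

/-- A good source network has a mask for which all used preactivations approximate those of the
target network. -/
theorem Good.exists_mask {g : Grouping n nS L} {hL : 1 < L + 1} {η : ℕ → ℝ}
    {ω : Param (srcWidth (n 0) nS) (L + 1) → ℝ × Bool × Bool} (hω : Good g hL η ω)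
    {θT : Param n L → ℝ} (hθT : ∀ e, |θT e| ≤ 1) :
    ∃ m, Respects ω m ∧ ∀ (x : Fin (n 0) → ℝ) (e : ℕ → ℝ),
      (η 1 * (1 + ∑ i, |x i|) ≤ e 1) →
      (∀ r, r + 2 < L + 1 → η (r + 2) * (1 + ∑ i, |neurons θT x (r + 1) i|) +
        (g.alive (r + 1)).card * e (r + 1) ≤ e (r + 2)) →
      ∀ r (hr : r < L), ∀ i ∈ g.alive (r + 1),
        |affine (masked ω m) ⟨r + 1, Nat.succ_lt_succ hr⟩ (neurons (masked ω m) x (r + 1)) i -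
          ∑ o, homWeight θT ⟨r, hr⟩ (g.lab (r + 1) i) o * withOne (neurons θT x r) o| ≤
            e (r + 1) := by
  have hL' : 0 < L := Nat.lt_of_succ_lt_succ hL
  have hU1 : ∀ i : Fin (nS 1), ∀ x : Option (Fin (n 0)) × Bool, ∃ U : Finset (Fin (nS 0)),
      (∀ a ∈ U, g.lab0 a = x) ∧ (i ∈ g.alive 1 →
        |∑ a ∈ U, (ω ⟨⟨1, hL⟩, i, some a⟩).1 * gate x.2 (ω ⟨⟨0, L.succ_pos⟩, a, x.1⟩).1 -
          (if x.2 then homWeight θT ⟨0, hL'⟩ (g.lab 1 i) x.1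
            else -homWeight θT ⟨0, hL'⟩ (g.lab 1 i) x.1)| ≤ η 1) := by
    intro i x
    by_cases hi : i ∈ g.alive 1
    · obtain ⟨U, hU, h⟩ := hω.input i hi x.1 x.2
        (if x.2 then homWeight θT ⟨0, hL'⟩ (g.lab 1 i) x.1
            else -homWeight θT ⟨0, hL'⟩ (g.lab 1 i) x.1) (by
          have := abs_homWeight_le hθT ⟨0, hL'⟩ (g.lab 1 i) x.1
          split_ifs
          · linarith
          · rw [abs_neg]; linarith)
      refine ⟨U, fun a ha => (Finset.mem_filter.1 (hU ha)).2, fun _ => ?_⟩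
      simpa using h
    · exact ⟨∅, by simp, fun h => absurd h hi⟩
  choose U1 hU1lab hU1 using hU1
  -- A locked bias cannot be removed, so it is subtracted from the target of the constant group. The
  -- target weight and the locked bias are each at most `1` in absolute value, which is why targets
  -- up to `2` are required in `Selectable`.
  have hU2 : ∀ (r : ℕ) (i : Fin (nS (r + 2))) (o : Option (Fin (n (r + 1)))),
      ∃ U : Finset (Fin (nS (r + 1))), ∀ (h : r + 2 < L + 1), i ∈ g.alive (r + 2) →
        (U ⊆ (g.alive (r + 1)).filter fun j => g.lab (r + 1) j = o) ∧
        |∑ j ∈ U, freeVal (ω ⟨⟨r + 2, h⟩, i, some j⟩) +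
          ∑ j ∈ (g.alive (r + 1)).filter (fun j => g.lab (r + 1) j = o),
            lockVal (ω ⟨⟨r + 2, h⟩, i, some j⟩) -
          (homWeight θT ⟨r + 1, Nat.lt_of_succ_lt_succ h⟩ (g.lab (r + 2) i) o -
            if o = none then lockVal (ω ⟨⟨r + 2, h⟩, i, none⟩) else 0)| ≤ η (r + 2) := by
    intro r i o
    by_cases h : r + 2 < L + 1
    · by_cases hi : i ∈ g.alive (r + 2)
      · obtain ⟨U, hU, h'⟩ := hω.frozen r h i hi o
          (homWeight θT ⟨r + 1, Nat.lt_of_succ_lt_succ h⟩ (g.lab (r + 2) i) o -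
            if o = none then lockVal (ω ⟨⟨r + 2, h⟩, i, none⟩) else 0) (by
            have h1 := abs_homWeight_le hθT ⟨r + 1, Nat.lt_of_succ_lt_succ h⟩ (g.lab (r + 2) i) o
            have h2 := (abs_lockVal_le (ω ⟨⟨r + 2, h⟩, i, none⟩)).trans (hω.abs_le_one _)
            refine (abs_sub _ _).trans ?_
            split_ifs
            · linarith
            · rw [abs_zero]; linarith)
        exact ⟨U, fun _ _ => ⟨hU, h'⟩⟩
      · exact ⟨∅, fun _ h' => absurd h' hi⟩
    · exact ⟨∅, fun h' => absurd h' h⟩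
  choose U2 hU2 using hU2
  refine ⟨decideFree ω (selection g ω U1 U2), respects_decideFree _ _, ?_⟩
  intro x e he1 he2
  set θ := masked ω (decideFree ω (selection g ω U1 U2)) with hθ
  have hθ1 : ∀ e, |θ e| ≤ 1 := abs_masked_le hω.abs_le_one _
  intro r
  induction r with
  | zero =>
    intro hr i hi
    have hnone : θ ⟨⟨1, hL⟩, i, none⟩ = 0 :=
      masked_decideFree_of_free (hω.unfrozen _ Nat.one_lt_two) _
    have hsome : ∀ a : Fin (nS 0), θ ⟨⟨1, hL⟩, i, some a⟩ =
        if a ∈ U1 i (g.lab0 a) then (ω ⟨⟨1, hL⟩, i, some a⟩).1 else 0 := by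
      intro a
      refine (masked_decideFree_of_free (hω.unfrozen _ Nat.one_lt_two) _).trans ?_
      change (if g.keepFirst U1 i (some a) = true then (ω ⟨⟨1, hL⟩, i, some a⟩).1 else 0) = _
      simp [Grouping.keepFirst, hi]
    have h := abs_input_layer_sub_le g.lab0 (U1 i) (hU1lab i) (withOne x)
      (homWeight θT ⟨0, hL'⟩ (g.lab 1 i)) (fun a => (ω ⟨⟨1, hL⟩, i, some a⟩).1)
      (fun a => neurons θ x 1 a)
      (fun a => gate (g.lab0 a).2 (ω ⟨⟨0, L.succ_pos⟩, a, (g.lab0 a).1⟩).1) (η := η 1)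
      (fun a => hω.neurons_one U1 U2 x a) (fun o σ => by
        have h1 := hU1 i (o, σ) hi
        have h2 : ∑ a ∈ U1 i (o, σ), (ω ⟨⟨1, hL⟩, i, some a⟩).1 *
            gate (g.lab0 a).2 (ω ⟨⟨0, L.succ_pos⟩, a, (g.lab0 a).1⟩).1 =
            ∑ a ∈ U1 i (o, σ), (ω ⟨⟨1, hL⟩, i, some a⟩).1 *
            gate σ (ω ⟨⟨0, L.succ_pos⟩, a, o⟩).1 :=
          Finset.sum_congr rfl fun a ha => by rw [hU1lab i (o, σ) a ha]
        rw [h2]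
        exact h1)
    rw [sum_abs_withOne] at h
    refine le_trans (le_of_eq ?_) (h.trans he1)
    congr 1
    congr 1
    refine (affine_eq_sum_withOne _ _ _ _).trans ((Fintype.sum_option _).trans ?_)
    refine (congrArg₂ (· + ·) (mul_eq_zero_of_left hnone _) ?_).trans (zero_add _)
    exact Finset.sum_congr rfl fun a _ => congrArg (· * _) (hsome a)
  | succ r ih =>
    intro hr i hi
    have hr' : r < L := Nat.lt_of_succ_lt hr
    have hlt : r + 2 < L + 1 := Nat.succ_lt_succ hr
    -- Only layer `1` can have unused hidden neurons; all their incoming parameters, bias included,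
    -- are masked, which is possible because that layer is unfrozen.
    have hy0 : ∀ j ∉ g.alive (r + 1), neurons θ x (r + 2) j = 0 := by
      intro j hj
      rcases Nat.eq_zero_or_pos r with h0 | h0
      · subst h0
        refine (neurons_succ θ x hL j).trans ?_
        have hz : ∀ o : Option (Fin (nS 0)), θ ⟨⟨1, hL⟩, j, o⟩ = 0 := by
          intro o
          refine (masked_decideFree_of_free (hω.unfrozen _ Nat.one_lt_two) _).trans ?_
          refine if_neg ?_
          change ¬ g.keepFirst U1 j o = true
          cases o with
          | none => simp [Grouping.keepFirst]
          | some a => simp [Grouping.keepFirst, hj]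
        exact (congrArg (max 0) ((affine_eq_sum_withOne _ _ _ _).trans
          (Finset.sum_eq_zero fun o _ => mul_eq_zero_of_left (hz o) _))).trans (max_self 0)
      · rw [g.alive_eq_univ (r + 1) (by omega) hr] at hj
        exact absurd (Finset.mem_univ j) hj
    have hye : ∀ j ∈ g.alive (r + 1),
        |neurons θ x (r + 2) j - withOne (neurons θT x (r + 1)) (g.lab (r + 1) j)| ≤ e (r + 1) := by
      intro j hj
      rw [withOne_neurons_succ θT x hr']
      refine le_trans (le_of_eq ?_) ((abs_relu_sub_le _ _).trans (ih hr' j hj))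
      rw [neurons_succ θ x (Nat.succ_lt_succ hr') j]
    have hval : ∀ j : Fin (nS (r + 1)), θ ⟨⟨r + 2, hlt⟩, i, some j⟩ =
        (if j ∈ U2 r i (g.lab (r + 1) j) then freeVal (ω ⟨⟨r + 2, hlt⟩, i, some j⟩) else 0) +
          lockVal (ω ⟨⟨r + 2, hlt⟩, i, some j⟩) := by
      intro j
      refine (masked_decideFree ω _ _).trans ?_
      change (if g.keepFrozen r (U2 r i) (some j) = true then _ else _) + _ = _
      simp [Grouping.keepFrozen]
    -- A free bias is always dropped; the copies of the constant neuron do its work.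
    have hbias : θ ⟨⟨r + 2, hlt⟩, i, none⟩ = lockVal (ω ⟨⟨r + 2, hlt⟩, i, none⟩) := by
      refine (masked_decideFree ω _ _).trans ?_
      change (if g.keepFrozen r (U2 r i) none = true then _ else _) + _ = _
      simp [Grouping.keepFrozen]
    have h := abs_layer_sub_le (g.alive (r + 1)) (g.lab (r + 1)) (neurons θ x (r + 2))
      (withOne (neurons θT x (r + 1))) (homWeight θT ⟨r + 1, hr⟩ (g.lab (r + 2) i))
      (fun j => θ ⟨⟨r + 2, hlt⟩, i, some j⟩)
      (fun o => if o = none then lockVal (ω ⟨⟨r + 2, hlt⟩, i, none⟩) else 0) hy0 hye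
      (fun j => hθ1 _) (η := η (r + 2)) (fun o => by
        obtain ⟨h1, h2⟩ := hU2 r i o hlt hi
        have h3 : ∑ j ∈ (g.alive (r + 1)).filter (fun j => g.lab (r + 1) j = o),
            θ ⟨⟨r + 2, hlt⟩, i, some j⟩ = ∑ j ∈ U2 r i o, freeVal (ω ⟨⟨r + 2, hlt⟩, i, some j⟩) +
            ∑ j ∈ (g.alive (r + 1)).filter (fun j => g.lab (r + 1) j = o),
              lockVal (ω ⟨⟨r + 2, hlt⟩, i, some j⟩) := by
          rw [Finset.sum_congr rfl fun j _ => hval j, Finset.sum_add_distrib]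
          congr 1
          have h4 : U2 r i o = ((g.alive (r + 1)).filter fun j => g.lab (r + 1) j = o).filter
              (fun j => j ∈ U2 r i o) := by
            ext j
            simp only [Finset.mem_filter]
            exact ⟨fun h => ⟨Finset.mem_filter.1 (h1 h), h⟩, fun h => h.2⟩
          conv_rhs => rw [h4, Finset.sum_filter]
          refine Finset.sum_congr rfl fun j hj => ?_
          rw [(Finset.mem_filter.1 hj).2]
        rw [h3]
        convert h2 using 2
        ring)
    rw [sum_abs_withOne] at h
    refine le_trans (le_of_eq ?_) (h.trans (he2 r hlt))
    congr 1
    congr 1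
    refine (affine_eq_sum_withOne _ _ _ _).trans ((Fintype.sum_option _).trans ?_)
    refine (add_comm _ _).trans (congrArg₂ (· + ·) rfl ?_)
    refine (congrArg (· * (1 : ℝ)) hbias).trans ?_
    rw [Fintype.sum_option]
    simp [withOne]

/-- A good source network has an admissible mask under which it approximates the target. -/
theorem Good.exists_approx {g : Grouping n nS L} {hL : 1 < L + 1} {η : ℕ → ℝ}
    {ω : Param (srcWidth (n 0) nS) (L + 1) → ℝ × Bool × Bool} (hω : Good g hL η ω)
    {θT : Param n L → ℝ} (hθT : ∀ e, |θT e| ≤ 1) (hout : n L ≤ nS L)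
    (halive : ∀ i : Fin (n L), Fin.castLE hout i ∈ g.alive L)
    (hlab : ∀ i : Fin (n L), g.lab L (Fin.castLE hout i) = some i)
    (D : Set (Fin (n 0) → ℝ)) (e : ℕ → ℝ)
    (he1 : ∀ x ∈ D, η 1 * (1 + ∑ i, |x i|) ≤ e 1)
    (he2 : ∀ x ∈ D, ∀ r, r + 2 < L + 1 → η (r + 2) * (1 + ∑ i, |neurons θT x (r + 1) i|) +
        (g.alive (r + 1)).card * e (r + 1) ≤ e (r + 2)) :
    ∃ m, Respects ω m ∧ ∀ (i : Fin (n L)), ∀ x ∈ D,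
      |netFun θT x i - netFun (masked ω m) x (Fin.castLE hout i)| ≤ e L := by
  obtain ⟨m, hm, h⟩ := hω.exists_mask hθT
  refine ⟨m, hm, fun i x hx => ?_⟩
  obtain ⟨M, rfl⟩ : ∃ M, L = M + 1 := ⟨L - 1, by omega⟩
  have h1 := h x e (he1 x hx) (he2 x hx) M (Nat.lt_succ_self M) _ (halive i)
  rw [hlab, abs_sub_comm] at h1
  refine le_trans (le_of_eq ?_) h1
  congr 1
  change affine θT (Fin.last M) (neurons θT x M) i - _ = _
  rw [affine_eq_sum_withOne]
  rfl

end Construction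

/-! ### Union bound and cyclic grouping -/

section GoodProbability

open MeasureTheory ProbabilityTheory Set

/-- The density, on `[-1/2, 1/2]`, of the random variables that are available for the subset sums
between the layers `r` and `r + 1`. -/
noncomputable def freeDensity (p q : ℕ → ℝ) : ℕ → ℝ
  | 0 => 1 / 8
  | r + 1 => (1 - p (r + 2)) * (1 - q (r + 2)) / 2

/-- The exponential rate of the subset sums between the layers `r` and `r + 1` with groups of `s r`
neurons. -/
noncomputable def rate (p q : ℕ → ℝ) (s : ℕ → ℕ) (r : ℕ) : ℝ :=
  freeDensity p q r ^ 2 * s r / 2304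

theorem layerRatio_mem {L : ℕ} {p : ℕ → ℝ} (hp : ∀ l, 2 ≤ l → l ≤ L → p l ∈ Ioo (0 : ℝ) 1)
    (l : Fin (L + 1)) : 0 ≤ layerRatio p l ∧ layerRatio p l ≤ 1 := by
  unfold layerRatio
  split_ifs with h
  · norm_num
  · have := hp l (by omega) (by omega)
    exact ⟨this.1.le, this.2.le⟩

theorem layerRatio_of_two_le (p : ℕ → ℝ) {l : ℕ} (hl : 2 ≤ l) : layerRatio p l = p l :=
  if_neg (by omega)

theorem isProbabilityMeasure_layerLaw {L : ℕ} {p q : ℕ → ℝ}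
    (hp : ∀ l, 2 ≤ l → l ≤ L → p l ∈ Ioo (0 : ℝ) 1)
    (hq : ∀ l, 2 ≤ l → l ≤ L → q l ∈ Ioo (0 : ℝ) 1) (l : Fin (L + 1)) :
    IsProbabilityMeasure (paramLaw (layerRatio p l) (layerRatio q l)) :=
  isProbabilityMeasure_paramLaw (layerRatio_mem hp l).1 (layerRatio_mem hp l).2
    (layerRatio_mem hq l).1 (layerRatio_mem hq l).2

theorem sum_sum_const_ofReal {α β : Type*} (A : Finset α) [Fintype β] (c : ℝ) :
    ∑ _i ∈ A, ∑ _x : β, ENNReal.ofReal c =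
      ENNReal.ofReal ((A.card : ℝ) * (Fintype.card β : ℝ) * c) := by
  rw [Finset.sum_const, Finset.sum_const, nsmul_eq_mul, nsmul_eq_mul, ← mul_assoc,
    ENNReal.ofReal_mul (by positivity), ENNReal.ofReal_mul (by positivity),
    ENNReal.ofReal_natCast, ENNReal.ofReal_natCast, Finset.card_univ]

/-- Union bound over the target weights as seen from each used neuron. Up to a null set, failure
splits into `L` families, one for the input stage and one for each of the `L - 1` frozen layers, and
each is granted `δ / L`. The number of groups in the input stage is `2 * (n 0 + 1)`: an input or the
constant, and a sign. -/
theorem sourceLaw_not_good_le {n nS : ℕ → ℕ} {L : ℕ} (g : Grouping n nS L) (hL : 1 < L + 1)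
    {p q : ℕ → ℝ} (hp : ∀ l, 2 ≤ l → l ≤ L → p l ∈ Ioo (0 : ℝ) 1)
    (hq : ∀ l, 2 ≤ l → l ≤ L → q l ∈ Ioo (0 : ℝ) 1) (s : ℕ → ℕ)
    (hs0 : ∀ x, s 0 ≤ (Finset.univ.filter fun a => g.lab0 a = x).card)
    (hs : ∀ r, r + 2 < L + 1 → ∀ o,
      s (r + 1) ≤ ((g.alive (r + 1)).filter fun j => g.lab (r + 1) j = o).card)
    {δ : ℝ} (hδ : 0 ≤ δ)
    (h0 : (g.alive 1).card * (2 * ((n 0 : ℝ) + 1)) * (10 * Real.exp (-rate p q s 0)) ≤ δ / L)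
    (h1 : ∀ r, r + 2 < L + 1 → (g.alive (r + 2)).card * ((n (r + 1) : ℝ) + 1) *
      (10 * Real.exp (-rate p q s (r + 1))) ≤ δ / L) :
    sourceLaw (srcWidth (n 0) nS) (L + 1) p q
      {ω | ¬ Good g hL (fun l => Real.exp (-rate p q s (l - 1))) ω} ≤ ENNReal.ofReal δ := by
  have hprob : ∀ e : Param (srcWidth (n 0) nS) (L + 1),
      IsProbabilityMeasure (paramLaw (layerRatio p e.1) (layerRatio q e.1)) :=
    fun e => isProbabilityMeasure_layerLaw hp hq e.1
  set μ : Measure (Param (srcWidth (n 0) nS) (L + 1) → ℝ × Bool × Bool) :=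
    sourceLaw (srcWidth (n 0) nS) (L + 1) p q with hμ
  have hL0 : (0 : ℝ) < L := by exact_mod_cast Nat.lt_of_succ_lt_succ hL
  set N : Set (Param (srcWidth (n 0) nS) (L + 1) → ℝ × Bool × Bool) :=
    {ω | ¬ ∀ e, |(ω e).1| ≤ 1 ∧ ((e.1 : ℕ) < 2 → (ω e).2 = (false, false))} with hN
  set G0 : Option (Fin (n 0)) × Bool → Finset (Fin (nS 0)) := fun x =>
    Finset.univ.filter fun a => g.lab0 a = x with hG0
  set G1 : (r : ℕ) → Option (Fin (n (r + 1))) → Finset (Fin (nS (r + 1))) := fun r o =>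
    (g.alive (r + 1)).filter fun j => g.lab (r + 1) j = o with hG1
  set B0 : Fin (nS 1) → Option (Fin (n 0)) × Bool →
      Set (Param (srcWidth (n 0) nS) (L + 1) → ℝ × Bool × Bool) := fun i x =>
    {ω | ¬ Selectable (G0 x)
      (fun a => (ω ⟨⟨1, hL⟩, i, some a⟩).1 * gate x.2 (ω ⟨⟨0, L.succ_pos⟩, a, x.1⟩).1) (fun _ => 0)
      (Real.exp (-rate p q s 0))} with hB0
  have hlt : ∀ r : Fin (L - 1), r.1 + 2 < L + 1 := fun r => by omega
  set B : (r : Fin (L - 1)) → Fin (nS (r + 2)) → Option (Fin (n (r + 1))) →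
      Set (Param (srcWidth (n 0) nS) (L + 1) → ℝ × Bool × Bool) := fun r i o =>
    {ω | ¬ Selectable (G1 r o)
      (fun j => freeVal (ω ⟨⟨r + 2, hlt r⟩, i, some j⟩))
      (fun j => lockVal (ω ⟨⟨r + 2, hlt r⟩, i, some j⟩))
      (Real.exp (-rate p q s (r + 1)))} with hB
  have hN0 : μ N = 0 := by
    have : ∀ᵐ ω ∂μ, ∀ e, |(ω e).1| ≤ 1 ∧ ((e.1 : ℕ) < 2 → (ω e).2 = (false, false)) := by
      refine ae_all_iff.2 fun e => ?_
      have h2 : ∀ᵐ x ∂paramLaw (layerRatio p e.1) (layerRatio q e.1),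
          |x.1| ≤ 1 ∧ ((e.1 : ℕ) < 2 → x.2 = (false, false)) := by
        have h3 := ae_paramLaw_abs_le_one (layerRatio_mem hp e.1).1 (layerRatio_mem hp e.1).2
          (layerRatio_mem hq e.1).1 (layerRatio_mem hq e.1).2
        by_cases he : (e.1 : ℕ) < 2
        · have h4 : ∀ᵐ x ∂paramLaw (layerRatio p e.1) (layerRatio q e.1),
              x.2.1 = false ∧ x.2.2 = false := by
            rw [layerRatio, if_pos he, layerRatio, if_pos he]
            exact ae_paramLaw_zero
          filter_upwards [h3, h4] with x hx hx' using ⟨hx, fun _ => Prod.ext hx'.1 hx'.2⟩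
        · filter_upwards [h3] with x hx using ⟨hx, fun h => absurd h he⟩
      exact (Measure.quasiMeasurePreserving_eval
        (fun e : Param (srcWidth (n 0) nS) (L + 1) =>
          paramLaw (layerRatio p e.1) (layerRatio q e.1)) e).ae h2
    exact ae_iff.1 this
  have hB0le : ∀ i x, μ (B0 i x) ≤ ENNReal.ofReal (10 * Real.exp (-rate p q s 0)) := by
    intro i x
    have := measure_not_selectable_input_le (w := srcWidth (n 0) nS) (k := L + 1)
      (μ := fun e => paramLaw (layerRatio p e.1) (layerRatio q e.1)) L.succ_pos hL i x.1 x.2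
      (G0 x)
      (fun e he => by rw [layerRatio, if_pos he, layerRatio, if_pos he]) (hs0 _)
    exact this
  have hBle : ∀ r i o, μ (B r i o) ≤ ENNReal.ofReal (10 * Real.exp (-rate p q s (r + 1))) := by
    intro r i o
    have hp' := hp (r + 2) (by omega) (by omega)
    have hq' := hq (r + 2) (by omega) (by omega)
    have := measure_not_selectable_frozen_le (w := srcWidth (n 0) nS) (k := L + 1)
      (μ := fun e => paramLaw (layerRatio p e.1) (layerRatio q e.1)) ⟨r + 2, hlt r⟩ i
      (G1 r o) hp'.1.le hp'.2.le hq'.1.le hq'.2.le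
      (fun e he => by
        have h2 : (e.1 : ℕ) = r + 2 := congrArg Fin.val he
        rw [h2, layerRatio_of_two_le p (by omega), layerRatio_of_two_le q (by omega)])
      (hs r (hlt r) o)
    exact this
  have hsub : {ω | ¬ Good g hL (fun l => Real.exp (-rate p q s (l - 1))) ω} ⊆
      N ∪ ((⋃ i ∈ g.alive 1, ⋃ x, B0 i x) ∪
        ⋃ r : Fin (L - 1), ⋃ i ∈ g.alive (r + 2), ⋃ o, B r i o) := by
    intro ω hω
    by_contra hcon
    simp only [mem_union, mem_iUnion, not_or, not_exists] at hcon
    obtain ⟨c1, c2, c3⟩ := hcon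
    have c1' := not_not.1 c1
    refine hω ⟨fun e => (c1' e).1, fun e => (c1' e).2, ?_, ?_⟩
    · intro i hi o σ
      exact not_not.1 (c2 i hi (o, σ))
    · intro r h i hi o
      exact not_not.1 (c3 ⟨r, by omega⟩ i hi o)
  have hS0 : μ (⋃ i ∈ g.alive 1, ⋃ x, B0 i x) ≤ ENNReal.ofReal (δ / L) := by
    calc _ ≤ ∑ i ∈ g.alive 1, ∑ x : Option (Fin (n 0)) × Bool,
          ENNReal.ofReal (10 * Real.exp (-rate p q s 0)) :=
        (measure_biUnion_finset_le _ _).trans (Finset.sum_le_sum fun i _ =>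
          (measure_iUnion_fintype_le _ _).trans (Finset.sum_le_sum fun x _ => hB0le i x))
      _ = ENNReal.ofReal ((g.alive 1).card * (2 * ((n 0 : ℝ) + 1)) *
            (10 * Real.exp (-rate p q s 0))) := by
          rw [sum_sum_const_ofReal, Fintype.card_prod, Fintype.card_option, Fintype.card_fin,
            Fintype.card_bool]
          push_cast
          congr 3
          ring
      _ ≤ _ := ENNReal.ofReal_le_ofReal h0
  have hS1 : ∀ r : Fin (L - 1), μ (⋃ i ∈ g.alive (r + 2), ⋃ o, B r i o) ≤
      ENNReal.ofReal (δ / L) := by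
    intro r
    calc _ ≤ ∑ i ∈ g.alive (r + 2), ∑ o : Option (Fin (n (r + 1))),
          ENNReal.ofReal (10 * Real.exp (-rate p q s (r + 1))) :=
        (measure_biUnion_finset_le _ _).trans (Finset.sum_le_sum fun i _ =>
          (measure_iUnion_fintype_le _ _).trans (Finset.sum_le_sum fun o _ => hBle r i o))
      _ = ENNReal.ofReal ((g.alive (r + 2)).card * ((n (r + 1) : ℝ) + 1) *
            (10 * Real.exp (-rate p q s (r + 1)))) := by
          rw [sum_sum_const_ofReal, Fintype.card_option, Fintype.card_fin]
          push_cast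
          rfl
      _ ≤ _ := ENNReal.ofReal_le_ofReal (h1 r (hlt r))
  calc _ ≤ μ N + (μ (⋃ i ∈ g.alive 1, ⋃ x, B0 i x) +
        μ (⋃ r : Fin (L - 1), ⋃ i ∈ g.alive (r + 2), ⋃ o, B r i o)) :=
        (measure_mono hsub).trans ((measure_union_le _ _).trans
          (add_le_add le_rfl (measure_union_le _ _)))
    _ ≤ 0 + (ENNReal.ofReal (δ / L) + ∑ _r : Fin (L - 1), ENNReal.ofReal (δ / L)) := by
        refine add_le_add hN0.le (add_le_add hS0 ?_)
        exact (measure_iUnion_fintype_le _ _).trans (Finset.sum_le_sum fun r _ => hS1 r)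
    _ = ENNReal.ofReal δ := by
        rw [zero_add, Finset.sum_const, Finset.card_univ, Fintype.card_fin, nsmul_eq_mul,
          ← ENNReal.ofReal_natCast, ← ENNReal.ofReal_mul (by positivity),
          ← ENNReal.ofReal_add (by positivity) (by positivity), Nat.cast_sub (by omega)]
        congr 1
        field_simp
        push_cast
        ring

/-- Each of the `U / M` complete blocks of length `M` below `U` contains every residue once. -/
theorem le_card_filter_mod {N U M : ℕ} {J : Type*} [DecidableEq J] (hM : 0 < M) (hU : U ≤ N)
    (e : Fin M ≃ J) (j : J) : U / M ≤ ((Finset.univ.filter fun i : Fin N => i.1 < U).filter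
      fun i => e ⟨i.1 % M, Nat.mod_lt _ hM⟩ = j).card := by
  have hlt : ∀ t : Fin (U / M), t.1 * M + (e.symm j).1 < U := fun t => by
    calc t.1 * M + (e.symm j).1 < t.1 * M + M := Nat.add_lt_add_left (e.symm j).2 _
      _ = (t.1 + 1) * M := by ring
      _ ≤ (U / M) * M := Nat.mul_le_mul_right _ t.2
      _ ≤ U := Nat.div_mul_le_self _ _
  have hinj : Function.Injective fun t : Fin (U / M) =>
      (⟨t.1 * M + (e.symm j).1, (hlt t).trans_le hU⟩ : Fin N) := by
    intro a b hab
    have h1 : a.1 * M + (e.symm j).1 = b.1 * M + (e.symm j).1 := congrArg Fin.val hab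
    exact Fin.ext (Nat.eq_of_mul_eq_mul_right hM (Nat.add_right_cancel h1))
  have h := Finset.card_le_card_of_injOn (s := (Finset.univ : Finset (Fin (U / M))))
    (t := (Finset.univ.filter fun i : Fin N => i.1 < U).filter
      fun i => e ⟨i.1 % M, Nat.mod_lt _ hM⟩ = j) _ (fun t _ => by
        simp only [Finset.coe_filter, Finset.mem_filter, Finset.mem_univ, true_and, mem_ofPred_eq]
        refine ⟨hlt t, ?_⟩
        have h2 : (t.1 * M + (e.symm j).1) % M = (e.symm j).1 := by
          rw [Nat.mul_comm, Nat.mul_add_mod, Nat.mod_eq_of_lt (e.symm j).2]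
        have h3 : (⟨(t.1 * M + (e.symm j).1) % M, Nat.mod_lt _ hM⟩ : Fin M) = e.symm j :=
          Fin.ext h2
        rw [h3, Equiv.apply_symm_apply]) hinj.injOn
  simpa using h

/-- The cyclic grouping in which the first `U r` neurons of layer `r ≥ 1` are used. -/
noncomputable def cyclicGrouping (n nS U : ℕ → ℕ) (L : ℕ)
    (hU : ∀ r, 2 ≤ r → r < L → U r = nS r) : Grouping n nS L where
  lab0 a := (Fintype.equivFin (Option (Fin (n 0)) × Bool)).symm
    ⟨a.1 % Fintype.card (Option (Fin (n 0)) × Bool), Nat.mod_lt _ Fintype.card_pos⟩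
  lab r i := finSuccEquivLast ⟨i.1 % (n r + 1), Nat.mod_lt _ (Nat.succ_pos _)⟩
  alive r := Finset.univ.filter fun i => i.1 < U r
  alive_eq_univ r h2 hr := by
    ext i
    simp [hU r h2 hr]

section Cyclic

variable {n nS U : ℕ → ℕ} {L : ℕ} {hU : ∀ r, 2 ≤ r → r < L → U r = nS r}

theorem card_alive_cyclicGrouping_le (r : ℕ) :
    ((cyclicGrouping n nS U L hU).alive r).card ≤ U r := by
  have h := Finset.card_le_card_of_injOn (s := (cyclicGrouping n nS U L hU).alive r)
    (t := Finset.range (U r)) (fun i => i.1) (fun i hi => by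
      simpa [cyclicGrouping] using hi) (fun a _ b _ hab => Fin.ext hab)
  simpa using h

theorem le_card_lab0_cyclicGrouping (x : Option (Fin (n 0)) × Bool) :
    nS 0 / (2 * (n 0 + 1)) ≤
      (Finset.univ.filter fun a => (cyclicGrouping n nS U L hU).lab0 a = x).card := by
  have h := le_card_filter_mod (N := nS 0) (U := nS 0)
    (M := Fintype.card (Option (Fin (n 0)) × Bool)) Fintype.card_pos le_rfl
    (Fintype.equivFin (Option (Fin (n 0)) × Bool)).symm x
  have h1 : (Finset.univ.filter fun i : Fin (nS 0) => i.1 < nS 0) = Finset.univ := by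
    ext i; simp
  rw [h1] at h
  refine le_trans (le_of_eq ?_) h
  congr 1
  simp [mul_comm]

theorem le_card_lab_cyclicGrouping {r : ℕ} (hr : U r ≤ nS r) (o : Option (Fin (n r))) :
    U r / (n r + 1) ≤ (((cyclicGrouping n nS U L hU).alive r).filter
      fun j => (cyclicGrouping n nS U L hU).lab r j = o).card :=
  le_card_filter_mod (Nat.succ_pos _) hr finSuccEquivLast o

theorem castLE_mem_alive_cyclicGrouping (hout : n L ≤ nS L) (hUL : U L = n L) (i : Fin (n L)) :
    Fin.castLE hout i ∈ (cyclicGrouping n nS U L hU).alive L := by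
  simp [cyclicGrouping, hUL]

/-- `finSuccEquivLast` puts the constant label last, so the first `n L` neurons carry the labels of
the output components in order. -/
theorem lab_castLE_cyclicGrouping (hout : n L ≤ nS L) (i : Fin (n L)) :
    (cyclicGrouping n nS U L hU).lab L (Fin.castLE hout i) = some i := by
  have : (⟨i.1 % (n L + 1), Nat.mod_lt _ (Nat.succ_pos _)⟩ : Fin (n L + 1)) = Fin.castSucc i :=
    Fin.ext (Nat.mod_eq_of_lt (by omega))
  change finSuccEquivLast (⟨i.1 % (n L + 1), Nat.mod_lt _ (Nat.succ_pos _)⟩ : Fin (n L + 1)) = _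
  rw [this, finSuccEquivLast_castSucc]

end Cyclic

end GoodProbability

/-! ### Tolerances and accumulated error -/

section Tolerances

open Set

variable {n : ℕ → ℕ} {L : ℕ} {θ : Param n L → ℝ} {D : Set (Fin (n 0) → ℝ)} {ε : ℝ}

theorem continuous_neurons {w : ℕ → ℕ} {k : ℕ} (θ : Param w k → ℝ) :
    ∀ l, Continuous fun x => neurons θ x l
  | 0 => continuous_id
  | l + 1 => by
      simp only [neurons]
      split_ifs with h
      · have := continuous_neurons θ l
        unfold affine
        fun_prop
      · exact continuous_const

theorem sum_abs_neurons_le_actBound (hD : IsCompact D) {x : Fin (n 0) → ℝ} (hx : x ∈ D) (l : ℕ) :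
    ∑ i, |neurons θ x l i| ≤ actBound θ D l := by
  have hcont : Continuous fun x => ∑ i, |neurons θ x l i| := by
    have := continuous_neurons θ l
    fun_prop
  exact le_csSup (hD.image hcont).bddAbove (mem_image_of_mem _ hx)

theorem actBound_nonneg (l : ℕ) : 0 ≤ actBound θ D l := by
  refine Real.sSup_nonneg ?_
  rintro _ ⟨x, -, rfl⟩
  positivity

theorem actBound_succ_le (hθ : ∀ e, |θ e| ≤ 1) (hD : IsCompact D) (l : ℕ) :
    actBound θ D (l + 1) ≤ n (l + 1) * (1 + actBound θ D l) := by
  have hB := actBound_nonneg (θ := θ) (D := D) l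
  refine Real.sSup_le ?_ (by positivity)
  rintro _ ⟨x, hx, rfl⟩
  have h : ∀ i, |neurons θ x (l + 1) i| ≤ 1 + actBound θ D l := by
    intro i
    by_cases hl : l < L
    · rw [neurons_succ θ x hl, affine_eq_sum_withOne]
      have h1 : |∑ o, θ ⟨⟨l, hl⟩, i, o⟩ * withOne (neurons θ x l) o| ≤
          1 + ∑ j, |neurons θ x l j| := by
        rw [← sum_abs_withOne]
        refine (Finset.abs_sum_le_sum_abs _ _).trans (Finset.sum_le_sum fun o _ => ?_)
        rw [abs_mul]
        exact mul_le_of_le_one_left (abs_nonneg _) (hθ _)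
      have h2 := abs_relu_sub_le (∑ o, θ ⟨⟨l, hl⟩, i, o⟩ * withOne (neurons θ x l) o) 0
      rw [max_self, sub_zero, sub_zero] at h2
      linarith [sum_abs_neurons_le_actBound (θ := θ) hD hx l]
    · rw [neurons, dif_neg hl]
      simpa using by linarith
  calc ∑ i, |neurons θ x (l + 1) i| ≤ ∑ _i : Fin (n (l + 1)), (1 + actBound θ D l) :=
        Finset.sum_le_sum fun i _ => h i
    _ = _ := by rw [Finset.sum_const, Finset.card_univ, Fintype.card_fin, nsmul_eq_mul]

/-- The product of norm bounds in the tolerance of layer `l`. -/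
theorem one_le_prod_weightNorm (hε : 0 ≤ ε) (l : ℕ) :
    1 ≤ ∏ k ∈ Finset.Ico l (L - 1), (max 1 (weightNorm θ k) + ε / L) := by
  refine Finset.one_le_prod fun k _ => ?_
  have : 0 ≤ ε / L := by positivity
  linarith [le_max_left 1 (weightNorm θ k)]

theorem tol_pos (hε : 0 < ε) (hL : 1 ≤ L) (hn : 1 ≤ n L) (l : ℕ) : 0 < tol θ D ε l := by
  have h1 := actBound_nonneg (θ := θ) (D := D) (l - 1)
  have h2 := one_le_prod_weightNorm (θ := θ) hε.le l
  have hL' : (0 : ℝ) < L := by exact_mod_cast hL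
  have hn' : (0 : ℝ) < n L := by exact_mod_cast hn
  unfold tol
  have : 0 < ∏ k ∈ Finset.Ico l (L - 1), (max 1 (weightNorm θ k) + ε / L) := by linarith
  positivity

/-- A weight error below the tolerance contributes at most `ε / L` to the output. The factors `n L`
and the product of norms are at least `1` and may be discarded: the amplification by later layers is
controlled through source widths instead. -/
theorem tol_mul_le (hε : 0 < ε) (hL : 1 ≤ L) (hn : 1 ≤ n L) (l : ℕ) :
    tol θ D ε (l + 1) * (1 + actBound θ D l) * (1 + ε / L) ≤ ε / L := by
  have h1 := actBound_nonneg (θ := θ) (D := D) l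
  have h2 := one_le_prod_weightNorm (θ := θ) hε.le (l + 1)
  have hL' : (0 : ℝ) < L := by exact_mod_cast hL
  have hn' : (1 : ℝ) ≤ n L := by exact_mod_cast hn
  unfold tol
  rw [Nat.add_sub_cancel]
  set P := ∏ k ∈ Finset.Ico (l + 1) (L - 1), (max 1 (weightNorm θ k) + ε / L)
  have hP : 0 < P := by linarith
  have heq : ε / (n L * L) * ((1 + actBound θ D l) * (1 + ε / L) * P)⁻¹ * (1 + actBound θ D l) *
      (1 + ε / L) = ε / L / (n L * P) := by
    have h3 : (1 + actBound θ D l) ≠ 0 := by positivity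
    have h4 : (1 + ε / L) ≠ 0 := by positivity
    field_simp
  rw [heq]
  refine div_le_self (by positivity) ?_
  nlinarith

/-- With `x = ε / L ≤ 1` the tolerance is at most `x / (1 + x) ≤ 1 / 2`. This bounds the logarithm
in `rho` away from `0`. -/
theorem tol_le_half (hε : 0 < ε) (hε1 : ε < 1) (hL : 1 ≤ L) (hn : 1 ≤ n L) {l : ℕ} (hl : 1 ≤ l) :
    tol θ D ε l ≤ 1 / 2 := by
  obtain ⟨l, rfl⟩ : ∃ k, l = k + 1 := ⟨l - 1, by omega⟩
  have h1 := actBound_nonneg (θ := θ) (D := D) l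
  have h2 := tol_mul_le (θ := θ) (D := D) hε hL hn l
  have h3 := tol_pos (θ := θ) (D := D) hε hL hn (l + 1)
  have hL' : (1 : ℝ) ≤ L := by exact_mod_cast hL
  have hεL : ε / L ≤ 1 := (div_le_one (by linarith)).2 (by linarith)
  have hεL0 : 0 < ε / L := by positivity
  have h4 : tol θ D ε (l + 1) * (1 + ε / L) ≤ ε / L := by
    refine le_trans ?_ h2
    have : tol θ D ε (l + 1) ≤ tol θ D ε (l + 1) * (1 + actBound θ D l) := by nlinarith
    nlinarith
  nlinarith

/-- Compensates an index shift: the width of layer `l` is tied to the tolerance of index `l`, but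
its neurons feed the weights with index `l + 1`. The tolerances compare because `1 + B_l ≤ (n l + 1)
* (1 + B_{l-1})`, while the product only loses factors that are at least `1`. -/
theorem tol_succ_ge (hε : 0 < ε) (hL : 1 ≤ L) (hn : 1 ≤ n L) (hθ : ∀ e, |θ e| ≤ 1)
    (hD : IsCompact D) {l : ℕ} (hl : 1 ≤ l) :
    tol θ D ε l ≤ (n l + 1) * tol θ D ε (l + 1) := by
  obtain ⟨l, rfl⟩ : ∃ k, l = k + 1 := ⟨l - 1, by omega⟩
  have h1 := actBound_nonneg (θ := θ) (D := D) l
  have h1' := actBound_nonneg (θ := θ) (D := D) (l + 1)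
  have h2 := one_le_prod_weightNorm (θ := θ) hε.le (l + 1)
  have h2' := one_le_prod_weightNorm (θ := θ) hε.le (l + 1 + 1)
  have h3 := actBound_succ_le hθ hD l
  have hL' : (0 : ℝ) < L := by exact_mod_cast hL
  have hn' : (0 : ℝ) < n L := by exact_mod_cast hn
  unfold tol
  rw [Nat.add_sub_cancel, Nat.add_sub_cancel]
  have hP : ∏ k ∈ Finset.Ico (l + 1 + 1) (L - 1), (max 1 (weightNorm θ k) + ε / L) ≤
      ∏ k ∈ Finset.Ico (l + 1) (L - 1), (max 1 (weightNorm θ k) + ε / L) := by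
    by_cases h : l + 1 < L - 1
    · rw [Finset.prod_eq_prod_Ico_succ_bot h]
      refine le_mul_of_one_le_left (by linarith) ?_
      have : 0 ≤ ε / L := by positivity
      linarith [le_max_left 1 (weightNorm θ (l + 1))]
    · rw [Finset.Ico_eq_empty h, Finset.Ico_eq_empty (by omega)]
  set P := ∏ k ∈ Finset.Ico (l + 1) (L - 1), (max 1 (weightNorm θ k) + ε / L)
  set P' := ∏ k ∈ Finset.Ico (l + 1 + 1) (L - 1), (max 1 (weightNorm θ k) + ε / L)
  set b := actBound θ D l
  set b' := actBound θ D (l + 1)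
  have hP0 : 0 < P := by linarith
  have hP0' : 0 < P' := by linarith
  have hR : 0 < 1 + ε / L := by positivity
  have h5 : (1 + b') * (1 + ε / L) * P' ≤ ((n (l + 1) + 1) * ((1 + b) * (1 + ε / L) * P)) := by
    have : 1 + b' ≤ (n (l + 1) + 1) * (1 + b) := by linarith
    calc (1 + b') * (1 + ε / L) * P' ≤ ((n (l + 1) + 1) * (1 + b)) * (1 + ε / L) * P := by gcongr
      _ = _ := by ring
  have h6 : ((1 + b) * (1 + ε / L) * P)⁻¹ ≤
      (n (l + 1) + 1) * ((1 + b') * (1 + ε / L) * P')⁻¹ := by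
    rw [← div_eq_mul_inv, le_div_iff₀ (by positivity), inv_mul_le_iff₀ (by positivity)]
    linarith
  calc ε / (n L * L) * ((1 + b) * (1 + ε / L) * P)⁻¹
      ≤ ε / (n L * L) * ((n (l + 1) + 1) * ((1 + b') * (1 + ε / L) * P')⁻¹) := by gcongr
    _ = _ := by ring

/-- The error after `l` layers, for groups with `U l` used neurons and accuracies `exp (-t l)`. -/
noncomputable def errBound (U : ℕ → ℕ) (B t : ℕ → ℝ) : ℕ → ℝ
  | 0 => 0
  | l + 1 => Real.exp (-t l) * (1 + B l) + U l * errBound U B t l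

theorem errBound_nonneg {U : ℕ → ℕ} {B t : ℕ → ℝ} (hB : ∀ l, 0 ≤ B l) :
    ∀ l, 0 ≤ errBound U B t l
  | 0 => le_rfl
  | l + 1 => by
      have := errBound_nonneg (U := U) (t := t) hB l
      have := hB l
      unfold errBound
      positivity

/-- Unrolling the recursion, the weight error made at step `r` is amplified by the product of the
later `U k`; each of the `L` contributions stays below `ε / L`. -/
theorem errBound_lt {U : ℕ → ℕ} {B t : ℕ → ℝ} {L : ℕ} (hL : 1 ≤ L) {ε : ℝ}
    (h : ∀ r < L, Real.exp (-t r) * (∏ k ∈ Finset.Ico (r + 1) L, (U k : ℝ)) * (1 + B r) < ε / L) :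
    errBound U B t L < ε := by
  have h1 : ∀ l ≤ L, errBound U B t l * ∏ k ∈ Finset.Ico l L, (U k : ℝ) =
      ∑ r ∈ Finset.range l,
        Real.exp (-t r) * (∏ k ∈ Finset.Ico (r + 1) L, (U k : ℝ)) * (1 + B r) := by
    intro l
    induction l with
    | zero => intro _; simp [errBound]
    | succ l ih =>
      intro hl
      rw [Finset.sum_range_succ, ← ih (by omega), errBound,
        Finset.prod_eq_prod_Ico_succ_bot (show l < L by omega)]
      ring
  have h2 := h1 L le_rfl
  rw [Finset.Ico_self, Finset.prod_empty, mul_one] at h2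
  rw [h2]
  calc _ < ∑ _r ∈ Finset.range L, ε / L :=
        Finset.sum_lt_sum_of_nonempty (Finset.nonempty_range_iff.2 (by omega))
          fun r hr => h r (Finset.mem_range.1 hr)
    _ = ε := by
        have hL' : (0 : ℝ) < L := by exact_mod_cast hL
        rw [Finset.sum_const, Finset.card_range, nsmul_eq_mul]
        field_simp

end Tolerances

/-! ### Reduction to inequalities between rates -/

section Reduction

open MeasureTheory ProbabilityTheory Set

/-- The sizes of the groups in the layers of the source network. -/
def groupSize (n nS U : ℕ → ℕ) : ℕ → ℕ
  | 0 => nS 0 / (2 * (n 0 + 1))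
  | r + 1 => U (r + 1) / (n (r + 1) + 1)

/-- The existence of a mask follows from a finite list of inequalities for the rates of the subset
sums. -/
theorem sourceLaw_exists_mask_ge {n nS U : ℕ → ℕ} {L : ℕ} (hL : 1 ≤ L) {ε δ : ℝ} (hε : 0 < ε)
    (hδ : 0 ≤ δ) {p q : ℕ → ℝ} (hp : ∀ l, 2 ≤ l → l ≤ L → p l ∈ Ioo (0 : ℝ) 1)
    (hq : ∀ l, 2 ≤ l → l ≤ L → q l ∈ Ioo (0 : ℝ) 1) (hn : 1 ≤ n L)
    {θT : Param n L → ℝ} (hθT : ∀ e, |θT e| ≤ 1) {D : Set (Fin (n 0) → ℝ)} (hD : IsCompact D)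
    (hout : n L ≤ nS L) (hU : ∀ r, 2 ≤ r → r < L → U r = nS r) (hUL : U L = n L)
    (hU1 : U 1 ≤ nS 1)
    (h0 : (U 1 : ℝ) * (2 * ((n 0 : ℝ) + 1)) *
      (10 * Real.exp (-rate p q (groupSize n nS U) 0)) ≤ δ / L)
    (h1 : ∀ r, r + 2 ≤ L → (U (r + 2) : ℝ) * ((n (r + 1) : ℝ) + 1) *
      (10 * Real.exp (-rate p q (groupSize n nS U) (r + 1))) ≤ δ / L)
    (hE : ∀ r < L, Real.exp (-rate p q (groupSize n nS U) r) *
      (∏ k ∈ Finset.Ico (r + 1) L, (U k : ℝ)) < tol θT D ε (r + 1)) :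
    ENNReal.ofReal (1 - δ) ≤ sourceLaw (srcWidth (n 0) nS) (L + 1) p q
      {ω | ∃ m : Param (srcWidth (n 0) nS) (L + 1) → Bool, Respects ω m ∧
        ∀ (i : Fin (n L)), ∀ x ∈ D,
          |netFun θT x i - netFun (masked ω m) x (Fin.castLE hout i)| < ε} := by
  have hprob : ∀ e : Param (srcWidth (n 0) nS) (L + 1),
      IsProbabilityMeasure (paramLaw (layerRatio p e.1) (layerRatio q e.1)) :=
    fun e => isProbabilityMeasure_layerLaw hp hq e.1
  have hprob' : IsProbabilityMeasure (sourceLaw (srcWidth (n 0) nS) (L + 1) p q) := by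
    unfold sourceLaw
    infer_instance
  set s := groupSize n nS U with hs
  set g := cyclicGrouping n nS U L hU with hg
  have hL1 : 1 < L + 1 := Nat.lt_succ_of_le hL
  have hcard : ∀ r, (g.alive r).card ≤ U r := card_alive_cyclicGrouping_le
  have hbad := sourceLaw_not_good_le g hL1 hp hq s le_card_lab0_cyclicGrouping
    (fun r hr o => le_card_lab_cyclicGrouping (by
      rcases Nat.eq_zero_or_pos r with h | h
      · subst h; exact hU1
      · rw [hU (r + 1) (by omega) (by omega)]) o) hδ
    (le_trans (by gcongr; exact hcard 1) h0)
    (fun r hr => le_trans (by gcongr; exact hcard _) (h1 r (by omega)))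
  set η : ℕ → ℝ := fun l => Real.exp (-rate p q s (l - 1)) with hη
  set e := errBound U (actBound θT D) (rate p q s) with he
  have hBnn : ∀ l, 0 ≤ actBound θT D l := actBound_nonneg
  have heL : e L < ε := by
    refine errBound_lt hL fun r hr => ?_
    have h2 := tol_mul_le (θ := θT) (D := D) hε hL hn r
    have hL' : (0 : ℝ) < L := by exact_mod_cast hL
    have h3 : 0 < ε / L := by positivity
    have h4 : tol θT D ε (r + 1) * (1 + actBound θT D r) ≤ ε / L := by
      refine le_trans ?_ h2
      have := tol_pos (θ := θT) (D := D) hε hL hn (r + 1)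
      exact le_mul_of_one_le_right (mul_nonneg this.le (by linarith [hBnn r])) (by linarith)
    refine lt_of_lt_of_le ?_ h4
    exact mul_lt_mul_of_pos_right (hE r hr) (by linarith [hBnn r])
  have hsub : {ω | Good g hL1 η ω} ⊆
      {ω | ∃ m : Param (srcWidth (n 0) nS) (L + 1) → Bool, Respects ω m ∧
        ∀ (i : Fin (n L)), ∀ x ∈ D,
          |netFun θT x i - netFun (masked ω m) x (Fin.castLE hout i)| < ε} := by
    intro ω hω
    have hω' : Good g hL1 η ω := hω
    obtain ⟨m, hm, h⟩ := hω'.exists_approx hθT hout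
      (castLE_mem_alive_cyclicGrouping hout hUL) (lab_castLE_cyclicGrouping hout) D e
      (fun x hx => by
        have h2 := sum_abs_neurons_le_actBound (θ := θT) hD hx 0
        have h3 : e 1 = Real.exp (-rate p q s 0) * (1 + actBound θT D 0) := by
          simp [he, errBound]
        rw [h3]
        change Real.exp (-rate p q s 0) * (1 + ∑ i, |x i|) ≤ _
        gcongr
        exact h2)
      (fun x hx r hr => by
        have h2 := sum_abs_neurons_le_actBound (θ := θT) hD hx (r + 1)
        have h3 := errBound_nonneg (U := U) (t := rate p q s) hBnn (r + 1)
        have h4 : e (r + 2) = Real.exp (-rate p q s (r + 1)) * (1 + actBound θT D (r + 1)) +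
          U (r + 1) * e (r + 1) := rfl
        rw [h4]
        change Real.exp (-rate p q s (r + 1)) * _ + _ ≤ _
        gcongr
        exact hcard _)
    exact ⟨m, hm, fun i x hx => (h i x hx).trans_lt heL⟩
  -- Subadditivity suffices here, so measurability of the good event is not needed.
  have htotal : (1 : ℝ≥0∞) ≤ sourceLaw (srcWidth (n 0) nS) (L + 1) p q {ω | Good g hL1 η ω} +
      ENNReal.ofReal δ := by
    calc (1 : ℝ≥0∞) = sourceLaw (srcWidth (n 0) nS) (L + 1) p q univ := measure_univ.symm
      _ ≤ sourceLaw (srcWidth (n 0) nS) (L + 1) p q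
          ({ω | Good g hL1 η ω} ∪ {ω | ¬ Good g hL1 η ω}) :=
          measure_mono fun ω _ => em _
      _ ≤ _ := (measure_union_le _ _).trans (add_le_add le_rfl hbad)
  calc ENNReal.ofReal (1 - δ) = 1 - ENNReal.ofReal δ := by
        rw [ENNReal.ofReal_sub _ hδ, ENNReal.ofReal_one]
    _ ≤ sourceLaw (srcWidth (n 0) nS) (L + 1) p q {ω | Good g hL1 η ω} :=
        tsub_le_iff_right.2 htotal
    _ ≤ _ := measure_mono hsub

end Reduction

/-! ### Required accuracies and lower bounds for the rates -/

section Numerics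

open Set

theorem half_le_natDiv {x : ℝ} {a b : ℕ} (hx : 1 ≤ x) (hb : 0 < b) (h : x * b ≤ a) :
    x / 2 ≤ ((a / b : ℕ) : ℝ) := by
  have h1 : (a : ℝ) < b * ((a / b : ℕ) + 1) := by exact_mod_cast Nat.lt_mul_div_succ a hb
  have hb' : (0 : ℝ) < b := by exact_mod_cast hb
  have h2 : x < ((a / b : ℕ) : ℝ) + 1 := by
    by_contra! hcon
    nlinarith
  have h3 : (1 : ℝ) ≤ ((a / b : ℕ) : ℝ) := by
    have : (0 : ℝ) < ((a / b : ℕ) : ℝ) := by linarith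
    exact_mod_cast this
  linarith

/-- The factor `16 = 2 * 8`: rounding the group size down loses at most a factor `2`, and `8` is the
exponent reserved for all polynomial losses. -/
theorem le_rate_of_le {f Λ : ℝ} {a b : ℕ} (hf : 0 < f) (hf1 : f ≤ 1) (hΛ : 1 ≤ Λ) (hb : 0 < b)
    (h : 16 * 2304 / f ^ 2 * Λ * b ≤ a) : 8 * Λ ≤ f ^ 2 * ((a / b : ℕ) : ℝ) / 2304 := by
  have hf2 : f ^ 2 ≤ 1 := pow_le_one₀ hf.le hf1
  have hx : 1 ≤ 16 * 2304 / f ^ 2 * Λ := by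
    have : 1 ≤ 16 * 2304 / f ^ 2 := by rw [le_div_iff₀ (by positivity)]; linarith
    nlinarith
  have h1 := half_le_natDiv hx hb h
  rw [le_div_iff₀ (by norm_num)]
  calc 8 * Λ * 2304 = f ^ 2 * (16 * 2304 / f ^ 2 * Λ / 2) := by field_simp; ring
    _ ≤ _ := by gcongr

/-- The logarithm of the accuracy that the groups in a layer have to provide: `μ` is the tolerance
of the layer, and `j` the first of the later frozen layers. -/
noncomputable def logPrec (nS : ℕ → ℕ) (L : ℕ) (C' μ : ℝ) (j : ℕ) : ℝ :=
  Real.log (C' / μ) + ∑ k ∈ Finset.Ico j L, Real.log (nS k)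

theorem one_le_logPrec {nS : ℕ → ℕ} {L : ℕ} {C' μ : ℝ} (hC : 3 ≤ C') (hμ : 0 < μ) (hμ1 : μ ≤ 1)
    (j : ℕ) : 1 ≤ logPrec nS L C' μ j := by
  have h1 : 1 ≤ Real.log (C' / μ) := by
    rw [Real.le_log_iff_exp_le (by positivity), le_div_iff₀ hμ]
    have := Real.exp_one_lt_d9
    nlinarith [Real.exp_pos 1]
  have h2 : 0 ≤ ∑ k ∈ Finset.Ico j L, Real.log (nS k) :=
    Finset.sum_nonneg fun k _ => Real.log_natCast_nonneg _
  unfold logPrec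
  linarith

/-- The logarithms of the widths are included in the exponent precisely to cancel the amplification
by the later frozen layers. -/
theorem exp_neg_logPrec {nS : ℕ → ℕ} {L : ℕ} {C' μ : ℝ} (hC : 0 < C') (hμ : 0 < μ) {j : ℕ}
    (hnS : ∀ k ∈ Finset.Ico j L, 1 ≤ nS k) :
    Real.exp (-logPrec nS L C' μ j) * (∏ k ∈ Finset.Ico j L, (nS k : ℝ)) = μ / C' := by
  have h1 : ∏ k ∈ Finset.Ico j L, (nS k : ℝ) =
      Real.exp (∑ k ∈ Finset.Ico j L, Real.log (nS k)) := by
    rw [Real.exp_sum]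
    refine Finset.prod_congr rfl fun k hk => ?_
    rw [Real.exp_log]
    exact_mod_cast hnS k hk
  rw [h1, ← Real.exp_add, logPrec, neg_add, add_assoc, neg_add_cancel, add_zero, ← Real.log_inv,
    Real.exp_log (by positivity), inv_div]

/-- Since `1 ≤ j`, the precision is a sum of at most `L` logarithms, each controlled by one width
hypothesis. This is the origin of the factor `L` in the width constants. -/
theorem mul_logPrec_le {nS : ℕ → ℕ} {L : ℕ} {C' μ c X : ℝ} {j : ℕ} (hj : 1 ≤ j) (hL : 1 ≤ L)
    (hX : 0 ≤ X) (h1 : c * Real.log (C' / μ) ≤ X)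
    (h2 : ∀ k, j ≤ k → k < L → c * Real.log (nS k) ≤ X) : c * logPrec nS L C' μ j ≤ L * X := by
  rw [logPrec, mul_add, Finset.mul_sum]
  have h3 : ∑ k ∈ Finset.Ico j L, c * Real.log (nS k) ≤ (L - j : ℕ) * X := by
    rw [← Nat.card_Ico, ← nsmul_eq_mul]
    exact Finset.sum_le_card_nsmul _ _ _ fun k hk =>
      h2 k (Finset.mem_Ico.1 hk).1 (Finset.mem_Ico.1 hk).2
  have h4 : ((L - j : ℕ) : ℝ) + 1 ≤ L := by
    have : L - j + 1 ≤ L := by omega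
    exact_mod_cast this
  nlinarith

variable {n : ℕ → ℕ} {L : ℕ} {p q : ℕ → ℝ}

theorem freeRatio_le {l : ℕ} (h2 : 2 ≤ l) (hl : l ≤ L) :
    freeRatio L p q ≤ (1 - p l) * (1 - q l) :=
  Finset.fold_min_le _ |>.2 (Or.inr ⟨l, Finset.mem_Icc.2 ⟨h2, hl⟩, le_rfl⟩)

theorem freeRatio_le_one : freeRatio L p q ≤ 1 :=
  Finset.fold_min_le _ |>.2 (Or.inl le_rfl)

theorem freeRatio_pos (hp : ∀ l, 2 ≤ l → l ≤ L → p l ∈ Ioo (0 : ℝ) 1)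
    (hq : ∀ l, 2 ≤ l → l ≤ L → q l ∈ Ioo (0 : ℝ) 1) : 0 < freeRatio L p q := by
  refine Finset.lt_fold_min _ |>.2 ⟨one_pos, fun l hl => ?_⟩
  have h1 := hp l (Finset.mem_Icc.1 hl).1 (Finset.mem_Icc.1 hl).2
  have h2 := hq l (Finset.mem_Icc.1 hl).1 (Finset.mem_Icc.1 hl).2
  exact mul_pos (by linarith [h1.2]) (by linarith [h2.2])

theorem mul_le_card_param {r : ℕ} (hr : r < L) :
    n (r + 1) * (n r + 1) ≤ Fintype.card (Param n L) := by
  have h : Fintype.card (Param n L) = ∑ l : Fin L, n (l + 1) * (n l + 1) := by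
    simp [Param]
  rw [h]
  exact Finset.single_le_sum (f := fun l : Fin L => n (l + 1) * (n l + 1))
    (fun _ _ => Nat.zero_le _) (Finset.mem_univ (⟨r, hr⟩ : Fin L))

theorem succ_le_card_param (hn : ∀ l, l ≤ L → 1 ≤ n l) {r : ℕ} (hr : r < L) :
    n r + 1 ≤ Fintype.card (Param n L) :=
  (Nat.le_mul_of_pos_left _ (hn (r + 1) hr)).trans (mul_le_card_param hr)

/-- The base `N / κ` and the exponent `1 + γ` are at least `1`, and the logarithm is at least `log 2
> 1 / 2`. Hence `δ / ρ` absorbs both the number of parameters and `1 / κ`, which allows `C'` to be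
independent of `p` and `q`. -/
theorem le_rho {θ : Param n L → ℝ} {D : Set (Fin (n 0) → ℝ)} {γ ε δ : ℝ} (hγ : 0 ≤ γ)
    (hε : 0 < ε) (hε1 : ε < 1) (hδ : 0 < δ) (hL : 1 ≤ L) (hn : ∀ l, l ≤ L → 1 ≤ n l)
    (hp : ∀ l, 2 ≤ l → l ≤ L → p l ∈ Ioo (0 : ℝ) 1)
    (hq : ∀ l, 2 ≤ l → l ≤ L → q l ∈ Ioo (0 : ℝ) 1) :
    Fintype.card (Param n L) / freeRatio L p q / 2 ≤ rho θ D p q γ ε δ := by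
  have hκ := freeRatio_pos hp hq
  have hκ1 := freeRatio_le_one (L := L) (p := p) (q := q)
  have hN : (1 : ℝ) ≤ Fintype.card (Param n L) := by
    have := succ_le_card_param hn (r := 0) (by omega)
    exact_mod_cast le_trans (Nat.le_add_left 1 (n 0)) this
  have h1 : 1 ≤ (Fintype.card (Param n L) : ℝ) / freeRatio L p q := by
    rw [le_div_iff₀ hκ]; linarith
  have h2 : (Fintype.card (Param n L) : ℝ) / freeRatio L p q ≤
      ((Fintype.card (Param n L) : ℝ) / freeRatio L p q) ^ (1 + γ) := by
    conv_lhs => rw [← Real.rpow_one ((Fintype.card (Param n L) : ℝ) / freeRatio L p q)]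
    exact Real.rpow_le_rpow_of_exponent_le h1 (by linarith)
  set m := (Finset.Icc 1 L).fold min δ (tol θ D ε) with hm
  have hm0 : 0 < m := Finset.lt_fold_min _ |>.2 ⟨hδ, fun l _ => tol_pos hε hL (hn L le_rfl) l⟩
  have hm2 : m ≤ 1 / 2 := Finset.fold_min_le _ |>.2 (Or.inr
    ⟨1, Finset.mem_Icc.2 ⟨le_rfl, hL⟩, tol_le_half hε hε1 hL (hn L le_rfl) le_rfl⟩)
  have h3 : 1 / 2 ≤ Real.log (1 / m) := by
    have h4 : Real.log 2 ≤ Real.log (1 / m) := by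
      refine Real.log_le_log (by norm_num) ?_
      rw [le_div_iff₀ hm0]; linarith
    linarith [Real.log_two_gt_d9]
  unfold rho
  rw [← hm, div_eq_mul_one_div _ (2 : ℝ)]
  exact mul_le_mul h2 h3 (by norm_num) (by linarith)

end Numerics

/-! ### From the width hypotheses to the required rates -/

section Widths

open Set

/-- Provides the number of copies per group in the thinned layer `1`: large enough for the accuracy,
yet only of order `Λ / a`. The gap `Λ / a ≥ 1` leaves room for rounding. -/
theorem exists_nat_mul_between {a Λ : ℝ} (ha : 0 < a) (ha1 : a ≤ 1) (hΛ : 1 ≤ Λ) :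
    ∃ m : ℕ, 8 * Λ ≤ a * m ∧ m ≤ 9 * Λ / a := by
  refine ⟨⌈8 * Λ / a⌉₊, ?_, ?_⟩
  · rw [mul_comm a, ← div_le_iff₀ ha]
    exact Nat.le_ceil _
  · have h := (Nat.ceil_lt_add_one (a := 8 * Λ / a) (by positivity)).le
    have h1 : 8 * Λ / a + 1 ≤ 9 * Λ / a := by
      rw [div_add_one ha.ne', div_le_div_iff_of_pos_right ha]
      linarith
    exact h.trans h1

theorem one_le_of_mul_log_le {c C' μ : ℝ} {n s : ℕ} (hc : 0 < c) (hC' : 3 ≤ C') (hμ : 0 < μ)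
    (hμ1 : μ ≤ 1) (hn : 1 ≤ n) (h : c * Real.log (C' / μ) * n ≤ s) : 1 ≤ s := by
  have h1 : 0 < Real.log (C' / μ) := Real.log_pos (by rw [lt_div_iff₀ hμ]; linarith)
  have hn' : (0 : ℝ) < n := by exact_mod_cast hn
  have h2 : (0 : ℝ) < s := lt_of_lt_of_le (by positivity) h
  exact_mod_cast h2

section Accuracy

variable {y P C' μ N δ L : ℝ}

/-- One factor `y` already suffices: it cancels `P` and leaves `μ / C'`, where `μ` absorbs `N`. -/
theorem mul_exp_le_of_card_le {X : ℝ} (hy : 0 < y) (hP : 1 ≤ P) (hyP : y * P = μ / C')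
    (hμ1 : μ ≤ 1) (hL : 1 ≤ L) (hC' : 20 * L ≤ C') (hδ : 0 < δ) (hN : N * μ ≤ 2 * δ)
    (hX : 0 ≤ X) (hXN : X ≤ N * P) : X * (10 * y ^ 8) ≤ δ / L := by
  have hC0 : 0 < C' := by linarith
  have hy1 : y ≤ 1 := by
    calc y ≤ y * P := le_mul_of_one_le_right hy.le hP
      _ = μ / C' := hyP
      _ ≤ 1 := by rw [div_le_one hC0]; linarith
  have hy8 : y ^ 8 ≤ y := pow_le_of_le_one hy.le hy1 (by norm_num)
  calc X * (10 * y ^ 8) ≤ N * P * (10 * y) := by gcongr; exact hX.trans hXN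
    _ = 10 * N * (y * P) := by ring
    _ = 10 * (N * μ) / C' := by rw [hyP]; ring
    _ ≤ 10 * (2 * δ) / C' := by gcongr
    _ ≤ δ / L := by
      rw [div_le_div_iff₀ hC0 (by linarith)]
      nlinarith

/-- Two factors `y` produce `μ ^ 2`. One `μ` is bounded by the tolerance `T ≤ N * T'` of the
preceding index, and the other absorbs the resulting `N`. -/
theorem exp_mul_prod_lt_of_tol {T T' : ℝ} (hy : 0 < y) (hP : 1 ≤ P) (hyP : y * P = μ / C')
    (hμ : 0 < μ) (hμ1 : μ ≤ 1) (hC' : 3 ≤ C') (hδ1 : δ < 1) (hN : N * μ ≤ 2 * δ)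
    (hT' : 0 < T') (hμT : μ ≤ T) (hTT : T ≤ N * T') : y ^ 8 * P < T' := by
  have hC0 : 0 < C' := by linarith
  have hy1 : y ≤ 1 := by
    calc y ≤ y * P := le_mul_of_one_le_right hy.le hP
      _ = μ / C' := hyP
      _ ≤ 1 := by rw [div_le_one hC0]; linarith
  have hy8 : y ^ 8 ≤ y ^ 2 := pow_le_pow_of_le_one hy.le hy1 (by norm_num)
  have h1 : μ ^ 2 ≤ 2 * T' := by
    calc μ ^ 2 = μ * μ := sq μ
      _ ≤ N * T' * μ := by gcongr; linarith
      _ = N * μ * T' := by ring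
      _ ≤ 2 * T' := by gcongr; linarith
  calc y ^ 8 * P ≤ y ^ 2 * (P * P) := by gcongr; exact le_mul_of_one_le_right (by linarith) hP
    _ = (y * P) ^ 2 := by ring
    _ = μ ^ 2 / C' ^ 2 := by rw [hyP, div_pow]
    _ ≤ 2 * T' / C' ^ 2 := by gcongr
    _ < T' := by
      have : 2 < C' ^ 2 := by nlinarith
      rw [div_lt_iff₀ (by positivity)]
      nlinarith

/-- The first layers: `u` bounds the number of neurons in use in layer `1`. -/
theorem first_layer_bounds {Λ κ u n₀ n₁ m : ℝ} (hΛ0 : 0 ≤ Λ) (hyΛ : y = Real.exp (-Λ)) (hP : 1 ≤ P)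
    (hyP : y * P = μ / C') (hμ : 0 < μ) (hμ1 : μ ≤ 1) (hL : 1 ≤ L) (hC' : 10 ^ 8 * L ≤ C')
    (hκ : 0 < κ) (hδ1 : δ ≤ 1) (hNκ : N / κ * μ ≤ 2 * δ) (hκ1 : κ ≤ 1) (hN : 1 ≤ N)
    (hm0 : 0 ≤ m) (hm : m ≤ 9 * Λ / ((κ / 2) ^ 2 / 2304)) (hu : u = (n₁ + 1) * m)
    (hn₀ : 0 ≤ n₀) (hn₁ : 0 ≤ n₁) (hn₀N : n₀ + 1 ≤ N) (hn₁N : n₁ + 1 ≤ N) :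
    u * (2 * (n₀ + 1)) * (10 * y ^ 8) ≤ δ / L ∧ y ^ 8 * (u * P) < μ := by
  have hC0 : 0 < C' := by linarith
  have hy : 0 < y := hyΛ ▸ Real.exp_pos _
  have hyμ : y ≤ μ / C' := hyP ▸ le_mul_of_one_le_right hy.le hP
  have hyμ' : y ≤ μ := hyμ.trans (div_le_self hμ.le (by linarith))
  -- From here on `Λ`, `N`, `1 / κ`, and hence `m` and `u`, are bounded by powers of `1 / y`; eight
  -- factors `y` outweigh them with a power to spare.
  have hΛ : Λ ≤ 1 / y := by
    rw [hyΛ, Real.exp_neg, one_div, inv_inv]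
    linarith [Real.add_one_le_exp Λ]
  have h1 : N / κ ≤ 2 / y := by
    rw [le_div_iff₀ hy]
    have : 0 ≤ N / κ := by positivity
    nlinarith
  have hN' : N ≤ 2 / y := le_trans (by rw [le_div_iff₀ hκ]; nlinarith) h1
  have hκ' : 1 / κ ≤ 2 / y := le_trans (by gcongr) h1
  have hm' : m ≤ 331776 / y ^ 3 := by
    calc m ≤ 9 * Λ / ((κ / 2) ^ 2 / 2304) := hm
      _ = 82944 * (1 / κ) ^ 2 * Λ := by field_simp; ring
      _ ≤ 82944 * (2 / y) ^ 2 * (1 / y) := by gcongr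
      _ = 331776 / y ^ 3 := by field_simp; ring
  have hu' : u ≤ 663552 / y ^ 4 := by
    calc u = (n₁ + 1) * m := hu
      _ ≤ 2 / y * (331776 / y ^ 3) := by gcongr; linarith
      _ = 663552 / y ^ 4 := by field_simp; ring
  have hu0 : 0 ≤ u := by rw [hu]; positivity
  have hy1 : y ≤ 1 := hyμ'.trans hμ1
  have hμδ : μ ≤ 2 * δ := by
    have : 1 ≤ N / κ := by rw [le_div_iff₀ hκ]; linarith
    nlinarith
  constructor
  · calc u * (2 * (n₀ + 1)) * (10 * y ^ 8)
        ≤ 663552 / y ^ 4 * (2 * (2 / y)) * (10 * y ^ 8) := by gcongr; linarith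
      _ = 26542080 * y ^ 3 := by field_simp; ring
      _ ≤ 26542080 * y := by gcongr; exact pow_le_of_le_one hy.le hy1 (by norm_num)
      _ ≤ 26542080 * (μ / C') := by gcongr
      _ ≤ 26542080 * (2 * δ / C') := by gcongr
      _ ≤ δ / L := by
        rw [← mul_div_assoc, div_le_div_iff₀ hC0 (by linarith)]
        nlinarith
  · calc y ^ 8 * (u * P) ≤ y ^ 8 * (663552 / y ^ 4 * P) := by gcongr
      _ = 663552 * (y ^ 3 * (y * P)) := by field_simp
      _ ≤ 663552 * (1 * (y * P)) := by gcongr; exact pow_le_one₀ hy.le hy1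
      _ = 663552 * μ / C' := by rw [hyP]; ring
      _ < μ := by
        rw [div_lt_iff₀ hC0]
        nlinarith

end Accuracy

/-- The expression `max 1 l` gives layer `0` the tolerance of layer `1`, since source layers `0` and
`1` jointly realize the first target layer. -/
theorem sourceLaw_exists_mask_ge_of_width {L : ℕ} (hL : 1 ≤ L) {γ ε δ : ℝ} (hγ : 0 ≤ γ)
    (hε : 0 < ε) (hε1 : ε < 1) (hδ : 0 < δ) (hδ1 : δ < 1) {p q : ℕ → ℝ}
    (hp : ∀ l, 2 ≤ l → l ≤ L → p l ∈ Ioo (0 : ℝ) 1)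
    (hq : ∀ l, 2 ≤ l → l ≤ L → q l ∈ Ioo (0 : ℝ) 1) {n : ℕ → ℕ} (hn : ∀ l, l ≤ L → 1 ≤ n l)
    {θ : Param n L → ℝ} (hθ : ∀ e, |θ e| ≤ 1) {D : Set (Fin (n 0) → ℝ)} (hD : IsCompact D)
    {nS : ℕ → ℕ} (hout : n L ≤ nS L) {C' : ℝ} (hC' : 10 ^ 8 * (L : ℝ) ≤ C') {μ : ℕ → ℝ}
    (hμ : ∀ l, μ l = min (tol θ D ε (max 1 l)) (δ / rho θ D p q γ ε δ))
    (hw : ∀ l < L, 147456 * L / freeDensity p q l ^ 2 * Real.log (C' / μ l) * n l ≤ nS l)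
    (hw' : ∀ k, 2 ≤ k → k < L → ∀ l < k,
      147456 * L / freeDensity p q l ^ 2 * Real.log (nS k) * n l ≤ nS l) :
    ENNReal.ofReal (1 - δ) ≤ sourceLaw (srcWidth (n 0) nS) (L + 1) p q
      {ω | ∃ m : Param (srcWidth (n 0) nS) (L + 1) → Bool, Respects ω m ∧
        ∀ (i : Fin (n L)), ∀ x ∈ D,
          |netFun θ x i - netFun (masked ω m) x (Fin.castLE hout i)| < ε} := by
  have hL' : (1 : ℝ) ≤ L := by exact_mod_cast hL
  have hC3 : 3 ≤ C' := by linarith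
  have hC0 : 0 < C' := by linarith
  set N : ℝ := (Fintype.card (Param n L) : ℝ) with hNdef
  set κ := freeRatio L p q with hκdef
  have hκ : 0 < κ := freeRatio_pos hp hq
  have hκ1 : κ ≤ 1 := freeRatio_le_one
  have hnN : ∀ r < L, (n r : ℝ) + 1 ≤ N := fun r hr => by
    rw [hNdef]; exact_mod_cast succ_le_card_param hn hr
  have hnnN : ∀ r < L, (n (r + 1) : ℝ) * (n r + 1) ≤ N := fun r hr => by
    rw [hNdef]; exact_mod_cast mul_le_card_param (n := n) hr
  have hn1 : ∀ l, l ≤ L → (1 : ℝ) ≤ n l := fun l hl => by exact_mod_cast hn l hl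
  have hN : 1 ≤ N := by linarith [hnN 0 hL, hn1 0 (by omega)]
  have hρ : N / κ / 2 ≤ rho θ D p q γ ε δ := le_rho hγ hε hε1 hδ hL hn hp hq
  have hρ0 : 0 < rho θ D p q γ ε δ := lt_of_lt_of_le (by positivity) hρ
  have htol : ∀ l, 0 < tol θ D ε l := tol_pos hε hL (hn L le_rfl)
  have hμ0 : ∀ l, 0 < μ l := fun l => by rw [hμ]; exact lt_min (htol _) (by positivity)
  have hμtol : ∀ l, μ l ≤ tol θ D ε (max 1 l) := fun l => by rw [hμ]; exact min_le_left _ _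
  have hμ1 : ∀ l, μ l ≤ 1 := fun l => by
    linarith [hμtol l, tol_le_half (θ := θ) (D := D) hε hε1 hL (hn L le_rfl) (le_max_left 1 l)]
  have hμρ : ∀ l, N / κ * μ l ≤ 2 * δ := fun l => by
    have h1 : μ l ≤ δ / rho θ D p q γ ε δ := by rw [hμ]; exact min_le_right _ _
    rw [le_div_iff₀ hρ0] at h1
    nlinarith [hμ0 l]
  have hμN : ∀ l, N * μ l ≤ 2 * δ := fun l => by
    have h1 : N ≤ N / κ := by rw [le_div_iff₀ hκ]; nlinarith
    nlinarith [hμρ l, hμ0 l]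
  have hf : ∀ r < L, 0 < freeDensity p q r ∧ freeDensity p q r ≤ 1 := by
    intro r hr
    rcases r with _ | r
    · simp only [freeDensity]; norm_num
    · have h1 := hp (r + 2) (by omega) (by omega)
      have h2 := hq (r + 2) (by omega) (by omega)
      have h3 : 0 < 1 - p (r + 2) := by linarith [h1.2]
      have h4 : 0 < 1 - q (r + 2) := by linarith [h2.2]
      simp only [freeDensity]
      refine ⟨by positivity, ?_⟩
      nlinarith [h1.1, h2.1]
  have hnS : ∀ l < L, 1 ≤ nS l := fun l hl =>
    one_le_of_mul_log_le (div_pos (by positivity) (pow_pos (hf l hl).1 2)) hC3 (hμ0 l) (hμ1 l)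
      (hn l hl.le) (hw l hl)
  have hP : ∀ j, 1 ≤ ∏ k ∈ Finset.Ico j L, (nS k : ℝ) := fun j =>
    Finset.one_le_prod fun k hk => by exact_mod_cast hnS k (Finset.mem_Ico.1 hk).2
  -- The start `max 2 (r + 1)` leaves the width of layer `1` out of the precision of layer `0`; the
  -- thinned layer `1` is treated by `first_layer_bounds`.
  set Λ : ℕ → ℝ := fun r => logPrec nS L C' (μ r) (max 2 (r + 1)) with hΛ
  have hΛ1 : ∀ r, 1 ≤ Λ r := fun r => one_le_logPrec hC3 (hμ0 r) (hμ1 r) _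
  have hyP : ∀ r, Real.exp (-Λ r) * (∏ k ∈ Finset.Ico (max 2 (r + 1)) L, (nS k : ℝ)) =
      μ r / C' := fun r =>
    exp_neg_logPrec hC0 (hμ0 r) fun k hk => hnS k (Finset.mem_Ico.1 hk).2
  have hwΛ : ∀ r < L, 147456 / freeDensity p q r ^ 2 * Λ r * n r ≤ nS r := by
    intro r hr
    have h1 : 147456 * L / freeDensity p q r ^ 2 * n r * Λ r ≤ L * (nS r : ℝ) := by
      refine mul_logPrec_le (by omega) hL (Nat.cast_nonneg _) ?_ fun k hk hkL => ?_
      · linarith [hw r hr]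
      · linarith [hw' k (by omega) hkL r (by omega)]
    refine le_of_mul_le_mul_left (a := (L : ℝ)) (le_trans (le_of_eq ?_) h1) (by linarith)
    ring
  obtain ⟨m, hm⟩ : ∃ m : ℕ, 1 < L → 8 * Λ 1 ≤ freeDensity p q 1 ^ 2 / 2304 * m ∧
      m ≤ 9 * Λ 1 / (freeDensity p q 1 ^ 2 / 2304) := by
    by_cases h : 1 < L
    · have h1 := hf 1 h
      have h2 : freeDensity p q 1 ^ 2 ≤ 1 := pow_le_one₀ h1.1.le h1.2
      obtain ⟨m, hm⟩ := exists_nat_mul_between (a := freeDensity p q 1 ^ 2 / 2304)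
        (div_pos (pow_pos h1.1 2) (by norm_num)) (by linarith) (hΛ1 1)
      exact ⟨m, fun _ => hm⟩
    · exact ⟨0, fun h' => absurd h' h⟩
  -- The case `r = L` comes first, so that for `L = 1` layer `1` is the output layer. Frozen hidden
  -- layers use all neurons, because locked incoming weights may keep a neuron active.
  set U : ℕ → ℕ := fun r => if r = L then n L else if r = 1 then (n 1 + 1) * m else nS r with hU
  have hUL : U L = n L := by simp [hU]
  have hU1 : 1 < L → U 1 = (n 1 + 1) * m := fun h => by simp [hU, h.ne]
  have hUr : ∀ r, 2 ≤ r → r < L → U r = nS r := fun r hr hrL => by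
    simp [hU, hrL.ne, show r ≠ 1 by omega]
  have hU1S : U 1 ≤ nS 1 := by
    rcases hL.eq_or_lt with h | h
    · subst h; rw [hUL]; exact hout
    · have h1 := (hm h).2
      have hf1 := (hf 1 h).1
      have h2 : ((n 1 : ℝ) + 1) * m ≤ nS 1 := by
        calc ((n 1 : ℝ) + 1) * m
            ≤ (n 1 + n 1) * (9 * Λ 1 / (freeDensity p q 1 ^ 2 / 2304)) := by
              gcongr; exact hn1 1 h.le
          _ = 41472 / freeDensity p q 1 ^ 2 * Λ 1 * n 1 := by field_simp; ring
          _ ≤ 147456 / freeDensity p q 1 ^ 2 * Λ 1 * n 1 := by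
              have := hΛ1 1
              gcongr; norm_num
          _ ≤ nS 1 := hwΛ 1 h
      rw [hU1 h]
      exact_mod_cast h2
  have hrate : ∀ r < L, Real.exp (-rate p q (groupSize n nS U) r) ≤ Real.exp (-Λ r) ^ 8 := by
    intro r hr
    rw [← Real.exp_nat_mul, Real.exp_le_exp]
    have hfr := hf r hr
    have hnr := hn1 r hr.le
    have hwr := hwΛ r hr
    have hΛr := hΛ1 r
    suffices h : 8 * Λ r ≤ rate p q (groupSize n nS U) r by push_cast; linarith
    rcases r with _ | _ | r
    -- There are `2 * (n 0 + 1) ≤ 4 * n 0` groups, and `147456 = 4 * 16 * 2304`.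
    · refine le_rate_of_le hfr.1 hfr.2 hΛr (by positivity) (le_trans ?_ hwr)
      calc 16 * 2304 / freeDensity p q 0 ^ 2 * Λ 0 * ((2 * (n 0 + 1) : ℕ) : ℝ)
          ≤ 16 * 2304 / freeDensity p q 0 ^ 2 * Λ 0 * (4 * n 0) := by
            gcongr; push_cast; linarith
        _ = 147456 / freeDensity p q 0 ^ 2 * Λ 0 * n 0 := by ring
    · have h1 : groupSize n nS U 1 = m := by
        change U 1 / (n 1 + 1) = m
        rw [hU1 hr, Nat.mul_div_cancel_left _ (Nat.succ_pos _)]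
      change 8 * Λ 1 ≤ freeDensity p q 1 ^ 2 * (groupSize n nS U 1 : ℝ) / 2304
      rw [h1, mul_div_right_comm]
      exact (hm hr).1
    · have h1 : groupSize n nS U (r + 2) = nS (r + 2) / (n (r + 2) + 1) := by
        change U (r + 2) / (n (r + 2) + 1) = _
        rw [hUr (r + 2) (by omega) hr]
      change 8 * Λ (r + 2) ≤
        freeDensity p q (r + 2) ^ 2 * (groupSize n nS U (r + 2) : ℝ) / 2304
      rw [h1]
      refine le_rate_of_le hfr.1 hfr.2 hΛr (by positivity) (le_trans ?_ hwr)
      have hnr' : (1 : ℝ) ≤ n (r + 2) := hnr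
      calc 16 * 2304 / freeDensity p q (r + 2) ^ 2 * Λ (r + 2) * ((n (r + 2) + 1 : ℕ) : ℝ)
          ≤ 16 * 2304 / freeDensity p q (r + 2) ^ 2 * Λ (r + 2) * (4 * n (r + 2)) := by
            gcongr; push_cast; linarith
        _ = 147456 / freeDensity p q (r + 2) ^ 2 * Λ (r + 2) * n (r + 2) := by ring
  have hprod : ∀ j, 2 ≤ j → ∏ k ∈ Finset.Ico j L, (U k : ℝ) = ∏ k ∈ Finset.Ico j L, (nS k : ℝ) :=
    fun j hj => Finset.prod_congr rfl fun k hk => by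
      rw [hUr k (hj.trans (Finset.mem_Ico.1 hk).1) (Finset.mem_Ico.1 hk).2]
  have hlater : ∀ r, r + 2 ≤ L → (U (r + 2) : ℝ) * ((n (r + 1) : ℝ) + 1) ≤
      N * ∏ k ∈ Finset.Ico (r + 2) L, (nS k : ℝ) := by
    intro r hr
    rcases hr.eq_or_lt with h | h
    · subst h
      rw [hUL, Finset.Ico_self, Finset.prod_empty, mul_one]
      exact hnnN (r + 1) (by omega)
    · rw [hUr _ (by omega) h, Finset.prod_eq_prod_Ico_succ_bot h, mul_comm]
      have h1 := hnN (r + 1) (by omega)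
      have h2 := hP (r + 2 + 1)
      gcongr
      exact le_mul_of_one_le_right (Nat.cast_nonneg _) h2
  have hfirst : (U 1 : ℝ) * (2 * ((n 0 : ℝ) + 1)) * (10 * Real.exp (-Λ 0) ^ 8) ≤ δ / L ∧
      Real.exp (-Λ 0) ^ 8 * (∏ k ∈ Finset.Ico 1 L, (U k : ℝ)) < tol θ D ε 1 := by
    have hyP0 := hyP 0
    have hμt := hμtol 0
    rcases hL.eq_or_lt with h | h
    · have hP2 := hP 2
      have h1 : (n 1 : ℝ) * (n 0 + 1) ≤ N := hnnN 0 hL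
      have h2 : U 1 = n 1 := by rw [h, hUL]
      rw [Finset.Ico_eq_empty (by omega), Finset.prod_empty] at hyP0 hP2
      rw [h2, Finset.Ico_eq_empty (by omega), Finset.prod_empty]
      constructor
      -- The two signs double the number of events; doubling `N`, `δ` and `L` together leaves `δ /
      -- L` unchanged.
      · have h3 := mul_exp_le_of_card_le (N := 2 * N) (δ := 2 * δ) (L := 2 * L)
          (X := n 1 * (2 * (n 0 + 1))) (Real.exp_pos _) hP2 hyP0 (hμ1 0) (by linarith)
          (by linarith) (by linarith) (by linarith [hμN 0]) (by positivity) (by linarith)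
        rwa [mul_div_mul_left _ _ (two_ne_zero)] at h3
      · have h3 : Real.exp (-Λ 0) ^ 8 ≤ Real.exp (-Λ 0) :=
          pow_le_of_le_one (Real.exp_pos _).le
            (Real.exp_le_one_iff.2 (by linarith [hΛ1 0])) (by norm_num)
        have h4 : μ 0 / C' < μ 0 := div_lt_self (hμ0 0) (by linarith)
        have h5 : μ 0 ≤ tol θ D ε 1 := hμt
        linarith
    · have hf1 : freeDensity p q 1 = (1 - p 2) * (1 - q 2) / 2 := rfl
      -- The size of layer `1` is chosen through `Λ 1` but has to be compared with the accuracy `exp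
      -- (-Λ 0)`; both have the same tolerance and the same later layers.
      have hΛ01 : Λ 0 = Λ 1 := by simp [hΛ, hμ]
      have hκ2 : κ ≤ (1 - p 2) * (1 - q 2) := freeRatio_le le_rfl (by omega)
      have hκ21 : (1 - p 2) * (1 - q 2) ≤ 1 := by
        have h1 := hp 2 le_rfl (by omega)
        have h2 := hq 2 le_rfl (by omega)
        nlinarith [h1.1, h1.2, h2.1, h2.2]
      have h3 : N / ((1 - p 2) * (1 - q 2)) * μ 0 ≤ 2 * δ := by
        refine le_trans ?_ (hμρ 0)
        have := hμ0 0
        gcongr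
      have hmm := (hm h).2
      rw [hf1, ← hΛ01] at hmm
      have h4 := first_layer_bounds (u := U 1) (by linarith [hΛ1 0]) rfl (hP 2) hyP0 (hμ0 0)
        (hμ1 0) hL' hC' (hκ.trans_le hκ2) hδ1.le h3 hκ21 hN (Nat.cast_nonneg m) hmm
        (by rw [hU1 h]; push_cast; ring) (Nat.cast_nonneg (n 0)) (Nat.cast_nonneg (n 1))
        (hnN 0 hL) (hnN 1 h)
      refine ⟨h4.1, ?_⟩
      rw [Finset.prod_eq_prod_Ico_succ_bot h, hprod 2 le_rfl]
      exact h4.2.trans_le hμt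
  refine sourceLaw_exists_mask_ge hL hε hδ.le hp hq (hn L le_rfl) hθ hD hout hUr hUL hU1S ?_ ?_ ?_
  · refine le_trans ?_ hfirst.1
    gcongr
    exact hrate 0 hL
  · intro r hr
    refine le_trans ?_ (mul_exp_le_of_card_le (Real.exp_pos _) (hP _) (hyP (r + 1)) (hμ1 _) hL'
      (by linarith) hδ (hμN _) (X := (U (r + 2) : ℝ) * ((n (r + 1) : ℝ) + 1)) (by positivity) ?_)
    · gcongr
      exact hrate (r + 1) hr
    · rw [show max 2 (r + 1 + 1) = r + 2 by omega]
      exact hlater r hr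
  · intro r hr
    have hUP : (0 : ℝ) ≤ ∏ k ∈ Finset.Ico (r + 1) L, (U k : ℝ) :=
      Finset.prod_nonneg fun _ _ => Nat.cast_nonneg _
    refine lt_of_le_of_lt (mul_le_mul_of_nonneg_right (hrate r hr) hUP) ?_
    rcases r with _ | r
    · exact hfirst.2
    · rw [hprod _ (by omega)]
      have h1 := hyP (r + 1)
      have h2 := hP (r + 2)
      have h3 := hμtol (r + 1)
      rw [show max 2 (r + 1 + 1) = r + 2 by omega] at h1
      rw [show max 1 (r + 1) = r + 1 by omega] at h3
      refine exp_mul_prod_lt_of_tol (Real.exp_pos _) h2 h1 (hμ0 _) (hμ1 _) hC3 hδ1 (hμN _)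
        (htol _) h3 ?_
      refine (tol_succ_ge hε hL (hn L le_rfl) hθ hD (by omega)).trans ?_
      have := htol (r + 1 + 1)
      gcongr
      exact hnN _ hr

end Widths

end FrozenNet

theorem mainTheorem3 (L : ℕ) (hL : 1 ≤ L) :
    ∃ (C₀ C₀' C' : ℝ) (C : ℝ → ℝ → ℝ), 0 < C₀ ∧ 0 < C₀' ∧ 0 < C' ∧
      (∀ a b : ℝ, a ∈ Set.Ioo (0 : ℝ) 1 → b ∈ Set.Ioo (0 : ℝ) 1 → 0 < C a b) ∧
      ∀ (γ ε δ : ℝ), 0 ≤ γ → ε ∈ Set.Ioo (0 : ℝ) 1 → δ ∈ Set.Ioo (0 : ℝ) 1 →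
      -- pruning and locking ratios of the frozen layers
      ∀ (p q : ℕ → ℝ),
        (∀ l, 2 ≤ l → l ≤ L → p l ∈ Set.Ioo (0 : ℝ) 1 ∧ q l ∈ Set.Ioo (0 : ℝ) 1) →
      -- target network and data
      ∀ (nT : ℕ → ℕ), (∀ l, l ≤ L → 1 ≤ nT l) →
      ∀ (θT : FrozenNet.Param nT L → ℝ), (∀ e, |θT e| ≤ 1) →
      ∀ (D : Set (Fin (nT 0) → ℝ)), IsCompact D →
      -- widths of the source network
      ∀ (nS : ℕ → ℕ) (hout : nT L ≤ nS L),
        C₀ * Real.log (C₀' / min (FrozenNet.tol θT D ε 1) (δ / FrozenNet.rho θT D p q γ ε δ)) *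
            (nT 0 : ℝ) ≤ (nS 0 : ℝ) →
        (∀ l, 1 ≤ l → l < L →
          C (p (l + 1)) (q (l + 1)) *
              Real.log (C' / min (FrozenNet.tol θT D ε l) (δ / FrozenNet.rho θT D p q γ ε δ)) *
              (nT l : ℝ) ≤ (nS l : ℝ)) →
        -- no frozen hidden layer is exponentially wider than an earlier layer
        (∀ k, 2 ≤ k → k < L →
          C₀ * Real.log (nS k) * (nT 0 : ℝ) ≤ (nS 0 : ℝ) ∧
          ∀ l, 1 ≤ l → l < k →
            C (p (l + 1)) (q (l + 1)) * Real.log (nS k) * (nT l : ℝ) ≤ (nS l : ℝ)) →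
        ENNReal.ofReal (1 - δ) ≤
          FrozenNet.sourceLaw (FrozenNet.srcWidth (nT 0) nS) (L + 1) p q
            {ω | ∃ m : FrozenNet.Param (FrozenNet.srcWidth (nT 0) nS) (L + 1) → Bool,
              FrozenNet.Respects ω m ∧
              ∀ (i : Fin (nT L)), ∀ x ∈ D,
                |FrozenNet.netFun θT x i -
                  FrozenNet.netFun (FrozenNet.masked ω m) x (Fin.castLE hout i)| < ε} := by
  have hL' : (1 : ℝ) ≤ L := by exact_mod_cast hL
  -- The width constants are `147456 * L` over the squared density of the available summands: `1 /
  -- 8` for two-layer paths, `(1 - a) * (1 - b) / 2` for free weights of a frozen layer.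
  refine ⟨147456 * L / (1 / 8) ^ 2, 10 ^ 8 * L, 10 ^ 8 * L,
    fun a b => 147456 * L / ((1 - a) * (1 - b) / 2) ^ 2, by positivity, by positivity,
    by positivity, fun a b ha hb => ?_, ?_⟩
  · have h1 : 0 < 1 - a := by linarith [ha.2]
    have h2 : 0 < 1 - b := by linarith [hb.2]
    positivity
  · intro γ ε δ hγ hε hδ p q hpq nT hnT θT hθT D hD nS hout h0 hw hw'
    refine FrozenNet.sourceLaw_exists_mask_ge_of_width hL hγ hε.1 hε.2 hδ.1 hδ.2
      (fun l h2 hl => (hpq l h2 hl).1) (fun l h2 hl => (hpq l h2 hl).2) hnT hθT hD hout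
      (C' := 10 ^ 8 * L) le_rfl (fun l => rfl) ?_ ?_
    · rintro (_ | l) hl
      · exact h0
      · have h := hw (l + 1) (by omega) hl
        rwa [show max 1 (l + 1) = l + 1 by omega]
    · rintro k hk hkL (_ | l) hl
      · exact (hw' k hk hkL).1
      · exact (hw' k hk hkL).2 (l + 1) (by omega) hl
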